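/- Let $S$ be a finite metric space with $n$ points and distance $d$, and let $k<n$. A $k$-clustering is a partition $C_1,\dots,C_k$ of $S$; with centers $c_1,\dots,c_k\in S$ its $k$-median cost under a function $d'$ is $\sum_i\sum_{p\in C_i}d'(p,c_i)$, and it is optimal under $d'$ if, for suitable centers, this cost is minimal among all $k$-clusterings and all choices of centers. A $k$-clustering $\mathcal C'$ is $\epsilon$-close to $\mathcal C$ if $\min_{\sigma\in\mathcal S_k}\sum_{i}|C_i\setminus C'_{\sigma(i)}|\le\epsilon n$. Let $\mathcal C=\{C_1,\dots,C_k\}$ be an optimal $k$-clustering under $d$ such that the instance is $(\alpha,\epsilon)$-perturbation resilient: for every $d':S\times S\to\mathbb R_{\ge0}$ with $d\le d'\le\alpha d$ pointwise, every optimal $k$-clustering under $d'$ is $\epsilon$-close to $\mathcal C$. Consider the following algorithm, with input $S$ (as a list), $d$, $k$, $m=\min_i|C_i|$ and $\epsilon$. Write $\mathbb B=\mathbb B(p,r)=\{x: d(x,p)\le r\}$. *Phase 1 (approximate closure linkage).* Start with the clustering of $S$ into singletons. Go through all ordered pairs $(p,q)$ in ascending order of $d(p,q)$. Put $r=d(p,q)$,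 and let $U$ be the set of current clusters that meet $\mathbb B$ and have at most $\epsilon n$ points outside $\mathbb B$. Merge all clusters in $U$ into one if $|U|>1$, $|\bigcup U|\ge m-\epsilon n$, $|\bigcup U\setminus\mathbb B|\le\epsilon n$, and there is $E\subseteq S\setminus\mathbb B$ with $|E|\le\epsilon n$ such that $d(p_1,p_2)<d(p_1,q_1)$ for all $p_1,p_2\in\mathbb B$ and $q_1\in S\setminus(\mathbb B\cup E)$. The merges form a tree whose leaves are the points. *Phase 2 (cleaning).* Turn every node all of whose children are single points into a leaf. Then remove each remaining single point $p$ from its place and add it to the non-singleton leaf $L$ (as it was before any such addition) that minimizes the median of $\{d(p,q):q\in L\}$. The result is the tree $\tilde T$. *Phase 3 (dynamic programming).* Make $\tilde T$ binary by merging the children of each node one after another, and output, with centers, a pruning of this binary tree into exactly $k$ clusters that has minimal $k$-median cost (computed bottom-up from the optimal costs of the prunings of subtrees into $1,\dots,k$ clusters). Put $\rho=(\min_i|C_i|-15)/n$, and suppose that $\alpha>2+\sqrt7$ and $\epsilon\le\rho/5$. Then the algorithm runs in time bounded by a fixed polynomial in $n$ (counting elementary steps, with unit-cost operations on real numbers),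 and the tree $\tilde T$ has a pruning into $k$ clusters that is $\epsilon$-close to $\mathcal C$. Moreover, for every $\epsilon'\in[0,1]$ with $\epsilon\le\rho\epsilon'/5$, the algorithm outputs a $k$-clustering with centers whose $k$-median cost under $d$ is at most $(1+\epsilon')$ times the optimal cost. -/

import Mathlib

universe u v

namespace KMedian

/-! ### Clusterings, the k-median objective, perturbation resilience -/

section Objective

variable {X : Type u} [Fintype X] [DecidableEq X]

/-- The `i`-th cluster of the clustering `f : X → Fin k` (`f x` is the index of the cluster of `x`). -/
def cluster {k : ℕ} (f : X → Fin k) (i : Fin k) : Finset X :=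
  Finset.univ.filter (fun x => f x = i)

/-- The k-median objective: every point `x` pays its distance (under `d`) to the center of its
cluster. The function `d` need not be a metric, since perturbed distances are plugged in. -/
def cost (d : X → X → ℝ) {k : ℕ} (f : X → Fin k) (c : Fin k → X) : ℝ :=
  ∑ i, ∑ x ∈ cluster f i, d x (c i)

/-- `f` is an optimal k-clustering under `d`: with suitable centers its cost is minimal among
all k-clusterings and all choices of centers. -/
def IsOptimal (d : X → X → ℝ) {k : ℕ} (f : X → Fin k) : Prop :=
  ∃ c : Fin k → X, ∀ (g : X → Fin k) (b : Fin k → X), cost d f c ≤ cost d g b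

/-- `g` is `ε`-close to `f`. -/
def IsClose (ε : ℝ) {k : ℕ} (f g : X → Fin k) : Prop :=
  ∃ σ : Equiv.Perm (Fin k),
    ((∑ i, (cluster f i \ cluster g (σ i)).card : ℕ) : ℝ) ≤ ε * (Fintype.card X : ℝ)

/-- The instance `(X, d)` with optimal k-clustering `f` is `(α, ε)`-perturbation resilient:
every optimal clustering under every `α`-perturbation of `d` is `ε`-close to `f`. -/
def IsResilient (d : X → X → ℝ) {k : ℕ} (α ε : ℝ) (f : X → Fin k) : Prop :=
  IsOptimal d f ∧
    ∀ d' : X → X → ℝ, (∀ p q, d p q ≤ d' p q ∧ d' p q ≤ α * d p q) →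
      ∀ g : X → Fin k, IsOptimal d' g → IsClose ε f g

/-- The size of the smallest cluster. -/
noncomputable def minClusterSize {k : ℕ} (f : X → Fin k) : ℕ :=
  ⨅ i, (cluster f i).card

/-- `ρ = (min |C_i| - 15) / n`. -/
noncomputable def rho {k : ℕ} (f : X → Fin k) : ℝ :=
  ((minClusterSize f : ℝ) - 15) / (Fintype.card X : ℝ)

/-- The clustering `f` with centers `c` is an `r`-approximation to the optimal k-median cost. -/
def IsApproximation (d : X → X → ℝ) (r : ℝ) {k : ℕ} (f : X → Fin k) (c : Fin k → X) : Prop :=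
  ∀ (g : X → Fin k) (b : Fin k → X), cost d f c ≤ r * cost d g b

/-- The approximate closure condition for the ball of center `p` and radius `r`, where `u` is the
union of the clusters of the current clustering that are nearly contained in the ball,
`δ` stands for `ε n` and `m` for the size of the smallest optimal cluster. -/
def ApproxClosure (d : X → X → ℝ) (δ : ℝ) (m : ℕ) (p : X) (r : ℝ) (u : Finset X) : Prop :=
  (m : ℝ) - δ ≤ (u.card : ℝ) ∧
  (({x ∈ u | ¬ d x p ≤ r} : Finset X).card : ℝ) ≤ δ ∧
  ∃ E : Finset X, (∀ x ∈ E, ¬ d x p ≤ r) ∧ (E.card : ℝ) ≤ δ ∧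
    ∀ p₁ p₂ q₁ : X, d p₁ p ≤ r → d p₂ p ≤ r → ¬ d q₁ p ≤ r → q₁ ∉ E → d p₁ p₂ < d p₁ q₁

end Objective

/-! ### The cost model

Real-number RAM with unit cost. `Timed A` is a result together with the number of steps spent on it.
All work on the data goes through the procedures of this section: one step is charged for every
elementary operation `op` (reading a distance, an arithmetic operation or comparison on real or natural
numbers, an equality test of two points, a Boolean connective, building a pair, a list cell or a tree node;
never more than a fixed number of these together) and for every call of a recursive procedure. -/

section CostModel

/-- A value together with the number of elementary steps spent to compute it. -/
structure Timed (A : Type v) where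
  val : A
  cost : ℕ

variable {A : Type u} {B : Type v}

/-- One elementary operation. -/
def op (a : A) : Timed A := ⟨a, 1⟩

/-- Run `t` and charge one further step. -/
def call (t : Timed A) : Timed A := ⟨t.val, t.cost + 1⟩

/-- Sequential composition: the costs add up. -/
def Timed.bind (t : Timed A) (f : A → Timed B) : Timed B :=
  ⟨(f t.val).val, t.cost + (f t.val).cost⟩

def mapT (f : A → Timed B) : List A → Timed (List B)
  | [] => op []
  | a :: l => call ((f a).bind fun b => (mapT f l).bind fun l' => op (b :: l'))

def foldT (f : B → A → Timed B) (b : B) : List A → Timed B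
  | [] => op b
  | a :: l => call ((f b a).bind fun b' => foldT f b' l)

/-- Split a list into the elements that pass a test and those that do not. -/
def splitT (t : A → Timed Bool) : List A → Timed (List A × List A)
  | [] => op ([], [])
  | a :: l => call ((t a).bind fun b => (splitT t l).bind fun s =>
      op (if b then (a :: s.1, s.2) else (s.1, a :: s.2)))

def anyT (t : A → Timed Bool) : List A → Timed Bool
  | [] => op false
  | a :: l => call ((t a).bind fun b => (anyT t l).bind fun b' => op (b || b'))

def allT (t : A → Timed Bool) : List A → Timed Bool
  | [] => op true
  | a :: l => call ((t a).bind fun b => (allT t l).bind fun b' => op (b && b'))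

def lengthT : List A → Timed ℕ
  | [] => op 0
  | _ :: l => call ((lengthT l).bind fun n => op (n + 1))

def appendT : List A → List A → Timed (List A)
  | [], l => op l
  | a :: k, l => call ((appendT k l).bind fun s => op (a :: s))

def nthT : List A → ℕ → Timed (Option A)
  | [], _ => op none
  | a :: _, 0 => op (some a)
  | _ :: l, n + 1 => call (nthT l n)

/-- The list `[a, a + 1, …, a + n - 1]`. -/
def rangeT (a : ℕ) : ℕ → Timed (List ℕ)
  | 0 => op []
  | n + 1 => call ((op (a + 1)).bind fun a' => (rangeT a' n).bind fun l => op (a :: l))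

def memT [DecidableEq A] (x : A) (l : List A) : Timed Bool :=
  anyT (fun y => op (decide (x = y))) l

/-- Insertion into a list sorted by the key `key`. -/
noncomputable def insertT (key : A → ℝ) (a : A) : List A → Timed (List A)
  | [] => op [a]
  | b :: l => call ((op (decide (key a ≤ key b))).bind fun c =>
      if c then op (a :: b :: l) else (insertT key a l).bind fun l' => op (b :: l'))

/-- Sorting in ascending order of the key `key`. -/
noncomputable def sortT (key : A → ℝ) : List A → Timed (List A)
  | [] => op []
  | a :: l => call ((sortT key l).bind fun l' => insertT key a l')

def pairsT (l₁ l₂ : List A) : Timed (List (A × A)) :=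
  foldT (fun acc a => (mapT (fun b => op (a, b)) l₂).bind fun row => appendT row acc) [] l₁

theorem splitT_val (t : A → Timed Bool) (l : List A) :
    (splitT t l).val = (l.filter (fun a => (t a).val), l.filter (fun a => !(t a).val)) := by
  induction l with
  | nil => rfl
  | cons a l ih =>
    simp only [splitT, call, Timed.bind, op, ih, List.filter_cons]
    cases (t a).val <;> simp

theorem anyT_val (t : A → Timed Bool) (l : List A) :
    (anyT t l).val = l.any (fun a => (t a).val) := by
  induction l with
  | nil => rfl
  | cons a l ih => simp only [anyT, call, Timed.bind, op, ih, List.any_cons]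

theorem lengthT_val (l : List A) : (lengthT l).val = l.length := by
  induction l with
  | nil => rfl
  | cons a l ih => simp only [lengthT, call, Timed.bind, op, ih, List.length_cons]

end CostModel

/-! ### Trees of clusters and their prunings -/

section Trees

/-- A hierarchical clustering: a leaf carries a cluster, a node has a list of subtrees.
In the initial tree the leaves are single points. -/
inductive CTree (X : Type u) where
  | leaf (c : List X) : CTree X
  | node (ts : List (CTree X)) : CTree X

variable {X : Type u}

mutual
/-- The cluster represented by the root of a tree. -/
def CTree.points : CTree X → List X
  | .leaf c => c
  | .node ts => pointsAll ts
def pointsAll : List (CTree X) → List X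
  | [] => []
  | t :: ts => t.points ++ pointsAll ts
end

mutual
/-- `IsPruning t P`: the clusters in `P` are those of the roots of disjoint subtrees of `t` that together
cover all leaves of `t`. -/
inductive IsPruning : CTree X → List (List X) → Prop
  | whole (t : CTree X) : IsPruning t [t.points]
  | split {ts : List (CTree X)} {P : List (List X)} : IsPruningAll ts P → IsPruning (.node ts) P
inductive IsPruningAll : List (CTree X) → List (List X) → Prop
  | nil : IsPruningAll [] []
  | cons {t : CTree X} {ts : List (CTree X)} {P Q : List (List X)} :
      IsPruning t P → IsPruningAll ts Q → IsPruningAll (t :: ts) (P ++ Q)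
end

mutual
/-- Step-counted computation of `CTree.points`. -/
def CTree.pointsT : CTree X → Timed (List X)
  | .leaf c => op c
  | .node ts => call (pointsAllT ts)
def pointsAllT : List (CTree X) → Timed (List X)
  | [] => op []
  | t :: ts => call (t.pointsT.bind fun a => (pointsAllT ts).bind fun b => appendT a b)
end

end Trees

/-! ### The algorithm -/

/-- The input: a list of the points, the distance function, the number `k` of clusters, the size `m`
of the smallest optimal cluster, and `ε`. -/
structure Input (X : Type u) where
  pts : List X
  d : X → X → ℝ
  k : ℕ
  m : ℕ
  ε : ℝ

section Linkage

variable {X : Type u} (I : Input X)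

/-- `ε n` -/
noncomputable def slackT : Timed ℝ :=
  (lengthT I.pts).bind fun n => op (I.ε * (n : ℝ))

/-- Is `x` in the ball of center `p` and radius `r`? -/
noncomputable def inBallT (p : X) (r : ℝ) (x : X) : Timed Bool :=
  (op (I.d x p)).bind fun t => op (decide (t ≤ r))

/-- Is the cluster of the tree `t` nearly contained in the ball, i.e. does it meet the ball and have
at most `δ` points outside? -/
noncomputable def nearlyInT (δ : ℝ) (p : X) (r : ℝ) (t : CTree X) : Timed Bool :=
  t.pointsT.bind fun c =>
  (splitT (inBallT I p r) c).bind fun s =>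
  (lengthT s.1).bind fun i =>
  (lengthT s.2).bind fun o =>
  op (decide (0 < i) && decide ((o : ℝ) ≤ δ))

/-- Do some `p₁, p₂` in the ball satisfy `d p₁ q₁ ≤ d p₁ p₂`? -/
noncomputable def violatesT (ball : List X) (q₁ : X) : Timed Bool :=
  anyT (fun p₁ => anyT (fun p₂ =>
    (op (I.d p₁ p₂)).bind fun a => (op (I.d p₁ q₁)).bind fun b => op (decide (b ≤ a))) ball) ball

/-- Check of the approximate closure condition; the margin condition is checked by marking all points
outside the ball that violate it together with two points of the ball. -/
noncomputable def approxClosureT (δ : ℝ) (p : X) (r : ℝ) (u : List X) : Timed Bool :=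
  (splitT (inBallT I p r) I.pts).bind fun s =>
  (splitT (inBallT I p r) u).bind fun su =>
  (splitT (violatesT I s.1) s.2).bind fun marked =>
  (lengthT u).bind fun a =>
  (lengthT su.2).bind fun b =>
  (lengthT marked.1).bind fun e =>
  op (decide ((I.m : ℝ) - δ ≤ (a : ℝ)) && (decide ((b : ℝ) ≤ δ) && decide ((e : ℝ) ≤ δ)))

/-- The check is correct: it decides the approximate closure condition. -/
theorem approxClosureT_val [Fintype X] [DecidableEq X] (hnd : I.pts.Nodup) (hall : ∀ x, x ∈ I.pts)
    (δ : ℝ) (p : X) (r : ℝ) (u : List X) (hu : u.Nodup) :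
    (approxClosureT I δ p r u).val = true ↔ ApproxClosure I.d δ I.m p r u.toFinset := by
  have hb : ∀ x, (inBallT I p r x).val = decide (I.d x p ≤ r) := fun x => rfl
  have hv : ∀ (l : List X) q, (violatesT I l q).val = true ↔
      ∃ p₁ ∈ l, ∃ p₂ ∈ l, I.d p₁ q ≤ I.d p₁ p₂ := by
    intro l q
    simp only [violatesT, anyT_val, Timed.bind, op, List.any_eq_true]
    exact ⟨fun ⟨a, ha, b, hb, h⟩ => ⟨a, ha, b, hb, of_decide_eq_true h⟩,
      fun ⟨a, ha, b, hb, h⟩ => ⟨a, ha, b, hb, decide_eq_true h⟩⟩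
  have hcard : ∀ (t : X → Bool) (l : List X), l.Nodup →
      (l.filter t).length = (l.toFinset.filter (fun x => t x = true)).card := by
    intro t l hl
    rw [← List.toFinset_filter, List.toFinset_card_of_nodup (hl.filter _)]
  have huniv : I.pts.toFinset = Finset.univ := by
    ext x
    simp [hall x]
  simp only [approxClosureT, Timed.bind, op, splitT_val, lengthT_val, hb, Bool.and_eq_true,
    decide_eq_true_eq, ApproxClosure]
  refine and_congr ?_ (and_congr ?_ ?_)
  · rw [List.toFinset_card_of_nodup hu]
  · rw [hcard _ _ hu]
    simp
  · rw [List.filter_filter, hcard _ _ hnd, huniv]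
    constructor
    · intro h
      refine ⟨_, ?_, h, ?_⟩
      · intro x hx
        have hx' := (Finset.mem_filter.mp hx).2
        simp only [Bool.and_eq_true, Bool.not_eq_true', decide_eq_false_iff_not] at hx'
        exact hx'.2
      · intro p₁ p₂ q₁ h₁ h₂ hq hE
        by_contra hlt
        apply hE
        simp only [Finset.mem_filter, Finset.mem_univ, true_and, Bool.and_eq_true, Bool.not_eq_true',
          decide_eq_false_iff_not]
        refine ⟨(hv _ _).mpr ⟨p₁, ?_, p₂, ?_, not_lt.mp hlt⟩, hq⟩ <;>
          simp [List.mem_filter, hall, h₁, h₂]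
    · rintro ⟨E, -, hcardE, hE⟩
      refine le_trans ?_ hcardE
      norm_cast
      apply Finset.card_le_card
      intro q hq
      simp only [Finset.mem_filter, Finset.mem_univ, true_and, Bool.and_eq_true, Bool.not_eq_true',
        decide_eq_false_iff_not] at hq
      obtain ⟨p₁, h₁, p₂, h₂, hle⟩ := (hv _ _).mp hq.1
      by_contra hqE
      have h₁' := (List.mem_filter.mp h₁).2
      have h₂' := (List.mem_filter.mp h₂).2
      exact absurd (hE p₁ p₂ q (by simpa using h₁') (by simpa using h₂') hq.2 hqE) (not_lt.mpr hle)

/-- One round of the linkage: the ball of center `p` and radius `d p q` is examined, and if the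
conditions hold, the clusters (trees) nearly contained in it are merged. -/
noncomputable def linkT (δ : ℝ) (F : List (CTree X)) (pq : X × X) : Timed (List (CTree X)) :=
  (op (I.d pq.1 pq.2)).bind fun r =>
  (splitT (nearlyInT I δ pq.1 r) F).bind fun s =>
  (pointsAllT s.1).bind fun u =>
  (approxClosureT I δ pq.1 r u).bind fun ok =>
  (lengthT s.1).bind fun j =>
  op (if ok && decide (1 < j) then .node s.1 :: s.2 else F)

/-- First phase: start with singletons, go through all pairs in ascending order of the distance.
(The list of the remaining trees is closed to one tree at the end.) -/
noncomputable def linkageT : Timed (CTree X) :=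
  (slackT I).bind fun δ =>
  (pairsT I.pts I.pts).bind fun pairs =>
  (sortT (fun pq => I.d pq.1 pq.2) pairs).bind fun sorted =>
  (mapT (fun x => op (.leaf [x])) I.pts).bind fun F₀ =>
  (foldT (linkT I δ) F₀ sorted).bind fun F =>
  op (match F with
    | [t] => t
    | ts => .node ts)

end Linkage

section Cleaning

variable {X : Type u} (I : Input X)

/-- Is the cluster a single point? -/
def isSingle : List X → Bool
  | [_] => true
  | _ => false

/-- Is the tree a singleton leaf? -/
def CTree.isSingleLeaf : CTree X → Bool
  | .leaf c => isSingle c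
  | .node _ => false

mutual
/-- A node all of whose children are singleton leaves becomes a leaf. -/
def CTree.collapseT : CTree X → Timed (CTree X)
  | .leaf c => op (.leaf c)
  | .node ts => call ((allT (fun t => op t.isSingleLeaf) ts).bind fun b =>
      if b then (pointsAllT ts).bind fun c => op (.leaf c)
      else (collapseAllT ts).bind fun ts' => op (.node ts'))
def collapseAllT : List (CTree X) → Timed (List (CTree X))
  | [] => op []
  | t :: ts => call (t.collapseT.bind fun t' => (collapseAllT ts).bind fun ts' => op (t' :: ts'))
end

mutual
/-- The clusters of the leaves of a tree. -/
def CTree.leavesT : CTree X → Timed (List (List X))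
  | .leaf c => op [c]
  | .node ts => call (leavesAllT ts)
def leavesAllT : List (CTree X) → Timed (List (List X))
  | [] => op []
  | t :: ts => call (t.leavesT.bind fun a => (leavesAllT ts).bind fun b => appendT a b)
end

/-- The median of the distances `d p q`, `q ∈ c` (mean of the two middle values if their number is
even). -/
noncomputable def medianT (p : X) (c : List X) : Timed ℝ :=
  (mapT (fun q => op (I.d p q)) c).bind fun l =>
  (sortT (fun t => t) l).bind fun s =>
  (lengthT s).bind fun n =>
  (nthT s ((n - 1) / 2)).bind fun a =>
  (nthT s (n / 2)).bind fun b =>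
  op ((a.getD 0 + b.getD 0) / 2)

/-- The leaf, among those listed in `leaves`, of smallest median distance to `p`. The result is the
pair of this distance and the first point of the leaf, by which the leaf is identified. -/
noncomputable def nearestLeafT (p : X) (leaves : List (List X)) : Timed (Option (ℝ × X)) :=
  foldT (fun best c =>
    (medianT I p c).bind fun t =>
    op (match c, best with
      | [], b => b
      | r :: _, none => some (t, r)
      | r :: _, some b => if t < b.1 then some (t, r) else some b)) none leaves

/-- The cluster `c` together with all points that are assigned to it. The entry `(p, some (_, r))` of
`asg` says that `p` is assigned to the leaf containing `r`. -/
def fillLeafT [DecidableEq X] (asg : List (X × Option (ℝ × X))) (c : List X) : Timed (List X) :=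
  (splitT (fun a : X × Option (ℝ × X) => match a.2 with
    | none => op false
    | some b => memT b.2 c) asg).bind fun s =>
  (mapT (fun a => op a.1) s.1).bind fun extra =>
  appendT c extra

mutual
/-- Remove the singleton leaves below the root and enlarge the other leaves according to the
assignment. -/
def CTree.rebuildT [DecidableEq X] (asg : List (X × Option (ℝ × X))) : CTree X → Timed (CTree X)
  | .leaf c => call ((fillLeafT asg c).bind fun c' => op (.leaf c'))
  | .node ts => call ((rebuildAllT asg ts).bind fun ts' => op (.node ts'))
def rebuildAllT [DecidableEq X] (asg : List (X × Option (ℝ × X))) :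
    List (CTree X) → Timed (List (CTree X))
  | [] => op []
  | t :: ts => call ((op t.isSingleLeaf).bind fun b =>
      if b then rebuildAllT asg ts
      else (t.rebuildT asg).bind fun t' => (rebuildAllT asg ts).bind fun ts' => op (t' :: ts'))
end

/-- Second phase: collapse, then assign every remaining singleton to the non-singleton leaf of
smallest median distance. -/
noncomputable def cleanT [DecidableEq X] (T : CTree X) : Timed (CTree X) :=
  T.collapseT.bind fun T' =>
  T'.leavesT.bind fun leaves =>
  (splitT (fun c => op (isSingle c)) leaves).bind fun s =>
  (foldT (fun acc c => appendT c acc) [] s.1).bind fun singles =>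
  (mapT (fun p => (nearestLeafT I p s.2).bind fun b => op (p, b)) singles).bind fun asg =>
  T'.rebuildT asg

end Cleaning

section DynamicProgramming

variable {X : Type u} (I : Input X)

/-- Trees with two branches at every inner node. -/
inductive BTree (X : Type u) where
  | leaf (c : List X) : BTree X
  | node (l r : BTree X) : BTree X

mutual
/-- Replace a node with children `R₁, …, R_t` by two-branch nodes, merging `R₁` with `R₂`, the result
with `R₃`, and so on. -/
def CTree.binaryT : CTree X → Timed (BTree X)
  | .leaf c => op (.leaf c)
  | .node ts => call (binaryAllT none ts)
def binaryAllT : Option (BTree X) → List (CTree X) → Timed (BTree X)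
  | acc, [] => op (acc.getD (.leaf []))
  | acc, t :: ts => call (t.binaryT.bind fun b =>
      (op (match acc with
        | none => b
        | some a => .node a b)).bind fun a' => binaryAllT (some a') ts)
end

def BTree.pointsT : BTree X → Timed (List X)
  | .leaf c => op c
  | .node l r => call (l.pointsT.bind fun a => r.pointsT.bind fun b => appendT a b)

/-- A solution of a subproblem: its cost, and its clusters with their centers; `none` if there is no
solution (infinite cost). -/
abbrev Sol (X : Type u) := Option (ℝ × List (List X × X))

/-- The cheaper of two solutions. -/
noncomputable def betterT : Sol X → Sol X → Timed (Sol X)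
  | none, b => op b
  | some a, none => op (some a)
  | some a, some b => op (if a.1 ≤ b.1 then some a else some b)

/-- Union of solutions for two disjoint parts. -/
noncomputable def unionT : Sol X → Sol X → Timed (Sol X)
  | some a, some b => (appendT a.2 b.2).bind fun l => op (some (a.1 + b.1, l))
  | _, _ => op none

/-- `cost(·, 1)`: the cluster `c` with its best center. -/
noncomputable def oneClusterT (c : List X) : Timed (Sol X) :=
  foldT (fun best s =>
    (foldT (fun t x => (op (I.d x s)).bind fun a => op (t + a)) 0 c).bind fun t =>
    (op (some (t, [(c, s)]))).bind fun new => betterT best new) none I.pts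

/-- The best choice of `m₁ + m₂ = m` with `m₁, m₂ ≥ 1`, from the tables of the two subtrees
(the entry of index `j` of a table belongs to `j + 1` clusters). -/
noncomputable def combineT (L R : List (Sol X)) (m : ℕ) : Timed (Sol X) :=
  (rangeT 1 (m - 1)).bind fun ms =>
  foldT (fun best m₁ =>
    (nthT L (m₁ - 1)).bind fun a =>
    (nthT R (m - m₁ - 1)).bind fun b =>
    (unionT (a.getD none) (b.getD none)).bind fun new =>
    betterT best new) none ms

/-- For each tree node the table of the cheapest prunings of its subtree into `1, …, k` clusters. -/
noncomputable def BTree.tableT : BTree X → Timed (List (Sol X))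
  | .leaf c =>
      (oneClusterT I c).bind fun one =>
      (rangeT 1 I.k).bind fun ms =>
      mapT (fun m => op (if m = 1 then one else none)) ms
  | .node l r => call (
      (BTree.tableT l).bind fun L =>
      (BTree.tableT r).bind fun R =>
      (BTree.pointsT (.node l r)).bind fun c =>
      (oneClusterT I c).bind fun one =>
      (rangeT 1 I.k).bind fun ms =>
      mapT (fun m => if m = 1 then op one else combineT L R m) ms)

/-- Third phase: a k-cluster pruning of minimal k-median cost, with centers. -/
noncomputable def minPruningT (T : CTree X) : Timed (Option (List (List X × X))) :=
  T.binaryT.bind fun B =>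
  (B.tableT I).bind fun table =>
  (nthT table (I.k - 1)).bind fun s =>
  op ((s.getD none).map Prod.snd)

end DynamicProgramming

/-- The output: the cleaned tree, and the clusters of the final clustering with their centers. -/
structure Output (X : Type u) where
  tree : CTree X
  clustering : Option (List (List X × X))

/-- The whole algorithm: approximate closure linkage, cleaning, dynamic programming. -/
noncomputable def algorithmT {X : Type u} [DecidableEq X] (I : Input X) : Timed (Output X) :=
  (linkageT I).bind fun T =>
  (cleanT I T).bind fun T' =>
  (minPruningT I T').bind fun C =>
  op ⟨T', C⟩

/-! ### Reading lists of clusters as k-clusterings -/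

section Reading

variable {X : Type u} [Fintype X] [DecidableEq X]

/-- The list `P` consists of the `k` clusters of the clustering `g`. -/
def Represents {k : ℕ} (P : List (List X)) (g : X → Fin k) : Prop :=
  P.map List.toFinset = List.ofFn (cluster g)

/-- The list `P` consists of the `k` clusters of `g`, with centers `b`. -/
def RepresentsWithCenters {k : ℕ} (P : List (List X × X)) (g : X → Fin k) (b : Fin k → X) : Prop :=
  P.map (fun c => (c.1.toFinset, c.2)) = List.ofFn (fun i => (cluster g i, b i))

end Reading

end KMedian

-- Write δ = εn, let c be optimal centers of f, and call a point good if every other center is more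
-- than α times as far from it as its own.
--
-- Few bad points (`card_not_good_le`). Suppose more than δ points are bad. Move slightly more than
-- δ of them to a rival center, keep every distance from a point to its new center and multiply all
-- other distances by α. The new assignment is optimal for this perturbation: an optimal solution of
-- the perturbed instance is close to f by resilience, and `perturb_cluster_gap` shows cluster by
-- cluster that it is no cheaper. Resilience then makes the new assignment δ-close to f, although
-- more than δ points have moved.
--
-- Separated groups (`exists_isCore`). For α > 2 + √7 the good points of cluster i lie in a ball of
-- radius R_i around c i, where R_i = dist (c i) (q i) with q i the farthest of them, and all other
-- good points are more than 3 R_i away from c i.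
--
-- Linkage (`LinkInv.step`). If a ball of radius r contains good points of two groups, then R_i < r
-- for both. Since the pairs come in ascending order, (c i, q i) was examined before, and both
-- groups are already united. At (c i, q i) itself, either group i is already in one tree or the
-- closure test succeeds and unites it. Hence a merge that mixes groups only joins trees that
-- contain completely each group they meet.
--
-- Cleaning. The non-singleton leaves are large and carry good points of one group only (`IsDense`).
-- Most points of such a leaf are good, so medians compare good points, and every good point ends up
-- in a leaf of its own group (`eq_of_mem_fill`). Cutting the tree where a single group remains
-- gives k clusters that agree with f outside the bad points (`exists_pruning`).
--
-- Cost. If a point x ends up in group j instead of i, there are at least (m - 3δ)/2 good points w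
-- of group j and as many w' of group i with d(x,w) ≤ d(x,w') for all choices of w and w'. By
-- averaging, the excess cost of x is at most 5 OPT/(m - 15) (`mul_dist_sub_le`). Summing over at
-- most δ points bounds the total excess by ε' OPT, and the dynamic program returns a pruning that
-- is no more expensive.
--
-- Running time. The tree grows by a constant in each of the n² rounds, so its size is quadratic in
-- n, and every procedure is polynomial in that size.

set_option linter.unusedSectionVars false

namespace KMedian

/-! ### Values and costs of the list procedures -/

section Combinators

variable {A : Type u} {B : Type v}

@[simp] theorem op_val (a : A) : (op a).val = a := rfl
@[simp] theorem op_cost (a : A) : (op a).cost = 1 := rfl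
@[simp] theorem call_val (t : Timed A) : (call t).val = t.val := rfl
@[simp] theorem call_cost (t : Timed A) : (call t).cost = t.cost + 1 := rfl
@[simp] theorem bind_val (t : Timed A) (f : A → Timed B) : (t.bind f).val = (f t.val).val := rfl
@[simp] theorem bind_cost (t : Timed A) (f : A → Timed B) :
    (t.bind f).cost = t.cost + (f t.val).cost := rfl

theorem mapT_val (f : A → Timed B) (l : List A) : (mapT f l).val = l.map (fun a => (f a).val) := by
  induction l with
  | nil => rfl
  | cons a l ih => simp [mapT, ih]

theorem foldT_val (f : B → A → Timed B) (b : B) (l : List A) :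
    (foldT f b l).val = l.foldl (fun b a => (f b a).val) b := by
  induction l generalizing b with
  | nil => rfl
  | cons a l ih => simp [foldT, ih]

theorem allT_val (t : A → Timed Bool) (l : List A) :
    (allT t l).val = l.all (fun a => (t a).val) := by
  induction l with
  | nil => rfl
  | cons a l ih => simp [allT, ih]

theorem appendT_val (k l : List A) : (appendT k l).val = k ++ l := by
  induction k with
  | nil => rfl
  | cons a k ih => simp [appendT, ih]

theorem nthT_val (l : List A) (n : ℕ) : (nthT l n).val = l[n]? := by
  induction l generalizing n with
  | nil => rfl
  | cons a l ih => cases n <;> simp [nthT, ih]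

theorem rangeT_val (a n : ℕ) : (rangeT a n).val = List.range' a n := by
  induction n generalizing a with
  | zero => rfl
  | succ n ih => simp [rangeT, ih, List.range'_succ]

theorem memT_val [DecidableEq A] (x : A) (l : List A) : (memT x l).val = decide (x ∈ l) := by
  rw [Bool.eq_iff_iff]; simp [memT, anyT_val]

theorem insertT_perm (key : A → ℝ) (a : A) (l : List A) :
    (insertT key a l).val.Perm (a :: l) := by
  induction l with
  | nil => simp [insertT]
  | cons b l ih =>
    by_cases h : key a ≤ key b
    · simp [insertT, h]
    · simpa [insertT, h] using (ih.cons b).trans (List.Perm.swap a b l)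

theorem sortT_perm (key : A → ℝ) (l : List A) : (sortT key l).val.Perm l := by
  induction l with
  | nil => simp [sortT]
  | cons a l ih => simpa [sortT] using (insertT_perm key a _).trans (ih.cons a)

theorem insertT_sorted (key : A → ℝ) (a : A) (l : List A)
    (h : l.Pairwise (fun x y => key x ≤ key y)) :
    (insertT key a l).val.Pairwise (fun x y => key x ≤ key y) := by
  induction l with
  | nil => simp [insertT]
  | cons b l ih =>
    rw [List.pairwise_cons] at h
    by_cases hab : key a ≤ key b
    · simp only [insertT, hab, call_val, bind_val, op_val, decide_true, if_true,
        List.pairwise_cons]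
      refine ⟨?_, h⟩
      intro y hy
      rcases List.mem_cons.mp hy with rfl | hy
      · exact hab
      · exact hab.trans (h.1 y hy)
    · simp only [insertT, hab, call_val, bind_val, op_val, decide_false, Bool.false_eq_true,
        if_false, List.pairwise_cons]
      refine ⟨?_, ih h.2⟩
      intro y hy
      rcases List.mem_cons.mp ((insertT_perm key a l).mem_iff.mp hy) with rfl | hy
      · exact (not_le.mp hab).le
      · exact h.1 y hy

theorem sortT_sorted (key : A → ℝ) (l : List A) :
    (sortT key l).val.Pairwise (fun x y => key x ≤ key y) := by
  induction l with
  | nil => simp [sortT]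
  | cons a l ih => simpa [sortT] using insertT_sorted key a _ ih

theorem mem_pairsT (l₁ l₂ : List A) (x : A × A) :
    x ∈ (pairsT l₁ l₂).val ↔ x.1 ∈ l₁ ∧ x.2 ∈ l₂ := by
  simp only [pairsT, foldT_val, bind_val, mapT_val, appendT_val, op_val,
    List.foldl_flip_append_eq_append, List.append_nil]
  rcases x with ⟨x, y⟩
  simp

theorem length_pairsT (l₁ l₂ : List A) : (pairsT l₁ l₂).val.length = l₁.length * l₂.length := by
  simp [pairsT, foldT_val, mapT_val, appendT_val, Function.comp_def]

/-! Cost bounds -/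

theorem mapT_cost_le (f : A → Timed B) (l : List A) (K : ℕ) (h : ∀ a ∈ l, (f a).cost ≤ K) :
    (mapT f l).cost ≤ l.length * (K + 2) + 1 := by
  induction l with
  | nil => simp [mapT]
  | cons a l ih =>
    have h1 := h a (by simp)
    have h2 := ih (fun a ha => h a (by simp [ha]))
    simp only [mapT, call_cost, bind_cost, op_cost, List.length_cons, add_mul]
    lia

/-- The invariant `P` sees the remaining list together with the accumulator, so that an accumulator
which grows in each step can be bounded by a budget that the remaining steps use up. -/
theorem foldT_cost_le (f : B → A → Timed B) (P : List A → B → Prop) (K : ℕ)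
    (hstep : ∀ a l b, P (a :: l) b → (f b a).cost ≤ K ∧ P l (f b a).val) (b : B) (l : List A)
    (h : P l b) : (foldT f b l).cost ≤ l.length * (K + 1) + 1 := by
  induction l generalizing b with
  | nil => simp [foldT]
  | cons a l ih =>
    obtain ⟨h1, h2⟩ := hstep a l b h
    have h3 := ih _ h2
    simp only [foldT, call_cost, bind_cost, List.length_cons, add_mul]
    lia

theorem splitT_cost_le (t : A → Timed Bool) (l : List A) (K : ℕ) (h : ∀ a ∈ l, (t a).cost ≤ K) :
    (splitT t l).cost ≤ l.length * (K + 2) + 1 := by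
  induction l with
  | nil => simp [splitT]
  | cons a l ih =>
    have h1 := h a (by simp)
    have h2 := ih (fun a ha => h a (by simp [ha]))
    simp only [splitT, call_cost, bind_cost, op_cost, List.length_cons, add_mul]
    lia

theorem anyT_cost_le (t : A → Timed Bool) (l : List A) (K : ℕ) (h : ∀ a ∈ l, (t a).cost ≤ K) :
    (anyT t l).cost ≤ l.length * (K + 2) + 1 := by
  induction l with
  | nil => simp [anyT]
  | cons a l ih =>
    have h1 := h a (by simp)
    have h2 := ih (fun a ha => h a (by simp [ha]))
    simp only [anyT, call_cost, bind_cost, op_cost, List.length_cons, add_mul]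
    lia

theorem allT_cost_le (t : A → Timed Bool) (l : List A) (K : ℕ) (h : ∀ a ∈ l, (t a).cost ≤ K) :
    (allT t l).cost ≤ l.length * (K + 2) + 1 := by
  induction l with
  | nil => simp [allT]
  | cons a l ih =>
    have h1 := h a (by simp)
    have h2 := ih (fun a ha => h a (by simp [ha]))
    simp only [allT, call_cost, bind_cost, op_cost, List.length_cons, add_mul]
    lia

theorem lengthT_cost (l : List A) : (lengthT l).cost = 2 * l.length + 1 := by
  induction l with
  | nil => simp [lengthT]
  | cons a l ih => simp [lengthT, ih]; ring

theorem appendT_cost (k l : List A) : (appendT k l).cost = 2 * k.length + 1 := by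
  induction k with
  | nil => simp [appendT]
  | cons a k ih => simp [appendT, ih]; ring

theorem nthT_cost_le (l : List A) (n : ℕ) : (nthT l n).cost ≤ l.length + 1 := by
  induction l generalizing n with
  | nil => simp [nthT]
  | cons a l ih => cases n <;> simp [nthT, ih]

theorem rangeT_cost (a n : ℕ) : (rangeT a n).cost = 3 * n + 1 := by
  induction n generalizing a with
  | zero => simp [rangeT]
  | succ n ih => simp [rangeT, ih]; ring

theorem memT_cost_le [DecidableEq A] (x : A) (l : List A) :
    (memT x l).cost ≤ l.length * 3 + 1 :=
  anyT_cost_le _ l 1 (by simp)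

theorem insertT_cost_le (key : A → ℝ) (a : A) (l : List A) :
    (insertT key a l).cost ≤ 3 * l.length + 1 := by
  induction l with
  | nil => simp [insertT]
  | cons b l ih =>
    by_cases h : key a ≤ key b <;> simp [insertT, h] <;> lia

theorem sortT_cost_le (key : A → ℝ) (l : List A) :
    (sortT key l).cost ≤ l.length * (3 * l.length + 2) + 1 := by
  induction l with
  | nil => simp [sortT]
  | cons a l ih =>
    have h1 := insertT_cost_le key a (sortT key l).val
    rw [(sortT_perm key l).length_eq] at h1
    simp only [sortT, call_cost, bind_cost, List.length_cons]
    nlinarith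

theorem pairsT_cost_le (l₁ l₂ : List A) :
    (pairsT l₁ l₂).cost ≤ l₁.length * (5 * l₂.length + 3) + 1 := by
  refine (foldT_cost_le _ (fun _ _ => True) (5 * l₂.length + 2) ?_ [] l₁ trivial).trans ?_
  · intro a l b _
    refine ⟨?_, trivial⟩
    have h1 := mapT_cost_le (fun b => op (a, b)) l₂ 1 (by simp)
    simp only [bind_cost, appendT_cost, mapT_val, List.length_map]
    lia
  · lia

end Combinators

/-! ### Optimal clusterings and good points -/

section Structure

variable {X : Type u} [Fintype X] [DecidableEq X] {k : ℕ}

theorem mem_cluster {f : X → Fin k} {i : Fin k} {x : X} : x ∈ cluster f i ↔ f x = i := by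
  simp [cluster]

theorem cost_eq_sum (d : X → X → ℝ) (f : X → Fin k) (c : Fin k → X) :
    cost d f c = ∑ x, d x (c (f x)) := by
  rw [cost, ← Finset.sum_fiberwise (s := Finset.univ) (g := f)]
  refine Finset.sum_congr rfl fun i _ => Finset.sum_congr rfl fun x hx => ?_
  rw [mem_cluster.mp hx]

/-- Turns closeness into a count of mislabelled points, the form in which resilience is used
throughout. -/
theorem sum_card_cluster_sdiff (f g : X → Fin k) (σ : Equiv.Perm (Fin k)) :
    ∑ i, (cluster f i \ cluster g (σ i)).card = {x | g x ≠ σ (f x)}.toFinset.card := by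
  rw [Finset.card_eq_sum_card_fiberwise (f := f) (t := Finset.univ) (by simp)]
  refine Finset.sum_congr rfl fun i _ => congrArg _ ?_
  ext x
  simp only [Finset.mem_sdiff, mem_cluster, Set.mem_toFinset, Set.mem_ofPred_eq, Finset.mem_filter]
  constructor
  · rintro ⟨rfl, h⟩
    exact ⟨h, rfl⟩
  · rintro ⟨h, rfl⟩
    exact ⟨rfl, h⟩

theorem minClusterSize_le (f : X → Fin k) (i : Fin k) :
    minClusterSize f ≤ (cluster f i).card :=
  ciInf_le (OrderBot.bddBelow _) i

variable [MetricSpace X]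

/-- `c` is a choice of centers for which the clustering `f` has minimal cost. -/
def IsOptimalWith (f : X → Fin k) (c : Fin k → X) : Prop :=
  ∀ (g : X → Fin k) (b : Fin k → X), cost dist f c ≤ cost dist g b

/-- The point `x` is closer to its own center than to any other one, by more than a factor `α`. -/
def IsGood (α : ℝ) (f : X → Fin k) (c : Fin k → X) (x : X) : Prop :=
  ∀ j, j ≠ f x → α * dist x (c (f x)) < dist x (c j)

namespace IsOptimalWith

variable {f : X → Fin k} {c : Fin k → X} (h : IsOptimalWith f c)
include h

theorem dist_le (x : X) (j : Fin k) : dist x (c (f x)) ≤ dist x (c j) := by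
  have h1 := h (Function.update f x j) c
  rw [cost_eq_sum, cost_eq_sum, ← Finset.add_sum_erase _ _ (Finset.mem_univ x),
    ← Finset.add_sum_erase _ _ (Finset.mem_univ x)] at h1
  have h2 : ∑ y ∈ Finset.univ.erase x, dist y (c (Function.update f x j y)) =
      ∑ y ∈ Finset.univ.erase x, dist y (c (f y)) :=
    Finset.sum_congr rfl fun y hy => by rw [Function.update_of_ne (Finset.ne_of_mem_erase hy)]
  rw [h2, Function.update_self] at h1
  linarith

/-- With a repeated center one of the two clusters can be merged into the other. The freed center,
placed at a point y that is not a center, makes the positive cost of y vanish. -/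
theorem injective (hk : k < Fintype.card X) : Function.Injective c := by
  intro i j hij
  by_contra hne
  obtain ⟨y, hy⟩ : ∃ y, y ∉ Finset.univ.image c := by
    by_contra! hall
    have h1 : (Finset.univ : Finset X) ⊆ Finset.univ.image c := fun y _ => hall y
    have h2 := (Finset.card_le_card h1).trans Finset.card_image_le
    simp only [Finset.card_univ, Fintype.card_fin] at h2
    lia
  have hy' : ∀ l, c l ≠ y := fun l hl => hy (by simp [← hl])
  have h1 := h (fun x => if x = y then i else if f x = i then j else f x) (Function.update c i y)
  rw [cost_eq_sum, cost_eq_sum, ← Finset.add_sum_erase _ _ (Finset.mem_univ y),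
    ← Finset.add_sum_erase _ (fun x => dist x (Function.update c i y _)) (Finset.mem_univ y)] at h1
  have h2 : ∑ x ∈ Finset.univ.erase y, dist x (Function.update c i y
        (if x = y then i else if f x = i then j else f x)) =
      ∑ x ∈ Finset.univ.erase y, dist x (c (f x)) := by
    refine Finset.sum_congr rfl fun x hx => ?_
    rw [if_neg (Finset.ne_of_mem_erase hx)]
    split_ifs with hx'
    · rw [Function.update_of_ne (Ne.symm hne), ← hij, hx']
    · rw [Function.update_of_ne hx']
  rw [h2] at h1
  simp only [if_true, Function.update_self, dist_self] at h1
  have h3 : 0 < dist y (c (f y)) := dist_pos.mpr (hy' _).symm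
  linarith

theorem apply_center (hk : k < Fintype.card X) (i : Fin k) : f (c i) = i := by
  have h1 := h.dist_le (c i) i
  rw [dist_self] at h1
  exact (h.injective hk (dist_le_zero.mp h1)).symm

theorem sum_cluster_le (i : Fin k) (y : X) :
    ∑ x ∈ cluster f i, dist x (c i) ≤ ∑ x ∈ cluster f i, dist x y := by
  have h1 := h f (Function.update c i y)
  rw [cost, cost, ← Finset.add_sum_erase _ _ (Finset.mem_univ i),
    ← Finset.add_sum_erase _ (fun j => ∑ x ∈ cluster f j, dist x (Function.update c i y j))
      (Finset.mem_univ i)] at h1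
  have h2 : ∑ j ∈ Finset.univ.erase i, ∑ x ∈ cluster f j, dist x (Function.update c i y j) =
      ∑ j ∈ Finset.univ.erase i, ∑ x ∈ cluster f j, dist x (c j) :=
    Finset.sum_congr rfl fun j hj => by rw [Function.update_of_ne (Finset.ne_of_mem_erase hj)]
  rw [h2, Function.update_self] at h1
  linarith

end IsOptimalWith

/-- The perturbation that keeps the distance of every point `x` to the center `c (h x)` and
multiplies all other distances by `α`. -/
def perturb (α : ℝ) (h : X → Fin k) (c : Fin k → X) (x y : X) : ℝ :=
  if y = c (h x) then dist x y else α * dist x y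

theorem perturb_bounds {α : ℝ} (hα : 1 ≤ α) (h : X → Fin k) (c : Fin k → X) (x y : X) :
    dist x y ≤ perturb α h c x y ∧ perturb α h c x y ≤ α * dist x y := by
  have h0 : 0 ≤ dist x y := dist_nonneg
  have h1 : dist x y ≤ α * dist x y := le_mul_of_one_le_left h0 hα
  unfold perturb
  split_ifs
  · exact ⟨le_rfl, h1⟩
  · exact ⟨h1, le_rfl⟩

/-- Main estimate for the clusters of a solution `(g, b)` in the perturbed instance. -/
theorem perturb_cluster_gap {f g h : X → Fin k} {c : Fin k → X} (hopt : IsOptimalWith f c)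
    {α δ : ℝ} (hα : 3 ≤ α) {M : Finset X}
    (hM : ∀ x, x ∉ M → h x = f x) (hMc : (M.card : ℝ) ≤ δ + 1)
    (hh : ∀ x j, dist x (c (h x)) ≤ perturb α h c x (c j))
    (hm : ∀ i, 5 * δ + 15 ≤ ((cluster f i).card : ℝ))
    (hg : ({x | g x ≠ f x}.toFinset.card : ℝ) ≤ δ) (b : Fin k → X) (i : Fin k) :
    0 ≤ ∑ x ∈ cluster g i, (perturb α h c x (b i) - dist x (c (h x))) := by
  by_cases hb : b i = c i
  · rw [hb]
    exact Finset.sum_nonneg fun x _ => sub_nonneg.mpr (hh x i)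
  have hδ : 0 ≤ δ := le_trans (Nat.cast_nonneg _) hg
  set D := dist (b i) (c i) with hD
  have hDpos : 0 < D := dist_pos.mpr hb
  set φ : X → ℝ := fun x => perturb α h c x (b i) - dist x (c (h x)) with hφ
  set ψ : X → ℝ := fun x => dist x (b i) - dist x (c i) with hψ
  have hψ1 : ∀ x, -D ≤ ψ x := fun x => by
    have := dist_triangle x (b i) (c i)
    simp only [hψ]; linarith
  have hψ2 : ∀ x, ψ x ≤ D := fun x => by
    have := dist_triangle x (c i) (b i)
    rw [dist_comm (c i)] at this
    simp only [hψ]; linarith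
  have hsum : ∀ x, D ≤ dist x (b i) + dist x (c i) := fun x => by
    have := dist_triangle_left (b i) (c i) x
    linarith
  have hexc : ∀ x, b i = c (h x) → φ x = 0 := fun x hx => by simp [hφ, perturb, hx]
  have hnon : ∀ x, b i ≠ c (h x) → α * ψ x ≤ φ x := fun x hx => by
    have h1 := hh x i
    have h2 := (perturb_bounds (by linarith) h c x (c i) : _ ∧ perturb α h c x (c i) ≤ _).2
    simp only [hφ, hψ]
    rw [show perturb α h c x (b i) = α * dist x (b i) by simp [perturb, hx]]
    linarith
  -- The identity α u - v = (α-1)/2 (u+v) + (α+1)/2 (u-v), with u and v the distances of x to b i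
  -- and c i. It isolates ψ, whose sum over the cluster is controlled by optimality, from u + v ≥ D.
  have hA : ∀ x, f x = i → x ∉ M → (α - 1) / 2 * D + (α + 1) / 2 * ψ x ≤ φ x := by
    intro x hx hxM
    have h1 : b i ≠ c (h x) := by rwa [hM x hxM, hx]
    simp only [hφ, hψ]
    rw [show perturb α h c x (b i) = α * dist x (b i) by simp [perturb, h1], hM x hxM, hx]
    nlinarith [hsum x]
  have hW3 : ∀ x, -(α * D) ≤ φ x := fun x => by
    by_cases hx : b i = c (h x)
    · rw [hexc x hx]; nlinarith
    · have := hnon x hx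
      have := hψ1 x
      nlinarith
  set C := cluster f i with hC
  set C' := cluster g i with hC'
  -- A is the bulk, where the distance to b i is scaled by α. The sets W (reassigned points), V
  -- (intruders) and U (missing points) are small and may cost a multiple of D each.
  set A := (C ∩ C') \ M with hAdef
  set W := (C ∩ C') ∩ M with hWdef
  set V := C' \ C with hVdef
  set U := C \ C' with hUdef
  have hUV : (U.card : ℝ) + (V.card : ℝ) ≤ δ := by
    refine le_trans ?_ hg
    rw [← Nat.cast_add, ← Finset.card_union_of_disjoint]
    · norm_cast
      apply Finset.card_le_card
      intro x hx
      simp only [hUdef, hVdef, hC, hC', Finset.mem_union, Finset.mem_sdiff, mem_cluster] at hx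
      simp only [Set.mem_toFinset, Set.mem_ofPred_eq]
      intro he
      rw [he] at hx
      tauto
    · exact disjoint_sdiff_sdiff
  have hWc : (W.card : ℝ) ≤ δ + 1 :=
    le_trans (by exact_mod_cast Finset.card_le_card Finset.inter_subset_right) hMc
  have hAc : (A.card : ℝ) + W.card + U.card = C.card := by
    norm_cast
    rw [hAdef, hWdef, hUdef, Finset.card_sdiff_add_card_inter, Finset.card_inter_add_card_sdiff]
  have hsplit : ∀ F : X → ℝ, ∑ x ∈ C', F x = ∑ x ∈ A, F x + ∑ x ∈ W, F x + ∑ x ∈ V, F x := by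
    intro F
    rw [add_comm (∑ x ∈ A, F x), Finset.sum_inter_add_sum_sdiff, Finset.inter_comm,
      Finset.sum_inter_add_sum_sdiff]
  have hsplitC : ∀ F : X → ℝ, ∑ x ∈ C, F x = ∑ x ∈ A, F x + ∑ x ∈ W, F x + ∑ x ∈ U, F x := by
    intro F
    rw [add_comm (∑ x ∈ A, F x), Finset.sum_inter_add_sum_sdiff,
      Finset.sum_inter_add_sum_sdiff]
  have hAf : ∀ x ∈ A, f x = i ∧ x ∉ M := fun x hx => by
    simp only [hAdef, hC, Finset.mem_sdiff, Finset.mem_inter, mem_cluster] at hx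
    exact ⟨hx.1.1, hx.2⟩
  have hWf : ∀ x ∈ W, f x = i := fun x hx => by
    simp only [hWdef, hC, Finset.mem_inter, mem_cluster] at hx
    exact hx.1.1
  have hV : -(α * D) * V.card ≤ ∑ x ∈ V, φ x := by
    have := Finset.card_nsmul_le_sum V φ _ (fun x _ => hW3 x)
    rw [nsmul_eq_mul] at this
    linarith
  have hmi := hm i
  rw [hsplit]
  -- If b i is an old center, each ψ is nonnegative on cluster i, but points of W may have an
  -- unscaled distance to b i. Otherwise all distances to b i are scaled, but only the sum of ψ over
  -- cluster i is known to be nonnegative.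
  by_cases hl : ∃ l, b i = c l
  · obtain ⟨l, hl⟩ := hl
    have hψ0 : ∀ x, f x = i → 0 ≤ ψ x := fun x hx => by
      have := hopt.dist_le x l
      rw [hx] at this
      simp only [hψ, hl]; linarith
    have h1 : (α - 1) / 2 * D * A.card ≤ ∑ x ∈ A, φ x := by
      have := Finset.card_nsmul_le_sum A φ ((α - 1) / 2 * D) (fun x hx => by
        have h1 := hA x (hAf x hx).1 (hAf x hx).2
        have h2 := hψ0 x (hAf x hx).1
        nlinarith)
      rw [nsmul_eq_mul] at this
      linarith
    have h2 : 0 ≤ ∑ x ∈ W, φ x := Finset.sum_nonneg fun x hx => by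
      by_cases he : b i = c (h x)
      · rw [hexc x he]
      · have h1 := hnon x he
        have h2 := hψ0 x (hWf x hx)
        nlinarith
    -- From |C| ≥ 5δ + 15, |W| ≤ δ + 1 and |U| + |V| ≤ δ the bulk has at least 3δ + 14 points, and
    -- 3(α-1)/2 ≥ α holds for α ≥ 3.
    have h3 : 0 ≤ (α - 1) / 2 * A.card - α * V.card := by
      have h4 : 3 * δ + 14 ≤ A.card := by
        have : (0 : ℝ) ≤ V.card := Nat.cast_nonneg _
        linarith
      have h5 : (V.card : ℝ) ≤ δ := by
        have : (0 : ℝ) ≤ U.card := Nat.cast_nonneg _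
        linarith
      nlinarith
    nlinarith [mul_nonneg hDpos.le h3]
  · have hne : ∀ x, b i ≠ c (h x) := fun x hx => hl ⟨_, hx⟩
    have h1 : (α - 1) / 2 * D * A.card + (α + 1) / 2 * ∑ x ∈ A, ψ x ≤ ∑ x ∈ A, φ x := by
      have := Finset.sum_le_sum (s := A) (fun x hx => hA x (hAf x hx).1 (hAf x hx).2)
      rw [Finset.sum_add_distrib, Finset.sum_const, nsmul_eq_mul, ← Finset.mul_sum] at this
      linarith
    have h2 : -((α - 1) / 2 * D) * W.card + (α + 1) / 2 * ∑ x ∈ W, ψ x ≤ ∑ x ∈ W, φ x := by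
      have := Finset.sum_le_sum (s := W)
        (f := fun x => -((α - 1) / 2 * D) + (α + 1) / 2 * ψ x) (g := φ) (fun x _ => by
          have h1 := hnon x (hne x)
          have h2 := hψ1 x
          nlinarith)
      rw [Finset.sum_add_distrib, Finset.sum_const, nsmul_eq_mul, ← Finset.mul_sum] at this
      linarith
    have h3 : -(D * U.card) ≤ ∑ x ∈ A, ψ x + ∑ x ∈ W, ψ x := by
      have h4 := hopt.sum_cluster_le i (b i)
      have h5 : 0 ≤ ∑ x ∈ C, ψ x := by
        rw [Finset.sum_sub_distrib]
        linarith
      have h6 := Finset.sum_le_card_nsmul U ψ D (fun x _ => hψ2 x)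
      rw [nsmul_eq_mul] at h6
      rw [hsplitC] at h5
      linarith
    -- The right side is (α-1)/2 (|C| - 2|W|) - α(|U| + |V|), which is at least (α-3)δ/2 +
    -- 13(α-1)/2.
    have h4 : 0 ≤ (α - 1) / 2 * A.card - (α - 1) / 2 * W.card - α * V.card
        - (α + 1) / 2 * U.card := by
      have h5 : (A.card : ℝ) = C.card - W.card - U.card := by linarith
      rw [h5]
      have h6 : 0 ≤ (α - 1) / 2 * (C.card - 5 * δ - 15) :=
        mul_nonneg (by linarith) (by linarith)
      have h7 : 0 ≤ (α - 1) * (δ + 1 - W.card) := mul_nonneg (by linarith) (by linarith)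
      have h8 : 0 ≤ α * (δ - (U.card + V.card)) := mul_nonneg (by linarith) (by linarith)
      have h9 : 0 ≤ (α - 3) * δ := mul_nonneg (by linarith) hδ
      nlinarith
    have h5 : 0 ≤ (α + 1) / 2 * (∑ x ∈ A, ψ x + ∑ x ∈ W, ψ x + D * U.card) :=
      mul_nonneg (by linarith) (by linarith)
    nlinarith [mul_nonneg hDpos.le h4]

/-- In a resilient instance there are at most `ε n` points that are not good. -/
theorem card_not_good_le {f : X → Fin k} {c : Fin k → X} (hopt : IsOptimalWith f c)
    (hk : k < Fintype.card X) {α ε : ℝ} (hα : 3 ≤ α) (hres : IsResilient dist α ε f)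
    (hε : 0 ≤ ε * Fintype.card X)
    (hm : ∀ i, 5 * (ε * Fintype.card X) + 15 ≤ ((cluster f i).card : ℝ)) :
    ({x | ¬ IsGood α f c x}.ncard : ℝ) ≤ ε * Fintype.card X := by
  classical
  set δ := ε * Fintype.card X with hδ
  by_contra! hlt
  -- Exactly ⌊δ⌋ + 1 bad points: more than δ, to contradict closeness at the end, and at most δ + 1,
  -- as the cluster estimate requires.
  obtain ⟨M, hMsub, hMcard⟩ : ∃ M ⊆ {x | ¬ IsGood α f c x}.toFinset, M.card = ⌊δ⌋₊ + 1 := by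
    apply Finset.exists_subset_card_eq
    rw [← Set.ncard_eq_toFinset_card']
    exact Nat.succ_le_of_lt ((Nat.floor_lt hε).mpr hlt)
  have hM1 : δ < M.card := by rw [hMcard]; exact_mod_cast Nat.lt_floor_add_one δ
  have hM2 : (M.card : ℝ) ≤ δ + 1 := by
    rw [hMcard]; push_cast; linarith [Nat.floor_le hε]
  have hbad : ∀ x ∈ M, ∃ j, j ≠ f x ∧ dist x (c j) ≤ α * dist x (c (f x)) := by
    intro x hx
    have := hMsub hx
    simpa [IsGood] using this
  have hne : Nonempty X := Fintype.card_pos_iff.mp (by lia)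
  have hnek : Nonempty (Fin k) := ⟨f hne.some⟩
  choose! s hs1 hs2 using hbad
  set h : X → Fin k := fun x => if x ∈ M then s x else f x with hh
  have hhM : ∀ x, x ∉ M → h x = f x := fun x hx => by simp [hh, hx]
  have hhM' : ∀ x, x ∈ M → h x = s x := fun x hx => by simp [hh, hx]
  -- The new center stays a cheapest old center after the perturbation. For x in M this holds
  -- because badness puts the rival within α times the distance to the own center, which is the
  -- nearest one.
  have hmin : ∀ x j, dist x (c (h x)) ≤ perturb α h c x (c j) := by
    intro x j
    unfold perturb
    split_ifs with hj
    · rw [hj]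
    · by_cases hx : x ∈ M
      · rw [hhM' x hx]
        exact (hs2 x hx).trans
          (mul_le_mul_of_nonneg_left (hopt.dist_le x j) (by linarith))
      · rw [hhM x hx]
        exact (hopt.dist_le x j).trans (le_mul_of_one_le_left dist_nonneg (by linarith))
  -- A perturbed optimum exists by finiteness. Resilience is applied twice: to this optimum, so that
  -- it can be compared with f cluster by cluster, and then to h, which the comparison proves to be
  -- optimal as well.
  obtain ⟨⟨g, b⟩, hgb⟩ := Finite.exists_min
    (fun gb : (X → Fin k) × (Fin k → X) => cost (perturb α h c) gb.1 gb.2)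
  have hpert := perturb_bounds (α := α) (by linarith) h c
  obtain ⟨σ, hσ⟩ := hres.2 _ hpert g ⟨b, fun g' b' => hgb (g', b')⟩
  rw [sum_card_cluster_sdiff] at hσ
  have hkey : cost (perturb α h c) h c ≤ cost (perturb α h c) g b := by
    rw [cost_eq_sum, cost_eq_sum, ← sub_nonneg, ← Finset.sum_sub_distrib,
      ← Finset.sum_fiberwise (s := Finset.univ) (g := fun x => σ.symm (g x))]
    refine Finset.sum_nonneg fun i _ => ?_
    have h1 : ({x | σ.symm (g x) ≠ f x}.toFinset.card : ℝ) ≤ δ := by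
      convert hσ using 5
      exact funext fun x => by rw [ne_eq, ne_eq, Equiv.symm_apply_eq]
    have h2 := perturb_cluster_gap (g := fun x => σ.symm (g x)) hopt hα hhM hM2 hmin hm h1
      (fun i => b (σ i)) i
    refine h2.trans_eq (Finset.sum_congr rfl fun x hx => ?_)
    have h3 : σ i = g x := by
      rw [← mem_cluster.mp hx, Equiv.apply_symm_apply]
    rw [h3]
    congr 1
    simp [perturb]
  obtain ⟨τ, hτ⟩ := hres.2 _ hpert h
    ⟨c, fun g' b' => hkey.trans (hgb (g', b'))⟩
  rw [sum_card_cluster_sdiff] at hτ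
  -- A nontrivial value of τ would mislabel all of cluster i outside M, forcing |C_i| ≤ 2δ + 1.
  have hτ1 : ∀ i, τ i = i := by
    intro i
    by_contra hi
    have h1 : cluster f i \ M ⊆ {x | h x ≠ τ (f x)}.toFinset := by
      intro x hx
      simp only [Finset.mem_sdiff, mem_cluster] at hx
      simp only [Set.mem_toFinset, Set.mem_ofPred_eq, hhM x hx.2, hx.1]
      exact Ne.symm hi
    have h2 := Finset.card_le_card h1
    have h3 := Finset.le_card_sdiff M (cluster f i)
    have h4 : ((cluster f i).card : ℝ) ≤ δ + M.card := by
      have h5 : (cluster f i).card ≤ {x | h x ≠ τ (f x)}.toFinset.card + M.card := by lia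
      have h6 : ((cluster f i).card : ℝ) ≤ {x | h x ≠ τ (f x)}.toFinset.card + M.card := by
        exact_mod_cast h5
      linarith
    linarith [hm i]
  have h1 : M ⊆ {x | h x ≠ τ (f x)}.toFinset := by
    intro x hx
    simp only [Set.mem_toFinset, Set.mem_ofPred_eq, hhM' x hx, hτ1]
    exact hs1 x hx
  have h2 : (M.card : ℝ) ≤ {x | h x ≠ τ (f x)}.toFinset.card := by
    exact_mod_cast Finset.card_le_card h1
  linarith

end Structure

/-! ### Trees -/

section Trees

variable {X : Type u}

theorem pointsAll_eq_flatMap (ts : List (CTree X)) : pointsAll ts = ts.flatMap CTree.points := by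
  induction ts with
  | nil => rfl
  | cons t ts ih => rw [pointsAll, ih, List.flatMap_cons]

theorem mem_pointsAll {ts : List (CTree X)} {x : X} :
    x ∈ pointsAll ts ↔ ∃ t ∈ ts, x ∈ t.points := by
  rw [pointsAll_eq_flatMap, List.mem_flatMap]

theorem CTree.points_leaf (c : List X) : (CTree.leaf c).points = c := by rw [CTree.points]

theorem CTree.points_node (ts : List (CTree X)) : (CTree.node ts).points = pointsAll ts := by
  rw [CTree.points]

mutual
theorem CTree.pointsT_val : (t : CTree X) → t.pointsT.val = t.points
  | .leaf c => by rw [CTree.pointsT, CTree.points, op_val]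
  | .node ts => by rw [CTree.pointsT, CTree.points, call_val, pointsAllT_val ts]
theorem pointsAllT_val : (ts : List (CTree X)) → (pointsAllT ts).val = pointsAll ts
  | [] => by rw [pointsAllT, pointsAll, op_val]
  | t :: ts => by
    rw [pointsAllT, pointsAll, call_val, bind_val, bind_val, appendT_val, CTree.pointsT_val t,
      pointsAllT_val ts]
end

/-- The leaves of the tree are single points, and the lists of children of its nodes all
satisfy `Q`. -/
inductive CTree.ForallNodes (Q : List (CTree X) → Prop) : CTree X → Prop
  | leaf (x : X) : ForallNodes Q (.leaf [x])
  | node {ts : List (CTree X)} : (∀ t ∈ ts, ForallNodes Q t) → Q ts → ForallNodes Q (.node ts)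

theorem eq_of_mem_points {F : List (CTree X)} (hF : (pointsAll F).Nodup) {s t : CTree X}
    (hs : s ∈ F) (ht : t ∈ F) {x : X} (hxs : x ∈ s.points) (hxt : x ∈ t.points) : s = t := by
  rw [pointsAll_eq_flatMap, List.nodup_flatMap] at hF
  by_contra hne
  have : Std.Symm (Function.onFun List.Disjoint (CTree.points (X := X))) :=
    ⟨fun a b h => List.Disjoint.symm h⟩
  exact hF.2.forall hs ht hne hxs hxt

theorem isSingle_iff {c : List X} : isSingle c = true ↔ ∃ x, c = [x] := by
  unfold isSingle
  split <;> simp_all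

theorem CTree.ForallNodes.cases_single {Q : List (CTree X) → Prop} {t : CTree X}
    (h : t.ForallNodes Q) :
    (∃ x, t = .leaf [x]) ∨ (t.isSingleLeaf = false ∧ ∃ ts, t = .node ts ∧ Q ts ∧
      ∀ s ∈ ts, s.ForallNodes Q) := by
  cases h with
  | leaf x => exact Or.inl ⟨x, rfl⟩
  | node h1 h2 => exact Or.inr ⟨rfl, _, rfl, h2, h1⟩

end Trees

/-! ### The good part of an instance -/

section Core

variable {X : Type u} [Fintype X] [DecidableEq X] [MetricSpace X] {k : ℕ}

/-- The clusters of `f` without the few points of `bad` are balls around the centers `c`, with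
radius `dist (c i) (q i)`, and they are well separated. -/
structure IsCore (f : X → Fin k) (c q : Fin k → X) (bad : Finset X) (m : ℕ) (δ : ℝ) : Prop where
  nonneg : 0 ≤ δ
  size_le : 5 * δ + 15 ≤ m
  le_card : ∀ i, m ≤ (cluster f i).card
  card_bad : (bad.card : ℝ) ≤ δ
  center_good : ∀ i, c i ∉ bad
  center_apply : ∀ i, f (c i) = i
  dist_le : ∀ x ∉ bad, dist x (c (f x)) ≤ dist (c (f x)) (q (f x))
  lt_dist : ∀ x ∉ bad, ∀ i, i ≠ f x → 3 * dist (c i) (q i) < dist x (c i)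

namespace IsCore

variable {f : X → Fin k} {c q : Fin k → X} {bad : Finset X} {m : ℕ} {δ : ℝ}
  (h : IsCore f c q bad m δ)
include h

/-- With R the radius of the group of x, the point x is within R of the center and y is beyond 3R.
Consequently a ball that contains both x and y has radius greater than R, which is what orders the
merges. -/
theorem two_mul_lt {x y : X} (hx : x ∉ bad) (hy : y ∉ bad) (hxy : f x ≠ f y) :
    2 * dist (c (f x)) (q (f x)) < dist x y := by
  have h1 := h.dist_le x hx
  have h2 := h.lt_dist y hy (f x) hxy
  have h3 := dist_triangle y x (c (f x))
  rw [dist_comm y x] at h3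
  linarith

/-- Two points of one group are at most 2R apart. This is what makes medians point to the right
group. -/
theorem dist_lt_dist {x y z : X} (hx : x ∉ bad) (hy : y ∉ bad) (hz : z ∉ bad) (hxy : f x = f y)
    (hxz : f x ≠ f z) : dist x y < dist x z := by
  have h1 := h.dist_le x hx
  have h2 := h.lt_dist z hz (f x) hxz
  have h3 := dist_triangle z x (c (f x))
  have h4 := h.dist_le y hy
  rw [← hxy] at h4
  have h5 := dist_triangle_right x y (c (f x))
  rw [dist_comm z x] at h3
  linarith

theorem le_card_sdiff (i : Fin k) : (m : ℝ) - δ ≤ ((cluster f i \ bad).card : ℝ) := by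
  have h1 := Finset.le_card_sdiff bad (cluster f i)
  have h2 : ((cluster f i).card : ℝ) ≤ (cluster f i \ bad).card + bad.card := by
    exact_mod_cast (by lia : (cluster f i).card ≤ (cluster f i \ bad).card + bad.card)
  have h3 : (m : ℝ) ≤ (cluster f i).card := by exact_mod_cast h.le_card i
  linarith [h.card_bad]

theorem exists_good {l : List X} (hl : l.Nodup) (hlt : δ < l.length) : ∃ x ∈ l, x ∉ bad := by
  by_contra! hall
  have h1 : l.toFinset ⊆ bad := fun x hx => hall x (List.mem_toFinset.mp hx)
  have h2 := Finset.card_le_card h1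
  rw [List.toFinset_card_of_nodup hl] at h2
  have h3 : (l.length : ℝ) ≤ bad.card := by exact_mod_cast h2
  linarith [h.card_bad]

theorem le_length {l : List X} {i : Fin k} (hl : ∀ x ∉ bad, f x = i → x ∈ l) :
    (m : ℝ) - δ ≤ l.length := by
  refine (h.le_card_sdiff i).trans ?_
  have h1 : cluster f i \ bad ⊆ l.toFinset := fun x hx => by
    rw [Finset.mem_sdiff, mem_cluster] at hx
    exact List.mem_toFinset.mpr (hl x hx.2 hx.1)
  exact_mod_cast (Finset.card_le_card h1).trans (List.toFinset_card_le l)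

theorem length_le {l : List X} (hl : l.Nodup) (hb : ∀ x ∈ l, x ∈ bad) : (l.length : ℝ) ≤ δ := by
  refine le_trans ?_ h.card_bad
  rw [← List.toFinset_card_of_nodup hl]
  exact_mod_cast Finset.card_le_card fun x hx => hb x (List.mem_toFinset.mp hx)

end IsCore

/-! ### The linkage phase -/

/-- The properties of the lists of clusters that are merged in the linkage phase. -/
structure IsMerge (f : X → Fin k) (bad : Finset X) (m : ℕ) (δ : ℝ) (ts : List (CTree X)) :
    Prop where
  size : (m : ℝ) - δ ≤ (pointsAll ts).length
  -- Groups are never torn apart by a mixed merge: below it, each child is a union of whole groups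
  -- as far as good points are concerned.
  split : ∀ x ∈ pointsAll ts, ∀ y ∈ pointsAll ts, x ∉ bad → y ∉ bad → f x ≠ f y →
    ∀ t ∈ ts, ∀ z ∈ t.points, z ∉ bad → ∀ w ∉ bad, f w = f z → w ∈ t.points
  -- Recorded for merges of single points, which become leaves. It later bounds the cost of bad
  -- points that lie in such a leaf from the start, and so are not placed by a median.
  margin : (∀ t ∈ ts, t.isSingleLeaf = true) → ∀ p ∈ pointsAll ts, ∀ y ∈ pointsAll ts, y ∉ bad →
    ∀ i, i ≠ f y → ∃ E : Finset X, (E.card : ℝ) ≤ δ ∧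
      ∀ z ∈ pointsAll ts, ∀ w ∉ bad, f w = i → w ∉ E → dist p z < dist p w

theorem CTree.ForallNodes.size_le {f : X → Fin k} {bad : Finset X} {m : ℕ} {δ : ℝ} {t : CTree X}
    (ht : t.ForallNodes (IsMerge f bad m δ)) (hs : t.isSingleLeaf = false) :
    (m : ℝ) - δ ≤ t.points.length := by
  rcases ht.cases_single with ⟨x, rfl⟩ | ⟨-, ts, rfl, h, -⟩
  · simp [CTree.isSingleLeaf, isSingle] at hs
  · rw [CTree.points_node]; exact h.size

/-- The `split` property at the root. In contrapositive form: a tree that holds a group only partly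
has no good points of other groups. -/
theorem CTree.ForallNodes.full {f : X → Fin k} {bad : Finset X} {m : ℕ} {δ : ℝ} {t : CTree X}
    (ht : t.ForallNodes (IsMerge f bad m δ)) {x y : X} (hx : x ∈ t.points) (hy : y ∈ t.points)
    (hxb : x ∉ bad) (hyb : y ∉ bad) (hxy : f x ≠ f y) {z w : X} (hz : z ∈ t.points)
    (hzb : z ∉ bad) (hw : w ∉ bad) (hwz : f w = f z) : w ∈ t.points := by
  rcases ht.cases_single with ⟨a, rfl⟩ | ⟨-, ts, rfl, h, -⟩
  · rw [CTree.points_leaf, List.mem_singleton] at hx hy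
    rw [hx, hy] at hxy
    exact absurd rfl hxy
  · rw [CTree.points_node] at *
    obtain ⟨t, ht, hzt⟩ := mem_pointsAll.mp hz
    exact mem_pointsAll.mpr ⟨t, ht, h.split x hx y hy hxb hyb hxy t ht z hzt hzb w hw hwz⟩

/-- The invariant of the linkage phase: `done` lists the pairs that were examined so far, `F` is the
current forest. -/
structure LinkInv (f : X → Fin k) (c q : Fin k → X) (bad : Finset X) (m : ℕ) (δ : ℝ)
    (pts : List X) (done : List (X × X)) (F : List (CTree X)) : Prop where
  perm : (pointsAll F).Perm pts
  nodes : ∀ t ∈ F, t.ForallNodes (IsMerge f bad m δ)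
  whole : ∀ i, (c i, q i) ∈ done → ∃ t ∈ F, ∀ y ∉ bad, f y = i → y ∈ t.points

theorem nearlyInT_val (I : Input X) (δ : ℝ) (p : X) (r : ℝ) (t : CTree X) :
    (nearlyInT I δ p r t).val = true ↔ (∃ x ∈ t.points, I.d x p ≤ r) ∧
      ((t.points.filter (fun x => !decide (I.d x p ≤ r))).length : ℝ) ≤ δ := by
  simp only [nearlyInT, bind_val, op_val, splitT_val, lengthT_val, CTree.pointsT_val, inBallT,
    Bool.and_eq_true, decide_eq_true_eq, List.length_pos_iff_exists_mem, List.mem_filter]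
  exact and_congr (exists_congr fun a => and_congr_right fun _ => decide_eq_true_iff) Iff.rfl

theorem linkT_val (I : Input X) (δ : ℝ) (F : List (CTree X)) (pq : X × X) :
    (linkT I δ F pq).val =
      if (approxClosureT I δ pq.1 (I.d pq.1 pq.2)
          (pointsAll (F.filter fun t => (nearlyInT I δ pq.1 (I.d pq.1 pq.2) t).val))).val = true ∧
          1 < (F.filter fun t => (nearlyInT I δ pq.1 (I.d pq.1 pq.2) t).val).length then
        .node (F.filter fun t => (nearlyInT I δ pq.1 (I.d pq.1 pq.2) t).val) ::
          F.filter fun t => !(nearlyInT I δ pq.1 (I.d pq.1 pq.2) t).val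
      else F := by
  simp [linkT, splitT_val, lengthT_val, pointsAllT_val]

section Step

variable {f : X → Fin k} {c q : Fin k → X} {bad : Finset X} {δ : ℝ} {I : Input X}
  (hcore : IsCore f c q bad I.m δ) (hd : I.d = dist)
include hcore hd

/-- A cluster nearly contained in a ball meets the ball in each of the groups that it meets. -/
theorem exists_mem_ball {p : X} {r : ℝ} {t : CTree X}
    (ht : t.ForallNodes (IsMerge f bad I.m δ)) (hnd : t.points.Nodup)
    (hnear : (nearlyInT I δ p r t).val = true) {z : X} (hz : z ∈ t.points) (hzb : z ∉ bad) :
    ∃ w ∈ t.points, w ∉ bad ∧ f w = f z ∧ dist w p ≤ r := by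
  rw [nearlyInT_val, hd] at hnear
  obtain ⟨⟨x, hx, hxr⟩, hout⟩ := hnear
  have hδ := hcore.nonneg
  have hm := hcore.size_le
  rcases ht.cases_single with ⟨a, rfl⟩ | ⟨hs, -⟩
  · rw [CTree.points_leaf, List.mem_singleton] at hx hz
    subst hx hz
    exact ⟨_, by simp [CTree.points_leaf], hzb, rfl, hxr⟩
  -- The tree is not a single point, so it has at least m - δ points, of which more than δ are in
  -- the ball, and one of these is good. If the group of z missed the ball, the tree would be mixed,
  -- hence contain that whole group, giving m - δ points outside the ball where only δ are allowed.
  by_contra! hno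
  have hlen := List.length_eq_length_filter_add (l := t.points) (fun x => decide (dist x p ≤ r))
  have hlen' : (t.points.length : ℝ) =
      (t.points.filter (fun x => decide (dist x p ≤ r))).length +
      (t.points.filter (fun x => !decide (dist x p ≤ r))).length := by exact_mod_cast hlen
  obtain ⟨y, hy, hyb⟩ := hcore.exists_good (hnd.filter _)
    (by linarith [ht.size_le hs] : δ < (t.points.filter (fun x => decide (dist x p ≤ r))).length)
  simp only [List.mem_filter, decide_eq_true_eq] at hy
  have hyz : f y ≠ f z := fun he => (hno y hy.1 hyb he).not_ge hy.2
  have h1 := hcore.le_length (i := f z) (l := t.points.filter (fun x => !decide (dist x p ≤ r)))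
    (fun x hx hxz => by
      have hxt := ht.full hy.1 hz hyb hzb hyz hz hzb hx hxz
      simpa [List.mem_filter, hxt] using hno x hxt hx hxz)
  linarith

/-- The hypothesis `hdone` is all that the sorted order is needed for: groups of radius smaller than
the current ball were handled earlier and are united by the invariant. -/
theorem LinkInv.step (hnd : I.pts.Nodup) (hall : ∀ x, x ∈ I.pts) {done : List (X × X)}
    {F : List (CTree X)} (hinv : LinkInv f c q bad I.m δ I.pts done F) (pq : X × X)
    (hdone : ∀ i, dist (c i) (q i) < dist pq.1 pq.2 → (c i, q i) ∈ done) :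
    LinkInv f c q bad I.m δ I.pts (pq :: done) (linkT I δ F pq).val := by
  have hδ := hcore.nonneg
  have hm := hcore.size_le
  obtain ⟨p, s⟩ := pq
  rw [linkT_val]
  simp only [hd] at hdone ⊢
  set r := dist p s with hr
  set near : CTree X → Bool := fun t => (nearlyInT I δ p r t).val with hnear
  set U := F.filter near with hU
  set R := F.filter (fun t => !near t) with hR
  have hFnd : (pointsAll F).Nodup := hinv.perm.nodup_iff.mpr hnd
  have hmemU : ∀ t, t ∈ U ↔ t ∈ F ∧ (nearlyInT I δ p r t).val = true := fun t => by
    rw [hU, List.mem_filter]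
  have hmemR : ∀ t, t ∈ F → t ∈ U ∨ t ∈ R := fun t ht => by
    rw [hU, hR, List.mem_filter, List.mem_filter]
    cases near t <;> simp [ht]
  have htnd : ∀ t ∈ F, t.points.Nodup := by
    rw [pointsAll_eq_flatMap, List.nodup_flatMap] at hFnd
    exact hFnd.1
  have hperm : (pointsAll U ++ pointsAll R).Perm (pointsAll F) := by
    simp only [pointsAll_eq_flatMap, ← List.flatMap_append]
    exact (List.filter_append_perm near F).flatMap_right _
  have hUnd : (pointsAll U).Nodup := ((hperm.nodup_iff.mpr hFnd).of_append_left)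
  have hclosure := approxClosureT_val I hnd hall δ p r (pointsAll U) hUnd
  rw [hd] at hclosure
  have hball : ∀ z ∈ pointsAll U, z ∉ bad → ∃ w ∈ pointsAll U, w ∉ bad ∧ f w = f z ∧
      dist w p ≤ r := by
    intro z hz hzb
    obtain ⟨t, ht, hzt⟩ := mem_pointsAll.mp hz
    have ht' := (hmemU t).mp ht
    obtain ⟨w, hw, h⟩ := exists_mem_ball hcore hd (hinv.nodes t ht'.1) (htnd t ht'.1) ht'.2 hzt hzb
    exact ⟨w, mem_pointsAll.mpr ⟨t, ht, hw⟩, h⟩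
  -- Here 2R < d(x,y) ≤ 2r, so the group of x has radius below r and was united in an earlier round.
  have hrad : ∀ x y, x ∉ bad → y ∉ bad → f x ≠ f y → dist x p ≤ r → dist y p ≤ r →
      ∃ t ∈ F, ∀ z ∉ bad, f z = f x → z ∈ t.points := by
    intro x y hx hy hxy hxp hyp
    refine hinv.whole _ (hdone _ ?_)
    have h1 := hcore.two_mul_lt hx hy hxy
    have h2 := dist_triangle_right x y p
    linarith
  have hkeep : ∀ i, (∃ t ∈ F, ∀ y ∉ bad, f y = i → y ∈ t.points) →
      ∃ t ∈ CTree.node U :: R, ∀ y ∉ bad, f y = i → y ∈ t.points := by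
    rintro i ⟨t, ht, hti⟩
    rcases hmemR t ht with h | h
    · refine ⟨_, List.mem_cons_self, fun y hy hyi => ?_⟩
      rw [CTree.points_node]
      exact mem_pointsAll.mpr ⟨t, h, hti y hy hyi⟩
    · exact ⟨t, List.mem_cons_of_mem _ h, hti⟩
  -- The round of (c i, q i) when group i is still scattered. Each tree meeting the group is then
  -- unmixed, so its points outside the ball are bad and it is nearly contained; the test will
  -- succeed.
  have hnew : ∀ i, (c i, q i) = (p, s) → (¬ ∃ t ∈ F, ∀ y ∉ bad, f y = i → y ∈ t.points) →
      (∀ y ∉ bad, f y = i → y ∈ pointsAll U) ∧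
        ApproxClosure dist δ I.m p r (pointsAll U).toFinset := by
    intro i hi hno
    obtain ⟨rfl, rfl⟩ := Prod.mk.inj hi
    have hin : ∀ x ∉ bad, f x = i → dist x (c i) ≤ r := fun x hx hxi => by
      have := hcore.dist_le x hx
      rwa [hxi] at this
    have hout : ∀ x ∉ bad, f x ≠ i → 3 * r < dist x (c i) := fun x hx hxi =>
      hcore.lt_dist x hx i (Ne.symm hxi)
    have hr0 : 0 ≤ r := dist_nonneg
    have h1 : ∀ y ∉ bad, f y = i → y ∈ pointsAll U := by
      intro y hy hyi
      have hyF : y ∈ pointsAll F := hinv.perm.mem_iff.mpr (hall y)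
      obtain ⟨t, ht, hyt⟩ := mem_pointsAll.mp hyF
      have hti : ∀ x ∈ t.points, x ∉ bad → f x = i := by
        intro x hx hxb
        by_contra hxi
        refine hno ⟨t, ht, fun w hw hwi => ?_⟩
        exact (hinv.nodes t ht).full hx hyt hxb hy (by rwa [hyi]) hyt hy hw (by rw [hwi, hyi])
      refine mem_pointsAll.mpr ⟨t, (hmemU t).mpr ⟨ht, ?_⟩, hyt⟩
      rw [nearlyInT_val, hd]
      refine ⟨⟨y, hyt, hin y hy hyi⟩, hcore.length_le ((htnd t ht).filter _) fun x hx => ?_⟩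
      simp only [List.mem_filter, Bool.not_eq_true', decide_eq_false_iff_not] at hx
      by_contra hxb
      exact hx.2 (hin x hxb (hti x hx.1 hxb))
    -- The exceptional set consists of the bad points outside the ball. Any other outside point is
    -- beyond 3r from c i, hence more than 2r from each point of the ball, while two points of the
    -- ball are at most 2r apart.
    refine ⟨h1, ?_, ?_, {x ∈ bad | ¬ dist x (c i) ≤ r}, ?_, ?_, ?_⟩
    · rw [List.toFinset_card_of_nodup hUnd]
      exact hcore.le_length h1
    · refine le_trans ?_ hcore.card_bad
      norm_cast
      refine Finset.card_le_card fun x hx => ?_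
      rw [Finset.mem_filter, List.mem_toFinset] at hx
      by_contra hxb
      obtain ⟨w, -, hwb, hwx, hwr⟩ := hball x hx.1 hxb
      by_cases hxi : f x = i
      · exact hx.2 (hin x hxb hxi)
      · have := hout w hwb (by rwa [hwx])
        linarith
    · intro x hx
      exact (Finset.mem_filter.mp hx).2
    · refine le_trans ?_ hcore.card_bad
      exact_mod_cast Finset.card_filter_le _ _
    · intro p₁ p₂ q₁ h₁ h₂ hq hqE
      have hqb : q₁ ∉ bad := fun hb => hqE (Finset.mem_filter.mpr ⟨hb, hq⟩)
      have hqi : f q₁ ≠ i := fun he => hq (hin q₁ hqb he)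
      have h3 := hout q₁ hqb hqi
      have h4 := dist_triangle_right p₁ p₂ (c i)
      have h5 := dist_triangle_left q₁ (c i) p₁
      linarith
  by_cases hok : (approxClosureT I δ p r (pointsAll U)).val = true ∧ 1 < U.length
  · rw [if_pos hok]
    obtain ⟨hu1, hu2, E, hE1, hE2, hE3⟩ := hclosure.mp hok.1
    refine ⟨?_, ?_, ?_⟩
    · rw [pointsAll, CTree.points_node]
      exact hperm.trans hinv.perm
    · intro t ht
      rcases List.mem_cons.mp ht with rfl | ht
      · refine .node (fun t ht => hinv.nodes t ((hmemU t).mp ht).1) ⟨?_, ?_, ?_⟩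
        · refine hu1.trans ?_
          exact_mod_cast List.toFinset_card_le _
        -- Both the group of z and some other group have good representatives in the ball by
        -- `hball`, so `hrad` has already united the group of z, and the tree containing it must be
        -- t.
        · intro x hx y hy hxb hyb hxy t ht z hzt hzb w hwb hwz
          have hz : z ∈ pointsAll U := mem_pointsAll.mpr ⟨t, ht, hzt⟩
          obtain ⟨z₁, -, hz₁b, hz₁, hz₁r⟩ := hball z hz hzb
          obtain ⟨y₁, hy₁b, hy₁, hy₁r⟩ : ∃ y₁, y₁ ∉ bad ∧ f y₁ ≠ f z ∧ dist y₁ p ≤ r := by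
            by_cases hxz : f x = f z
            · obtain ⟨y₁, -, h1, h2, h3⟩ := hball y hy hyb
              exact ⟨y₁, h1, by rw [h2, ← hxz]; exact hxy.symm, h3⟩
            · obtain ⟨y₁, -, h1, h2, h3⟩ := hball x hx hxb
              exact ⟨y₁, h1, by rwa [h2], h3⟩
          obtain ⟨t', ht', hwh⟩ := hrad z₁ y₁ hz₁b hy₁b (by rw [hz₁]; exact hy₁.symm) hz₁r hy₁r
          have htt := eq_of_mem_points hFnd ht' ((hmemU t).mp ht).1 (hwh z hzb hz₁.symm) hzt
          rw [← htt]
          exact hwh w hwb (by rw [hwz, hz₁])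
        -- A single point that is nearly contained lies in the ball, so the test supplies the margin
        -- for each w outside the ball. A good w of another group inside the ball would mean that
        -- the group of y is already united, in a tree that is a single point.
        · intro hsing a ha y hy hyb i hi
          have hsub : ∀ x ∈ pointsAll U, dist x p ≤ r := by
            intro x hx
            obtain ⟨t, ht, hxt⟩ := mem_pointsAll.mp hx
            have ht' := (hmemU t).mp ht
            have hs := hsing t ht
            rcases (hinv.nodes t ht'.1).cases_single with ⟨b, rfl⟩ | ⟨h, -⟩
            · have hn := ht'.2
              rw [nearlyInT_val, hd] at hn
              obtain ⟨b', hb', hr'⟩ := hn.1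
              rw [CTree.points_leaf, List.mem_singleton] at hb' hxt
              rwa [hxt, ← hb']
            · rw [hs] at h; cases h
          refine ⟨E, hE2, fun z hz w hwb hwi hwE => hE3 _ _ _ (hsub a ha) (hsub z hz) ?_ hwE⟩
          intro hwr
          obtain ⟨t', ht', hh⟩ := hrad y w hyb hwb (by rw [hwi]; exact hi.symm) (hsub y hy) hwr
          obtain ⟨t, ht, hyt⟩ := mem_pointsAll.mp hy
          have htt := eq_of_mem_points hFnd ht' ((hmemU t).mp ht).1 (hh y hyb rfl) hyt
          have hs := hsing t ht
          have hlen := hcore.le_length hh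
          rw [htt] at hlen
          rcases (hinv.nodes t ((hmemU t).mp ht).1).cases_single with ⟨b, rfl⟩ | ⟨h, -⟩
          · rw [CTree.points_leaf, List.length_singleton] at hlen
            push_cast at hlen
            linarith
          · rw [hs] at h; cases h
      · exact hinv.nodes t (List.mem_of_mem_filter ht)
    · intro i hi
      rcases List.mem_cons.mp hi with hi | hi
      · by_cases hno : ∃ t ∈ F, ∀ y ∉ bad, f y = i → y ∈ t.points
        · exact hkeep i hno
        · refine ⟨_, List.mem_cons_self, ?_⟩
          rw [CTree.points_node]
          exact (hnew i hi hno).1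
      · exact hkeep i (hinv.whole i hi)
  · rw [if_neg hok]
    refine ⟨hinv.perm, hinv.nodes, fun i hi => ?_⟩
    rcases List.mem_cons.mp hi with hi | hi
    · by_contra hno
      obtain ⟨h1, h2⟩ := hnew i hi hno
      -- The test succeeds, so a merge can only fail to happen because one tree alone is nearly
      -- contained; that tree then holds the whole group.
      have h3 : U.length ≤ 1 := by
        by_contra! h4
        exact hok ⟨hclosure.mpr h2, h4⟩
      obtain ⟨t, ht, -⟩ := mem_pointsAll.mp (h1 (c i) (hcore.center_good i) (hcore.center_apply i))
      have hUt : U = [t] := by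
        match hUU : U, h3, ht with
        | [a], _, ht => rw [List.mem_singleton.mp ht]
      refine hno ⟨t, ((hmemU t).mp ht).1, fun y hy hyi => ?_⟩
      have := h1 y hy hyi
      rwa [hUt, pointsAll, pointsAll, List.append_nil] at this
    · exact hinv.whole i hi

end Step

end Core

/-! ### The tree produced by the linkage phase -/

section Linkage

variable {X : Type u} [Fintype X] [DecidableEq X] [MetricSpace X] {k : ℕ}
  {f : X → Fin k} {c q : Fin k → X} {bad : Finset X} {δ : ℝ} {I : Input X}

/-- Sortedness supplies `hdone`: a critical pair strictly below the current distance can no longer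
be among the remaining ones. -/
theorem LinkInv.foldl (hcore : IsCore f c q bad I.m δ) (hd : I.d = dist) (hnd : I.pts.Nodup)
    (hall : ∀ x, x ∈ I.pts) (rest done : List (X × X)) (F : List (CTree X))
    (hinv : LinkInv f c q bad I.m δ I.pts done F)
    (hmem : ∀ i, (c i, q i) ∈ done ∨ (c i, q i) ∈ rest)
    (hsort : rest.Pairwise (fun a b => dist a.1 a.2 ≤ dist b.1 b.2)) :
    LinkInv f c q bad I.m δ I.pts (rest.reverse ++ done)
      (rest.foldl (fun F pq => (linkT I δ F pq).val) F) := by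
  induction rest generalizing done F with
  | nil => simpa using hinv
  | cons pq rest ih =>
    rw [List.pairwise_cons] at hsort
    rw [List.foldl_cons, List.reverse_cons, List.append_assoc, List.singleton_append]
    refine ih _ _ (hinv.step hcore hd hnd hall pq fun i hi => ?_) (fun i => ?_) hsort.2
    · rcases hmem i with h | h
      · exact h
      · rcases List.mem_cons.mp h with h | h
        · rw [← h] at hi
          exact absurd hi (lt_irrefl _)
        · exact absurd hi (hsort.1 _ h).not_gt
    · rcases hmem i with h | h
      · exact Or.inl (List.mem_cons_of_mem _ h)
      · rcases List.mem_cons.mp h with h | h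
        · exact Or.inl (h ▸ List.mem_cons_self)
        · exact Or.inr h

theorem slackT_val (I : Input X) : (slackT I).val = I.ε * I.pts.length := by
  simp [slackT, lengthT_val]

theorem linkageT_spec (hcore : IsCore f c q bad I.m (I.ε * I.pts.length)) (hd : I.d = dist)
    (hnd : I.pts.Nodup) (hall : ∀ x, x ∈ I.pts) [hX : Nonempty X] :
    (linkageT I).val.ForallNodes (IsMerge f bad I.m (I.ε * I.pts.length)) ∧
      (linkageT I).val.points.Perm I.pts ∧ (linkageT I).val.isSingleLeaf = false := by
  set δ := I.ε * I.pts.length with hδ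
  set sorted := (sortT (fun pq => I.d pq.1 pq.2) (pairsT I.pts I.pts).val).val with hsorted
  set F := sorted.foldl (fun F pq => (linkT I δ F pq).val) (I.pts.map fun x => .leaf [x]) with hF
  have hval : (linkageT I).val = (fun ts : List (CTree X) => match ts with
      | [t] => t
      | ts => .node ts) F := by
    simp only [linkageT, bind_val, op_val, slackT_val, mapT_val, foldT_val]
    rfl
  have hinv : LinkInv f c q bad I.m δ I.pts (sorted.reverse ++ []) F := by
    refine LinkInv.foldl hcore hd hnd hall sorted [] _ ⟨?_, ?_, ?_⟩ ?_ ?_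
    · rw [pointsAll_eq_flatMap, List.flatMap_map]
      simp [CTree.points_leaf]
    · intro t ht
      obtain ⟨x, -, rfl⟩ := List.mem_map.mp ht
      exact .leaf x
    · simp
    · intro i
      right
      rw [hsorted, (sortT_perm _ _).mem_iff, mem_pairsT]
      exact ⟨hall _, hall _⟩
    · have := sortT_sorted (fun pq : X × X => I.d pq.1 pq.2) (pairsT I.pts I.pts).val
      rw [hd] at this
      rw [hsorted, hd]
      exact this
  have hwhole : ∀ i, ∃ t ∈ F, ∀ y ∉ bad, f y = i → y ∈ t.points := by
    intro i
    refine hinv.whole i ?_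
    rw [List.append_nil, List.mem_reverse, hsorted, (sortT_perm _ _).mem_iff, mem_pairsT]
    exact ⟨hall _, hall _⟩
  have hFnd : (pointsAll F).Nodup := hinv.perm.nodup_iff.mpr hnd
  have hm := hcore.size_le
  have hδ0 := hcore.nonneg
  have hlen : ∀ ts : List (CTree X), (pointsAll ts).Perm I.pts →
      (I.m : ℝ) - δ ≤ (pointsAll ts).length := by
    intro ts hts
    exact hcore.le_length (i := f hX.some) fun x _ _ => hts.mem_iff.mpr (hall x)
  -- The closing root also counts as a legitimate merge: every group is in one tree by now, so
  -- `split` holds, and a tree with a whole group is not a single point, so `margin` is vacuous.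
  have hnode : (CTree.node F).ForallNodes (IsMerge f bad I.m δ) := by
    refine .node hinv.nodes ⟨hlen F hinv.perm, ?_, ?_⟩
    · intro _ _ _ _ _ _ _ t ht z hz hzb w hw hwz
      obtain ⟨t', ht', h⟩ := hwhole (f z)
      rw [eq_of_mem_points hFnd ht ht' hz (h z hzb rfl)]
      exact h w hw hwz
    · intro hs
      obtain ⟨t, ht, h⟩ := hwhole (f hX.some)
      have h1 := hcore.le_length h
      rcases (hinv.nodes t ht).cases_single with ⟨x, rfl⟩ | ⟨h2, -⟩
      · rw [CTree.points_leaf, List.length_singleton] at h1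
        push_cast at h1
        linarith
      · rw [hs t ht] at h2; cases h2
  have hres : (linkageT I).val.ForallNodes (IsMerge f bad I.m δ) ∧
      (linkageT I).val.points.Perm I.pts := by
    have hcases : (∃ t, F = [t] ∧ (linkageT I).val = t) ∨ (linkageT I).val = .node F := by
      rw [hval]
      match F with
      | [] => exact Or.inr rfl
      | [t] => exact Or.inl ⟨t, rfl, rfl⟩
      | _ :: _ :: _ => exact Or.inr rfl
    rcases hcases with ⟨t, heq, h⟩ | h
    · rw [h]
      refine ⟨hinv.nodes t (by rw [heq]; simp), ?_⟩
      have := hinv.perm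
      rwa [heq, pointsAll, pointsAll, List.append_nil] at this
    · rw [h]
      refine ⟨hnode, ?_⟩
      rw [CTree.points_node]
      exact hinv.perm
  refine ⟨hres.1, hres.2, ?_⟩
  rcases hres.1.cases_single with ⟨x, hx⟩ | ⟨h, -⟩
  · have h1 := hcore.le_length (i := f hX.some) (l := (linkageT I).val.points)
      fun x _ _ => hres.2.mem_iff.mpr (hall x)
    rw [hx, CTree.points_leaf, List.length_singleton] at h1
    push_cast at h1
    linarith
  · exact h

end Linkage

/-! ### Medians -/

section Median

variable {X : Type u} (I : Input X)

theorem medianT_val (p : X) (c : List X) (hc : c ≠ []) : ∃ s : List ℝ, ∃ a b : ℝ,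
    s.Perm (c.map (I.d p)) ∧ s.Pairwise (· ≤ ·) ∧ s[(c.length - 1) / 2]? = some a ∧
      s[c.length / 2]? = some b ∧ a ≤ (medianT I p c).val ∧ (medianT I p c).val ≤ b := by
  set s := (sortT (fun t : ℝ => t) (c.map (I.d p))).val with hs
  have hperm : s.Perm (c.map (I.d p)) := sortT_perm _ _
  have hlen : s.length = c.length := by rw [hperm.length_eq, List.length_map]
  have hsort : s.Pairwise (· ≤ ·) := sortT_sorted (fun t : ℝ => t) _
  have hpos : 0 < c.length := List.length_pos_iff.mpr hc
  have h1 : (c.length - 1) / 2 < s.length := by lia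
  have h2 : c.length / 2 < s.length := by lia
  have hle : s[(c.length - 1) / 2] ≤ s[c.length / 2] := by
    rcases (by lia : (c.length - 1) / 2 = c.length / 2 ∨ (c.length - 1) / 2 < c.length / 2)
      with h | h
    · simp only [h, le_refl]
    · exact List.pairwise_iff_getElem.mp hsort _ _ h1 h2 h
  have hval : (medianT I p c).val = (s[(c.length - 1) / 2] + s[c.length / 2]) / 2 := by
    simp only [medianT, bind_val, op_val, mapT_val, lengthT_val, nthT_val]
    rw [← hs, hlen, List.getElem?_eq_getElem h1, List.getElem?_eq_getElem h2]
    rfl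
  refine ⟨s, _, _, hperm, hsort, List.getElem?_eq_getElem h1, List.getElem?_eq_getElem h2, ?_, ?_⟩
  · rw [hval]; linarith
  · rw [hval]; linarith

/-- The sorted distances up to the lower middle index are at most the median, and they number
⌊(n-1)/2⌋ + 1 ≥ n/2. The companion estimate uses the entries from the upper middle index on. -/
theorem length_le_two_mul_filter_le_median (p : X) (c : List X) :
    c.length ≤ 2 * (c.filter (fun x => decide (I.d p x ≤ (medianT I p c).val))).length := by
  rcases eq_or_ne c [] with rfl | hc
  · simp
  obtain ⟨s, a, b, hperm, hsort, ha, -, hle, -⟩ := medianT_val I p c hc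
  set M := (medianT I p c).val
  have hpos : 0 < c.length := List.length_pos_iff.mpr hc
  have hlen : s.length = c.length := by rw [hperm.length_eq, List.length_map]
  have h1 : (c.filter (fun x => decide (I.d p x ≤ M))).length =
      s.countP (fun t => decide (t ≤ M)) := by
    rw [hperm.countP_eq, List.countP_map, List.countP_eq_length_filter]
    rfl
  have h2 : (s.take ((c.length - 1) / 2 + 1)).countP (fun t => decide (t ≤ M)) =
      (s.take ((c.length - 1) / 2 + 1)).length := by
    rw [List.countP_eq_length]
    intro t ht
    obtain ⟨j, hj, rfl⟩ := List.mem_take_iff_getElem.mp ht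
    obtain ⟨h, rfl⟩ := List.getElem?_eq_some_iff.mp ha
    refine decide_eq_true (le_trans ?_ hle)
    rcases (by lia : j = (c.length - 1) / 2 ∨ j < (c.length - 1) / 2) with h' | h'
    · simp only [h', le_refl]
    · exact List.pairwise_iff_getElem.mp hsort _ _ _ _ h'
  have h3 := (List.take_sublist ((c.length - 1) / 2 + 1) s).countP_le (p := fun t => decide (t ≤ M))
  rw [h2, List.length_take, hlen] at h3
  rw [h1]
  lia

theorem length_le_two_mul_filter_median_le (p : X) (c : List X) :
    c.length ≤ 2 * (c.filter (fun x => decide ((medianT I p c).val ≤ I.d p x))).length := by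
  rcases eq_or_ne c [] with rfl | hc
  · simp
  obtain ⟨s, a, b, hperm, hsort, -, hb, -, hle⟩ := medianT_val I p c hc
  set M := (medianT I p c).val
  have hlen : s.length = c.length := by rw [hperm.length_eq, List.length_map]
  have h1 : (c.filter (fun x => decide (M ≤ I.d p x))).length =
      s.countP (fun t => decide (M ≤ t)) := by
    rw [hperm.countP_eq, List.countP_map, List.countP_eq_length_filter]
    rfl
  have h2 : (s.drop (c.length / 2)).countP (fun t => decide (M ≤ t)) =
      (s.drop (c.length / 2)).length := by
    rw [List.countP_eq_length]
    intro t ht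
    obtain ⟨j, hj, rfl⟩ := List.mem_drop_iff_getElem.mp ht
    obtain ⟨h, rfl⟩ := List.getElem?_eq_some_iff.mp hb
    refine decide_eq_true (hle.trans ?_)
    rcases (by lia : c.length / 2 = c.length / 2 + j ∨ c.length / 2 < c.length / 2 + j)
      with h' | h'
    · simp only [← h', le_refl]
    · exact List.pairwise_iff_getElem.mp hsort _ _ _ _ h'
  have h3 := (List.drop_sublist (c.length / 2) s).countP_le (p := fun t => decide (M ≤ t))
  rw [h2, List.length_drop, hlen] at h3
  rw [h1]
  lia

/-- The assignment of a point to a leaf of smallest median distance. -/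
theorem nearestLeafT_val (p : X) (leaves : List (List X)) (hne : leaves ≠ [])
    (hl : ∀ L ∈ leaves, L ≠ []) : ∃ t r, (nearestLeafT I p leaves).val = some (t, r) ∧
      (∃ L ∈ leaves, r ∈ L ∧ (medianT I p L).val = t) ∧
      ∀ L ∈ leaves, t ≤ (medianT I p L).val := by
  set step : Option (ℝ × X) → List X → Option (ℝ × X) := fun best c => match c, best with
      | [], b => b
      | r :: _, none => some ((medianT I p c).val, r)
      | r :: _, some b => if (medianT I p c).val < b.1 then some ((medianT I p c).val, r) else some b
    with hstep
  have hval : (nearestLeafT I p leaves).val = leaves.foldl step none := by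
    rw [nearestLeafT, foldT_val]
    rfl
  rw [hval]
  -- Fold invariant: `done` lists the leaves already compared, and the current pair is the minimum
  -- over them.
  have key : ∀ (l done : List (List X)) (t : ℝ) (r : X), (∀ L ∈ l, L ≠ []) →
      (∃ L ∈ done, r ∈ L ∧ (medianT I p L).val = t) → (∀ L ∈ done, t ≤ (medianT I p L).val) →
      ∃ t₁ r₁, l.foldl step (some (t, r)) = some (t₁, r₁) ∧
        (∃ L ∈ done ++ l, r₁ ∈ L ∧ (medianT I p L).val = t₁) ∧
        ∀ L ∈ done ++ l, t₁ ≤ (medianT I p L).val := by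
    intro l
    induction l with
    | nil => intro done t r _ h1 h2; exact ⟨t, r, rfl, by simpa using h1, by simpa using h2⟩
    | cons L l ih =>
      intro done t r hl h1 h2
      obtain ⟨a, L', hL⟩ := List.exists_cons_of_ne_nil (hl L (by simp))
      rw [List.foldl_cons, List.append_cons]
      by_cases hlt : (medianT I p L).val < t
      · have hs : step (some (t, r)) L = some ((medianT I p L).val, a) := by
          rw [hL] at hlt
          simp only [hstep, hL, if_pos hlt]
        rw [hs]
        refine ih _ _ a (fun L hL => hl L (by simp [hL])) ⟨L, by simp, by rw [hL]; simp, rfl⟩ ?_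
        intro L'' hL''
        rcases List.mem_append.mp hL'' with h | h
        · exact hlt.le.trans (h2 _ h)
        · rw [List.mem_singleton.mp h]
      · have hs : step (some (t, r)) L = some (t, r) := by
          rw [hL] at hlt
          simp only [hstep, hL, if_neg hlt]
        rw [hs]
        obtain ⟨L₀, h3, h4⟩ := h1
        refine ih _ _ _ (fun L hL => hl L (by simp [hL])) ⟨L₀, by simp [h3], h4⟩ ?_
        intro L'' hL''
        rcases List.mem_append.mp hL'' with h | h
        · exact h2 _ h
        · rw [List.mem_singleton.mp h]
          exact not_lt.mp hlt
  obtain ⟨L, l, rfl⟩ := List.exists_cons_of_ne_nil hne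
  obtain ⟨a, L', hL⟩ := List.exists_cons_of_ne_nil (hl L (by simp))
  have hs : step none L = some ((medianT I p L).val, a) := by simp only [hstep, hL]
  rw [List.foldl_cons, hs]
  exact key l [L] _ a (fun L hL => hl L (by simp [hL])) ⟨L, by simp, by rw [hL]; simp, rfl⟩ (by simp)

end Median

/-! ### Collapsing, leaves and rebuilding -/

section Collapse

variable {X : Type u}

theorem collapseAllT_val (ts : List (CTree X)) :
    (collapseAllT ts).val = ts.map (fun t => t.collapseT.val) := by
  induction ts with
  | nil => rw [collapseAllT]; rfl
  | cons t ts ih => rw [collapseAllT, call_val, bind_val, bind_val, op_val, ih, List.map_cons]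

theorem collapseT_leaf_val (c : List X) : (CTree.leaf c).collapseT.val = .leaf c := by
  rw [CTree.collapseT, op_val]

theorem collapseT_node_val (ts : List (CTree X)) : (CTree.node ts).collapseT.val =
    if ts.all CTree.isSingleLeaf then .leaf (pointsAll ts)
    else .node (ts.map fun t => t.collapseT.val) := by
  have hb : (allT (fun t : CTree X => op t.isSingleLeaf) ts).val = ts.all CTree.isSingleLeaf :=
    allT_val _ _
  rw [CTree.collapseT, call_val, bind_val, hb]
  cases ts.all CTree.isSingleLeaf
  · simp [collapseAllT_val]
  · simp [pointsAllT_val]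

theorem leavesAllT_val (ts : List (CTree X)) :
    (leavesAllT ts).val = ts.flatMap (fun t => t.leavesT.val) := by
  induction ts with
  | nil => rw [leavesAllT]; rfl
  | cons t ts ih =>
    rw [leavesAllT, call_val, bind_val, bind_val, appendT_val, ih, List.flatMap_cons]

theorem leavesT_leaf_val (c : List X) : (CTree.leaf c).leavesT.val = [c] := by
  rw [CTree.leavesT, op_val]

theorem leavesT_node_val (ts : List (CTree X)) : (CTree.node ts).leavesT.val =
    ts.flatMap (fun t => t.leavesT.val) := by
  rw [CTree.leavesT, call_val, leavesAllT_val]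

variable [DecidableEq X]

theorem fillLeafT_val (asg : List (X × Option (ℝ × X))) (c : List X) :
    (fillLeafT asg c).val = c ++ (asg.filter (fun a => match a.2 with
      | none => false
      | some b => decide (b.2 ∈ c))).map Prod.fst := by
  simp only [fillLeafT, bind_val, op_val, splitT_val, mapT_val, appendT_val]
  congr 3
  funext a
  rcases a with ⟨x, _ | b⟩
  · rfl
  · exact memT_val _ _

theorem mem_fillLeafT {asg : List (X × Option (ℝ × X))} {c : List X} {x : X} :
    x ∈ (fillLeafT asg c).val ↔ x ∈ c ∨ ∃ b, (x, some b) ∈ asg ∧ b.2 ∈ c := by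
  rw [fillLeafT_val, List.mem_append, List.mem_map]
  refine or_congr Iff.rfl ⟨?_, ?_⟩
  · rintro ⟨⟨y, _ | b⟩, ha, rfl⟩
    · simp at ha
    · rw [List.mem_filter] at ha
      exact ⟨b, ha.1, of_decide_eq_true ha.2⟩
  · rintro ⟨b, hb, hc⟩
    exact ⟨(x, some b), List.mem_filter.mpr ⟨hb, decide_eq_true hc⟩, rfl⟩

theorem rebuildAllT_val (asg : List (X × Option (ℝ × X))) (ts : List (CTree X)) :
    (rebuildAllT asg ts).val =
      (ts.filter (fun t => !t.isSingleLeaf)).map (fun t => (t.rebuildT asg).val) := by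
  induction ts with
  | nil => rw [rebuildAllT]; rfl
  | cons t ts ih =>
    rw [rebuildAllT, call_val, bind_val, op_val]
    cases h : t.isSingleLeaf <;> simp [h, ih]

theorem rebuildT_leaf_val (asg : List (X × Option (ℝ × X))) (c : List X) :
    ((CTree.leaf c).rebuildT asg).val = .leaf (fillLeafT asg c).val := by
  rw [CTree.rebuildT, call_val, bind_val, op_val]

theorem rebuildT_node_val (asg : List (X × Option (ℝ × X))) (ts : List (CTree X)) :
    ((CTree.node ts).rebuildT asg).val =
      .node ((ts.filter (fun t => !t.isSingleLeaf)).map (fun t => (t.rebuildT asg).val)) := by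
  rw [CTree.rebuildT, call_val, bind_val, op_val, rebuildAllT_val]

end Collapse

/-! ### Binary trees -/

section Binary

variable {X : Type u}

/-- The cluster represented by the root of a binary tree. -/
def BTree.points : BTree X → List X
  | .leaf c => c
  | .node l r => l.points ++ r.points

/-- Prunings of binary trees. -/
inductive BPruning : BTree X → List (List X) → Prop
  | whole (t : BTree X) : BPruning t [t.points]
  | split {l r : BTree X} {P Q : List (List X)} :
      BPruning l P → BPruning r Q → BPruning (.node l r) (P ++ Q)

theorem BPruning.flatten_eq {t : BTree X} {P : List (List X)} (h : BPruning t P) :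
    P.flatten = t.points := by
  induction h with
  | whole t => simp
  | split _ _ h1 h2 => rw [List.flatten_append, h1, h2, BTree.points]

theorem BPruning.length_pos {t : BTree X} {P : List (List X)} (h : BPruning t P) :
    0 < P.length := by
  induction h with
  | whole t => simp
  | split _ _ h1 h2 => rw [List.length_append]; lia

theorem binaryT_leaf_val (c : List X) : (CTree.leaf c).binaryT.val = .leaf c := by
  rw [CTree.binaryT, op_val]

theorem binaryT_node_val (ts : List (CTree X)) :
    (CTree.node ts).binaryT.val = (binaryAllT none ts).val := by
  rw [CTree.binaryT, call_val]

theorem binaryAllT_nil_val (acc : Option (BTree X)) :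
    (binaryAllT acc []).val = acc.getD (.leaf []) := by
  rw [binaryAllT, op_val]

theorem binaryAllT_none_val (t : CTree X) (ts : List (CTree X)) :
    (binaryAllT none (t :: ts)).val = (binaryAllT (some t.binaryT.val) ts).val := by
  rw [binaryAllT, call_val, bind_val, bind_val, op_val]

theorem binaryAllT_some_val (a : BTree X) (t : CTree X) (ts : List (CTree X)) :
    (binaryAllT (some a) (t :: ts)).val = (binaryAllT (some (.node a t.binaryT.val)) ts).val := by
  rw [binaryAllT, call_val, bind_val, bind_val, op_val]

mutual
theorem binaryT_points : (t : CTree X) → t.binaryT.val.points = t.points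
  | .leaf c => by rw [binaryT_leaf_val, CTree.points_leaf, BTree.points]
  | .node ts => by
    rw [binaryT_node_val, CTree.points_node]
    cases ts with
    | nil => rw [binaryAllT_nil_val, pointsAll]; rfl
    | cons t ts =>
      rw [binaryAllT_none_val, binaryAllT_points ts t.binaryT.val, binaryT_points t, pointsAll]
theorem binaryAllT_points : (ts : List (CTree X)) → (a : BTree X) →
    (binaryAllT (some a) ts).val.points = a.points ++ pointsAll ts
  | [], a => by rw [binaryAllT_nil_val, pointsAll, List.append_nil]; rfl
  | t :: ts, a => by
    rw [binaryAllT_some_val, binaryAllT_points ts, BTree.points, binaryT_points t, pointsAll,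
      List.append_assoc]
end

/-- Binarization only inserts nodes between a vertex and its children, so prunings of the children
still combine; the accumulator carries the part built so far. -/
theorem BPruning.binaryAllT {ts : List (CTree X)} {Ps : List (List (List X))}
    (h : List.Forall₂ (fun t P => BPruning t.binaryT.val P) ts Ps) (a : BTree X)
    {P : List (List X)} (ha : BPruning a P) :
    BPruning (KMedian.binaryAllT (some a) ts).val (P ++ Ps.flatten) := by
  induction h generalizing a P with
  | nil => rw [binaryAllT_nil_val, List.flatten_nil, List.append_nil]; exact ha
  | cons h1 _ ih =>
    rw [binaryAllT_some_val, List.flatten_cons, ← List.append_assoc]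
    exact ih _ (.split ha h1)

/-- Nonemptiness matters: a node without children becomes the leaf `[]`, whose only pruning has one
empty cluster and not none. -/
theorem BPruning.binaryT_node {ts : List (CTree X)} {Ps : List (List (List X))}
    (h : List.Forall₂ (fun t P => BPruning t.binaryT.val P) ts Ps) (hts : ts ≠ []) :
    BPruning (CTree.node ts).binaryT.val Ps.flatten := by
  cases h with
  | nil => exact absurd rfl hts
  | cons h1 h2 =>
    rw [binaryT_node_val, binaryAllT_none_val, List.flatten_cons]
    exact BPruning.binaryAllT h2 _ h1

end Binary

/-! ### The leaves of the collapsed tree -/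

section Leaves

variable {X : Type u}

/-- The leaves of the collapsed tree. -/
def leafList (t : CTree X) : List (List X) := t.collapseT.val.leavesT.val

/-- The leaves of the collapsed tree with more than one point. -/
def bigLeaves (t : CTree X) : List (List X) := (leafList t).filter fun c => !isSingle c

theorem leafList_leaf (c : List X) : leafList (.leaf c) = [c] := by
  rw [leafList, collapseT_leaf_val, leavesT_leaf_val]

theorem leafList_node (ts : List (CTree X)) : leafList (.node ts) =
    if ts.all CTree.isSingleLeaf then [pointsAll ts] else ts.flatMap leafList := by
  rw [leafList, collapseT_node_val]
  split_ifs
  · rw [leavesT_leaf_val]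
  · rw [leavesT_node_val, List.flatMap_map]
    rfl

theorem leafList_flatten {Q : List (CTree X) → Prop} {t : CTree X} (ht : t.ForallNodes Q) :
    (leafList t).flatten = t.points := by
  induction ht with
  | leaf x => rw [leafList_leaf, CTree.points_leaf]; simp
  | @node ts _ _ ih =>
    rw [leafList_node, CTree.points_node]
    split_ifs
    · simp
    · rw [pointsAll_eq_flatMap]
      clear * - ih
      induction ts with
      | nil => simp
      | cons t ts ih' =>
        rw [List.flatMap_cons, List.flatten_append, List.flatMap_cons,
          ih t (by simp), ih' fun t ht => ih t (by simp [ht])]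

theorem bigLeaves_leaf (x : X) : bigLeaves (.leaf [x]) = [] := by
  simp [bigLeaves, leafList_leaf, isSingle]

theorem subset_of_mem_bigLeaves {Q : List (CTree X) → Prop} {t : CTree X} (ht : t.ForallNodes Q)
    {L : List X} (hL : L ∈ bigLeaves t) : L ⊆ t.points := by
  rw [← leafList_flatten ht]
  exact fun x hx => List.mem_flatten.mpr ⟨L, List.mem_of_mem_filter hL, hx⟩

theorem nodup_of_mem_bigLeaves {Q : List (CTree X) → Prop} {t : CTree X} (ht : t.ForallNodes Q)
    (hnd : t.points.Nodup) {L : List X} (hL : L ∈ bigLeaves t) : L.Nodup := by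
  rw [← leafList_flatten ht, List.nodup_flatten] at hnd
  exact hnd.1 L (List.mem_of_mem_filter hL)

theorem isSingleLeaf_iff {t : CTree X} : t.isSingleLeaf = true ↔ ∃ x, t = .leaf [x] := by
  cases t with
  | leaf c => simp [CTree.isSingleLeaf, isSingle_iff]
  | node ts => simp [CTree.isSingleLeaf]

end Leaves

-- The cleaned tree as a function of the assignment of single points.

section CleanedTree

variable {X : Type u} [DecidableEq X]

/-- The subtree of the cleaned tree that stems from the subtree `t`. -/
def cleaned (asg : List (X × Option (ℝ × X))) (t : CTree X) : CTree X :=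
  (t.collapseT.val.rebuildT asg).val

theorem cleaned_node_of_all (asg : List (X × Option (ℝ × X))) {ts : List (CTree X)}
    (h : ts.all CTree.isSingleLeaf = true) :
    cleaned asg (.node ts) = .leaf (fillLeafT asg (pointsAll ts)).val := by
  rw [cleaned, collapseT_node_val, if_pos h, rebuildT_leaf_val]

/-- The points that are single leaves of the collapsed tree. -/
def singlePoints (T : CTree X) : List X :=
  (((leafList T).filter fun c => isSingle c).reverse).flatten

/-- The assignment of the single points to leaves. -/
noncomputable def assignment (I : Input X) (T : CTree X) : List (X × Option (ℝ × X)) :=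
  (singlePoints T).map fun p => (p, (nearestLeafT I p (bigLeaves T)).val)

theorem cleanT_val (I : Input X) (T : CTree X) :
    (cleanT I T).val = cleaned (assignment I T) T := by
  simp only [cleanT, bind_val, splitT_val, op_val, foldT_val, mapT_val, appendT_val,
    List.foldl_flip_append_eq_append, List.append_nil]
  rw [cleaned, assignment, singlePoints, leafList, List.map_id']
  rfl

end CleanedTree

-- Dense leaves, and a pruning with one cluster per group.

section Clean

variable {X : Type u} [Fintype X] [DecidableEq X] [MetricSpace X] {k : ℕ}
  {f : X → Fin k} {c q : Fin k → X} {bad : Finset X} {m : ℕ} {δ : ℝ}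

/-- The properties of the non-singleton leaves of the collapsed tree. -/
structure IsDense (f : X → Fin k) (bad : Finset X) (m : ℕ) (δ : ℝ) (L : List X) : Prop where
  size : (m : ℝ) - δ ≤ L.length
  eq : ∀ x ∈ L, ∀ y ∈ L, x ∉ bad → y ∉ bad → f x = f y
  margin : ∀ p ∈ L, ∀ y ∈ L, y ∉ bad → ∀ i, i ≠ f y → ∃ E : Finset X, (E.card : ℝ) ≤ δ ∧
      ∀ z ∈ L, ∀ w ∉ bad, f w = i → w ∉ E → dist p z < dist p w

section

variable (hcore : IsCore f c q bad m δ)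
include hcore

theorem IsCore.not_subset_singleton (i : Fin k) (x : X) :
    ¬ ∀ y ∉ bad, f y = i → y ∈ [x] := by
  intro h
  have h1 := hcore.le_length h
  have := hcore.nonneg
  have := hcore.size_le
  rw [List.length_singleton] at h1
  push_cast at h1
  linarith

theorem IsMerge.isSingle_eq_false {ts : List (CTree X)} (h : IsMerge f bad m δ ts) :
    isSingle (pointsAll ts) = false := by
  rw [Bool.eq_false_iff]
  intro hs
  obtain ⟨x, hx⟩ := isSingle_iff.mp hs
  have h1 := h.size
  have := hcore.nonneg
  have := hcore.size_le
  rw [hx, List.length_singleton] at h1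
  push_cast at h1
  linarith

/-- If a merge of single points were mixed, `split` would put a whole group into one of these
points. -/
theorem IsMerge.isDense {ts : List (CTree X)} (h : IsMerge f bad m δ ts)
    (hs : ∀ t ∈ ts, t.isSingleLeaf = true) : IsDense f bad m δ (pointsAll ts) := by
  refine ⟨h.size, ?_, h.margin hs⟩
  intro x hx y hy hxb hyb
  by_contra hxy
  obtain ⟨t, ht, hxt⟩ := mem_pointsAll.mp hx
  have h1 := h.split x hx y hy hxb hyb hxy t ht x hxt hxb
  obtain ⟨a, rfl⟩ := isSingleLeaf_iff.mp (hs t ht)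
  rw [CTree.points_leaf] at h1
  exact hcore.not_subset_singleton _ _ h1

theorem bigLeaves_node {ts : List (CTree X)} (h : IsMerge f bad m δ ts) :
    bigLeaves (.node ts) =
      if ts.all CTree.isSingleLeaf then [pointsAll ts] else ts.flatMap bigLeaves := by
  rw [bigLeaves, leafList_node]
  split_ifs
  · simp [h.isSingle_eq_false hcore]
  · rw [List.filter_flatMap]
    rfl

theorem isDense_of_mem_bigLeaves {t : CTree X} (ht : t.ForallNodes (IsMerge f bad m δ))
    {L : List X} (hL : L ∈ bigLeaves t) : IsDense f bad m δ L := by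
  induction ht with
  | leaf x => rw [bigLeaves_leaf] at hL; cases hL
  | @node ts _ hts ih =>
    rw [bigLeaves_node hcore hts] at hL
    split_ifs at hL with hall
    · rw [List.mem_singleton.mp hL]
      exact hts.isDense hcore (List.all_eq_true.mp hall)
    · obtain ⟨t, ht, hLt⟩ := List.mem_flatMap.mp hL
      exact ih t ht hLt

theorem bigLeaves_ne_nil {t : CTree X} (ht : t.ForallNodes (IsMerge f bad m δ))
    (hs : t.isSingleLeaf = false) : bigLeaves t ≠ [] := by
  induction ht with
  | leaf x => cases hs
  | @node ts _ hts ih =>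
    rw [bigLeaves_node hcore hts]
    split_ifs with hall
    · simp
    · rw [List.all_eq_true] at hall
      push Not at hall
      obtain ⟨t, ht, hts⟩ := hall
      have h1 := ih t ht (Bool.eq_false_iff.mpr hts)
      obtain ⟨L, hL⟩ := List.exists_mem_of_ne_nil _ h1
      exact List.ne_nil_of_mem (List.mem_flatMap.mpr ⟨t, ht, hL⟩)

theorem IsDense.exists_good {L : List X} (h : IsDense f bad m δ L) (hnd : L.Nodup) :
    ∃ x ∈ L, x ∉ bad := by
  refine hcore.exists_good hnd ?_
  have := h.size
  have := hcore.nonneg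
  have := hcore.size_le
  linarith

/-- Descend the tree. At a node with good points of group i only, every large leaf serves, since
each has a good point. At a mixed node the child containing c i holds the whole group. -/
theorem exists_mem_bigLeaves {t : CTree X} (ht : t.ForallNodes (IsMerge f bad m δ))
    (hnd : t.points.Nodup) {i : Fin k} (hi : ∀ y ∉ bad, f y = i → y ∈ t.points) :
    ∃ L ∈ bigLeaves t, ∃ y ∈ L, y ∉ bad ∧ f y = i := by
  induction ht with
  | leaf x => exact absurd hi (hcore.not_subset_singleton i x)
  | @node ts hall hts ih =>
    have hc := hi (c i) (hcore.center_good i) (hcore.center_apply i)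
    by_cases hone : ∀ x ∈ (CTree.node ts).points, x ∉ bad → f x = i
    · obtain ⟨L, hL⟩ := List.exists_mem_of_ne_nil _
        (bigLeaves_ne_nil hcore (.node hall hts) rfl)
      obtain ⟨y, hy, hyb⟩ := (isDense_of_mem_bigLeaves hcore (.node hall hts) hL).exists_good hcore
        (nodup_of_mem_bigLeaves (.node hall hts) hnd hL)
      exact ⟨L, hL, y, hy, hyb, hone y (subset_of_mem_bigLeaves (.node hall hts) hL hy) hyb⟩
    · push Not at hone
      obtain ⟨x, hx, hxb, hxi⟩ := hone
      rw [CTree.points_node] at hc hx hnd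
      obtain ⟨t, ht, hct⟩ := mem_pointsAll.mp hc
      have hfull := hts.split x hx (c i) hc hxb (hcore.center_good i)
        (by rwa [hcore.center_apply]) t ht (c i) hct (hcore.center_good i)
      rw [hcore.center_apply] at hfull
      have hndt : t.points.Nodup := by
        rw [pointsAll_eq_flatMap, List.nodup_flatMap] at hnd
        exact hnd.1 t ht
      obtain ⟨L, hL, h⟩ := ih t ht hndt hfull
      rw [bigLeaves_node hcore hts, if_neg]
      · exact ⟨L, List.mem_flatMap.mpr ⟨t, ht, hL⟩, h⟩
      · intro hall
        obtain ⟨a, rfl⟩ := isSingleLeaf_iff.mp (List.all_eq_true.mp hall t ht)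
        rw [bigLeaves_leaf] at hL
        cases hL

theorem isSingleLeaf_collapseT {t : CTree X} (ht : t.ForallNodes (IsMerge f bad m δ)) :
    t.collapseT.val.isSingleLeaf = t.isSingleLeaf := by
  rcases ht.cases_single with ⟨x, rfl⟩ | ⟨h, ts, rfl, hts, -⟩
  · rw [collapseT_leaf_val]
  · rw [h, collapseT_node_val]
    split_ifs
    · exact hts.isSingle_eq_false hcore
    · rfl

theorem cleaned_node (asg : List (X × Option (ℝ × X))) {ts : List (CTree X)}
    (hts : ∀ t ∈ ts, t.ForallNodes (IsMerge f bad m δ))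
    (h : ¬ ts.all CTree.isSingleLeaf = true) :
    cleaned asg (.node ts) =
      .node ((ts.filter fun t => !t.isSingleLeaf).map (cleaned asg)) := by
  rw [cleaned, collapseT_node_val, if_neg h, rebuildT_node_val, List.filter_map, List.map_map]
  congr 2
  refine List.filter_congr fun t ht => ?_
  rw [Function.comp_apply, isSingleLeaf_collapseT hcore (hts t ht)]

theorem cleaned_points (asg : List (X × Option (ℝ × X))) {t : CTree X}
    (ht : t.ForallNodes (IsMerge f bad m δ)) (hs : t.isSingleLeaf = false) :
    (cleaned asg t).points = (bigLeaves t).flatMap fun L => (fillLeafT asg L).val := by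
  induction ht with
  | leaf x => cases hs
  | @node ts hall hts ih =>
    rw [bigLeaves_node hcore hts]
    by_cases h : ts.all CTree.isSingleLeaf = true
    · rw [if_pos h, cleaned_node_of_all asg h, CTree.points_leaf]
      simp
    · rw [if_neg h, cleaned_node hcore asg hall h, CTree.points_node, pointsAll_eq_flatMap]
      clear h hts hs
      induction ts with
      | nil => rfl
      | cons t ts ih' =>
        have h1 := ih' (fun t ht => hall t (by simp [ht])) (fun t ht => ih t (by simp [ht]))
        rw [List.flatMap_cons, List.flatMap_append, ← h1, List.filter_cons]
        cases hst : t.isSingleLeaf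
        · simp [ih t (by simp) hst]
        · obtain ⟨x, rfl⟩ := isSingleLeaf_iff.mp hst
          simp [bigLeaves_leaf]

/-- The cleaned tree has a pruning with one cluster for each group of good points. -/
theorem exists_pruning (asg : List (X × Option (ℝ × X))) {t : CTree X}
    (ht : t.ForallNodes (IsMerge f bad m δ)) (hs : t.isSingleLeaf = false)
    (hnd : t.points.Nodup)
    (hfull : ∀ x ∈ t.points, x ∉ bad → ∀ y ∉ bad, f y = f x → y ∈ t.points) :
    ∃ Ps : List (Fin k × List (List X)),
      IsPruning (cleaned asg t)
        (Ps.map fun a => a.2.flatMap fun L => (fillLeafT asg L).val) ∧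
      BPruning (cleaned asg t).binaryT.val
        (Ps.map fun a => a.2.flatMap fun L => (fillLeafT asg L).val) ∧
      (Ps.map Prod.snd).flatten = bigLeaves t ∧
      (∀ a ∈ Ps, ∀ L ∈ a.2, ∀ y ∈ L, y ∉ bad → f y = a.1) ∧
      (Ps.map Prod.fst).Nodup ∧
      ∀ i, i ∈ Ps.map Prod.fst ↔ ∃ y ∈ t.points, y ∉ bad ∧ f y = i := by
  induction ht with
  | leaf x => cases hs
  | @node ts hall hts ih =>
    have hT : (CTree.node ts).ForallNodes (IsMerge f bad m δ) := .node hall hts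
    -- The pruning cuts at the highest nodes whose good points belong to one group and splits the
    -- mixed nodes above them.
    by_cases hone : ∀ x ∈ (CTree.node ts).points, ∀ y ∈ (CTree.node ts).points,
        x ∉ bad → y ∉ bad → f x = f y
    · obtain ⟨L, hL⟩ := List.exists_mem_of_ne_nil _ (bigLeaves_ne_nil hcore hT rfl)
      obtain ⟨x, hx, hxb⟩ := (isDense_of_mem_bigLeaves hcore hT hL).exists_good hcore
        (nodup_of_mem_bigLeaves hT hnd hL)
      replace hx := subset_of_mem_bigLeaves hT hL hx
      refine ⟨[(f x, bigLeaves (.node ts))], ?_, ?_, ?_, ?_, ?_, ?_⟩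
      · rw [List.map_singleton, ← cleaned_points hcore asg hT rfl]
        exact .whole _
      · rw [List.map_singleton, ← cleaned_points hcore asg hT rfl, ← binaryT_points]
        exact .whole _
      · simp
      · intro a ha L hL y hy hyb
        rw [List.mem_singleton.mp ha] at hL ⊢
        exact hone y (subset_of_mem_bigLeaves hT hL hy) x hx hyb hxb
      · simp
      · intro i
        rw [List.map_singleton, List.mem_singleton]
        constructor
        · rintro rfl; exact ⟨x, hx, hxb, rfl⟩
        · rintro ⟨y, hy, hyb, rfl⟩; exact hone y hy x hx hyb hxb
    · push Not at hone
      obtain ⟨x, hx, y, hy, hxb, hyb, hxy⟩ := hone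
      rw [CTree.points_node] at hx hy hnd
      have hsplit := hts.split x hx y hy hxb hyb hxy
      have hns : ¬ ts.all CTree.isSingleLeaf = true := fun h =>
        hxy ((hts.isDense hcore (List.all_eq_true.mp h)).eq x hx y hy hxb hyb)
      -- Induction over the children. `Bs` keeps the prunings of the children apart, as the binary
      -- tree needs them, while `Ps` lists all parts with their groups.
      have key : ∀ l : List (CTree X), (∀ t ∈ l, t ∈ ts) → (pointsAll l).Nodup →
          ∃ Ps : List (Fin k × List (List X)), ∃ Bs : List (List (List X)),
            IsPruningAll ((l.filter fun t => !t.isSingleLeaf).map (cleaned asg))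
              (Ps.map fun a => a.2.flatMap fun L => (fillLeafT asg L).val) ∧
            List.Forall₂ (fun t P => BPruning t.binaryT.val P)
              ((l.filter fun t => !t.isSingleLeaf).map (cleaned asg)) Bs ∧
            Bs.flatten = (Ps.map fun a => a.2.flatMap fun L => (fillLeafT asg L).val) ∧
            (Ps.map Prod.snd).flatten = l.flatMap bigLeaves ∧
            (∀ a ∈ Ps, ∀ L ∈ a.2, ∀ y ∈ L, y ∉ bad → f y = a.1) ∧
            (Ps.map Prod.fst).Nodup ∧
            ∀ i, i ∈ Ps.map Prod.fst ↔ ∃ y ∈ pointsAll l, y ∉ bad ∧ f y = i := by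
        intro l
        induction l with
        | nil => exact fun _ _ => ⟨[], [], .nil, .nil, rfl, rfl, by simp, by simp,
            by simp [pointsAll]⟩
        | cons t l ihl =>
          intro hsub hnd'
          rw [pointsAll, List.nodup_append'] at hnd'
          obtain ⟨Ps, Bs, h1, h2, h3, h4, h5, h6, h7⟩ :=
            ihl (fun t ht => hsub t (by simp [ht])) hnd'.2.1
          have htts := hsub t (by simp)
          cases hst : t.isSingleLeaf
          · obtain ⟨Ps', g1, g2, g4, g5, g6, g7⟩ := ih t htts hst hnd'.1 (hsplit t htts)
            refine ⟨Ps' ++ Ps, (Ps'.map fun a => a.2.flatMap fun L => (fillLeafT asg L).val) :: Bs,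
              ?_, ?_, ?_, ?_, ?_, ?_, ?_⟩
            · simp only [List.filter_cons, hst, Bool.not_false, if_true, List.map_cons,
                List.map_append]
              exact .cons g1 h1
            · simp only [List.filter_cons, hst, Bool.not_false, if_true, List.map_cons]
              exact .cons g2 h2
            · rw [List.flatten_cons, h3, List.map_append]
            · rw [List.map_append, List.flatten_append, g4, h4, List.flatMap_cons]
            · intro a ha
              rcases List.mem_append.mp ha with h | h
              · exact g5 a h
              · exact h5 a h
            · rw [List.map_append, List.nodup_append']
              refine ⟨g6, h6, fun i hi hi' => ?_⟩
              obtain ⟨y, hy, hyb, hyi⟩ := (g7 i).mp hi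
              obtain ⟨z, hz, hzb, hzi⟩ := (h7 i).mp hi'
              -- A group occurring in two children would, by fullness of the first, give a point
              -- common to both.
              exact hnd'.2.2 (hsplit t htts y hy hyb z hzb (by rw [hyi, hzi])) hz
            · intro i
              rw [List.map_append, List.mem_append, g7, h7, pointsAll]
              simp only [List.mem_append, or_and_right, exists_or]
          · obtain ⟨a, rfl⟩ := isSingleLeaf_iff.mp hst
            refine ⟨Ps, Bs, ?_, ?_, h3, ?_, h5, h6, ?_⟩
            · simpa [List.filter_cons, hst] using h1
            · simpa [List.filter_cons, hst] using h2
            · rw [List.flatMap_cons, bigLeaves_leaf, List.nil_append, h4]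
            · intro i
              rw [h7, pointsAll]
              refine exists_congr fun y => and_congr_left fun hyb => ?_
              rw [List.mem_append]
              refine ⟨Or.inr, fun h => h.resolve_left fun hya => ?_⟩
              -- Below a mixed node a single point cannot be good, as it would be a whole group. So
              -- dropping single children loses no group.
              have := hsplit _ htts y hya hyb.1
              rw [CTree.points_leaf] at this
              exact hcore.not_subset_singleton _ _ this
      obtain ⟨Ps, Bs, h1, h2, h3, h4, h5, h6, h7⟩ := key ts (fun _ h => h) hnd
      refine ⟨Ps, ?_, ?_, ?_, h5, h6, h7⟩
      · rw [cleaned_node hcore asg hall hns]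
        exact .split h1
      · rw [cleaned_node hcore asg hall hns, ← h3]
        refine BPruning.binaryT_node h2 fun hnil => hns ?_
        rw [List.map_eq_nil_iff, List.filter_eq_nil_iff] at hnil
        rw [List.all_eq_true]
        intro t ht
        simpa using hnil t ht
      · rw [bigLeaves_node hcore hts, if_neg hns, h4]

end

-- The assignment of single points to large leaves.

section

variable {I : Input X} (hcore : IsCore f c q bad I.m δ) {T : CTree X}
  (hT : T.ForallNodes (IsMerge f bad I.m δ)) (hs : T.isSingleLeaf = false)
  (hnd : T.points.Nodup)
include hcore hT

omit hcore in
theorem leafList_perm : ((bigLeaves T).flatten ++ singlePoints T).Perm T.points := by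
  rw [← leafList_flatten hT, singlePoints, bigLeaves]
  have h1 := (List.filter_append_perm (fun c => isSingle c) (leafList T)).flatten
  rw [List.flatten_append] at h1
  exact (List.perm_append_comm.trans ((List.reverse_perm _).flatten.append_right _)).trans h1

omit hcore in
include hnd in
theorem disjoint_singlePoints {L : List X} (hL : L ∈ bigLeaves T) {x : X} (hx : x ∈ L) :
    x ∉ singlePoints T := by
  have h1 := (leafList_perm hT).nodup_iff.mpr hnd
  rw [List.nodup_append'] at h1
  exact fun h => h1.2.2 (List.mem_flatten.mpr ⟨L, hL, hx⟩) h

omit hcore hT in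
theorem mem_assignment {x : X} {b : Option (ℝ × X)} :
    (x, b) ∈ assignment I T ↔ x ∈ singlePoints T ∧ b = (nearestLeafT I x (bigLeaves T)).val := by
  rw [assignment, List.mem_map]
  constructor
  · rintro ⟨y, hy, he⟩
    obtain ⟨rfl, rfl⟩ := Prod.mk.inj he
    exact ⟨hy, rfl⟩
  · rintro ⟨hx, rfl⟩
    exact ⟨x, hx, rfl⟩

include hs in
theorem nearest_bigLeaf (x : X) : ∃ t r, (nearestLeafT I x (bigLeaves T)).val = some (t, r) ∧
      (∃ L ∈ bigLeaves T, r ∈ L ∧ (medianT I x L).val = t) ∧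
      ∀ L ∈ bigLeaves T, t ≤ (medianT I x L).val := by
  refine nearestLeafT_val I x _ (bigLeaves_ne_nil hcore hT hs) fun L hL hnil => ?_
  have h1 := (isDense_of_mem_bigLeaves hcore hT hL).size
  have := hcore.nonneg
  have := hcore.size_le
  rw [hnil, List.length_nil] at h1
  push_cast at h1
  linarith

include hnd in
theorem pairwise_disjoint_bigLeaves : (bigLeaves T).Pairwise List.Disjoint := by
  have h1 := (leafList_perm hT).nodup_iff.mpr hnd
  rw [List.nodup_append', List.nodup_flatten] at h1
  exact h1.1.2

include hs hnd in
-- An assignment names only one point of the chosen leaf; as the leaves are disjoint, this point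
-- determines the leaf.
theorem median_le_of_mem_fill {L : List X} (hL : L ∈ bigLeaves T) {x : X}
    (hx : x ∈ (fillLeafT (assignment I T) L).val) :
    x ∈ L ∨ ∀ L' ∈ bigLeaves T, (medianT I x L).val ≤ (medianT I x L').val := by
  refine (mem_fillLeafT.mp hx).imp_right ?_
  rintro ⟨b, hb, hbL⟩
  obtain ⟨t, r, h1, ⟨L₁, hL₁, hr, rfl⟩, h3⟩ := nearest_bigLeaf hcore hT hs x
  obtain ⟨-, hb'⟩ := mem_assignment.mp hb
  rw [h1] at hb'
  obtain rfl := Option.some.inj hb'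
  have : L = L₁ := by
    by_contra hne
    have : Std.Symm (List.Disjoint (α := X)) := ⟨fun a b h => List.Disjoint.symm h⟩
    exact (pairwise_disjoint_bigLeaves hcore hT hnd).forall hL hL₁ hne hbL hr
  rw [this]
  exact h3

include hs hnd in
theorem fill_perm : ((bigLeaves T).flatMap fun L => (fillLeafT (assignment I T) L).val).Perm
    T.points := by
  have hperm := leafList_perm hT
  have h1 := hperm.nodup_iff.mpr hnd
  rw [List.nodup_append'] at h1
  refine (List.perm_ext_iff_of_nodup ?_ hnd).mpr fun x => ?_
  · rw [List.nodup_flatMap]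
    constructor
    · intro L hL
      rw [fillLeafT_val, List.nodup_append']
      refine ⟨nodup_of_mem_bigLeaves hT hnd hL, ?_, ?_⟩
      · refine List.Nodup.sublist (List.Sublist.map _ List.filter_sublist) ?_
        rw [assignment, List.map_map]
        exact (List.map_id' (singlePoints T)).symm ▸ h1.2.1
      · intro x hxL hx
        obtain ⟨⟨y, b⟩, hyb, rfl⟩ := List.mem_map.mp hx
        exact disjoint_singlePoints hT hnd hL hxL
          (mem_assignment.mp (List.mem_of_mem_filter hyb)).1
    · refine (pairwise_disjoint_bigLeaves hcore hT hnd).imp_of_mem ?_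
      intro L L' hL hL' hdis x hx hx'
      rcases mem_fillLeafT.mp hx with h | ⟨b, hb, hbL⟩ <;>
        rcases mem_fillLeafT.mp hx' with h' | ⟨b', hb', hbL'⟩
      · exact hdis h h'
      · exact disjoint_singlePoints hT hnd hL h (mem_assignment.mp hb').1
      · exact disjoint_singlePoints hT hnd hL' h' (mem_assignment.mp hb).1
      · have h2 := (mem_assignment.mp hb).2.trans (mem_assignment.mp hb').2.symm
        rw [Option.some.inj h2] at hbL
        exact hdis hbL hbL'
  · rw [← hperm.mem_iff, List.mem_flatMap, List.mem_append, List.mem_flatten]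
    constructor
    · rintro ⟨L, hL, hx⟩
      rcases mem_fillLeafT.mp hx with h | ⟨b, hb, -⟩
      · exact Or.inl ⟨L, hL, h⟩
      · exact Or.inr (mem_assignment.mp hb).1
    · rintro (⟨L, hL, hx⟩ | hx)
      · exact ⟨L, hL, mem_fillLeafT.mpr (Or.inl hx)⟩
      · obtain ⟨t, r, h2, ⟨L, hL, hr, -⟩, -⟩ := nearest_bigLeaf hcore hT hs x
        exact ⟨L, hL, mem_fillLeafT.mpr (Or.inr ⟨(t, r), mem_assignment.mpr ⟨hx, h2.symm⟩, hr⟩)⟩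

end

end Clean

-- Group labels after cleaning, and the cost of wrong labels.

section Labels

variable {X : Type u} [Fintype X] [DecidableEq X] [MetricSpace X] {k : ℕ}
  {f : X → Fin k} {c q : Fin k → X} {bad : Finset X} {δ : ℝ} {I : Input X}

theorem sub_card_le_card_sdiff {bad S : Finset X} {a : ℝ} (hS : a ≤ S.card)
    (hb : (bad.card : ℝ) ≤ δ) : a - δ ≤ ((S \ bad).card : ℝ) := by
  have h1 := Finset.le_card_sdiff bad S
  have h2 : (S.card : ℝ) ≤ (S \ bad).card + bad.card := by
    exact_mod_cast (by lia : S.card ≤ (S \ bad).card + bad.card)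
  linarith

/-- Averaging: take the points w of Q and w' of Q' closest to their centers. Each set costs at least
s times its minimum, the sets are disjoint, and D is at most the sum of the two minima. -/
theorem mul_le_sum_of_le_dist {i j : Fin k} (hij : i ≠ j) {Q Q' : Finset X}
    (hQ : ∀ w ∈ Q, f w = j) (hQ' : ∀ w ∈ Q', f w = i) {s D : ℝ} (hs : 0 ≤ s)
    (hsQ : s ≤ Q.card) (hsQ' : s ≤ Q'.card)
    (hD : ∀ w ∈ Q, ∀ w' ∈ Q', D ≤ dist w (c j) + dist w' (c i)) :
    s * D ≤ ∑ x, dist x (c (f x)) := by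
  have hnn : ∀ S : Finset X, 0 ≤ ∑ x ∈ S, dist x (c (f x)) :=
    fun S => Finset.sum_nonneg fun _ _ => dist_nonneg
  rcases hs.eq_or_lt with rfl | hs
  · rw [zero_mul]; exact hnn _
  have hmin : ∀ (S : Finset X) (l : Fin k), (∀ w ∈ S, f w = l) → s ≤ S.card →
      ∃ w ∈ S, s * dist w (c l) ≤ ∑ x ∈ S, dist x (c (f x)) := by
    intro S l hS hsS
    have hne : S.Nonempty := by
      rw [← Finset.card_pos]
      exact_mod_cast hs.trans_le hsS
    obtain ⟨w, hw, hmin⟩ := S.exists_min_image (fun x => dist x (c l)) hne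
    refine ⟨w, hw, ?_⟩
    have h1 := Finset.card_nsmul_le_sum S (fun x => dist x (c (f x))) (dist w (c l))
      fun x hx => by rw [hS x hx]; exact hmin x hx
    rw [nsmul_eq_mul] at h1
    exact (mul_le_mul_of_nonneg_right hsS dist_nonneg).trans h1
  obtain ⟨w, hw, h1⟩ := hmin Q j hQ hsQ
  obtain ⟨w', hw', h2⟩ := hmin Q' i hQ' hsQ'
  have hdis : Disjoint Q Q' := by
    rw [Finset.disjoint_left]
    intro x hx hx'
    exact hij ((hQ' x hx').symm.trans (hQ x hx))
  calc s * D ≤ s * (dist w (c j) + dist w' (c i)) :=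
        mul_le_mul_of_nonneg_left (hD w hw w' hw') hs.le
    _ ≤ ∑ x ∈ Q ∪ Q', dist x (c (f x)) := by
        rw [Finset.sum_union hdis]; linarith
    _ ≤ ∑ x, dist x (c (f x)) :=
        Finset.sum_le_sum_of_subset_of_nonneg (Finset.subset_univ _) fun _ _ _ => dist_nonneg

variable (hcore : IsCore f c q bad I.m δ) (hd : I.d = dist) {T : CTree X}
  (hT : T.ForallNodes (IsMerge f bad I.m δ)) (hs : T.isSingleLeaf = false)
  (hnd : T.points.Nodup) (hall : ∀ x, x ∈ T.points)
include hcore hT hs hnd hall hd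

/-- Every good point ends up in a leaf of its own group. -/
theorem eq_of_mem_fill {L : List X} (hL : L ∈ bigLeaves T) {x y : X} (hxb : x ∉ bad)
    (hx : x ∈ (fillLeafT (assignment I T) L).val) (hy : y ∈ L) (hyb : y ∉ bad) : f y = f x := by
  have hLd := isDense_of_mem_bigLeaves hcore hT hL
  have hδ := hcore.nonneg
  have hm := hcore.size_le
  rcases median_le_of_mem_fill hcore hT hs hnd hL hx with h | h
  · exact hLd.eq y hy x h hyb hxb
  by_contra hne
  obtain ⟨L', hL', z, hz, hzb, hzx⟩ := exists_mem_bigLeaves hcore hT hnd (i := f x)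
    fun y _ _ => hall y
  have hLd' := isDense_of_mem_bigLeaves hcore hT hL'
  have hn := nodup_of_mem_bigLeaves hT hnd hL
  have hn' := nodup_of_mem_bigLeaves hT hnd hL'
  have h1 := (Nat.cast_le (α := ℝ)).mpr (length_le_two_mul_filter_le_median I x L)
  rw [Nat.cast_mul, Nat.cast_two] at h1
  have h1' := (Nat.cast_le (α := ℝ)).mpr (length_le_two_mul_filter_median_le I x L')
  rw [Nat.cast_mul, Nat.cast_two] at h1'
  -- Half of a dense leaf is at least (m - δ)/2 > δ points, so some good w in L is within the median
  -- and some good w' in L' is beyond its median. Then d(x,w) ≤ d(x,w') contradicts the separation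
  -- of the groups.
  obtain ⟨w, hw, hwb⟩ := hcore.exists_good (hn.filter _) (by linarith [hLd.size] : δ <
    (L.filter fun z => decide (I.d x z ≤ (medianT I x L).val)).length)
  obtain ⟨w', hw', hwb'⟩ := hcore.exists_good (hn'.filter _) (by linarith [hLd'.size] : δ <
    (L'.filter fun z => decide ((medianT I x L').val ≤ I.d x z)).length)
  simp only [List.mem_filter, decide_eq_true_eq, hd] at hw hw'
  have h2 := hcore.dist_lt_dist hxb hwb' hwb ((hLd'.eq w' hw'.1 z hz hwb' hzb).trans hzx).symm
    (by rw [hLd.eq w hw.1 y hy hwb hyb]; exact Ne.symm hne)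
  have h3 := h L' hL'
  linarith [hw.2, hw'.2]

/-- The cost of a point that ends up in a leaf of a wrong group. -/
theorem mul_dist_sub_le {L : List X} (hL : L ∈ bigLeaves T) {x y : X}
    (hx : x ∈ (fillLeafT (assignment I T) L).val) (hy : y ∈ L) (hyb : y ∉ bad) (hne : f y ≠ f x) :
    ((I.m : ℝ) - 15) * (dist x (c (f y)) - dist x (c (f x))) ≤
      5 * ∑ x, dist x (c (f x)) := by
  have hLd := isDense_of_mem_bigLeaves hcore hT hL
  have hδ := hcore.nonneg
  have hm := hcore.size_le
  have hn := nodup_of_mem_bigLeaves hT hnd hL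
  set Δ := dist x (c (f y)) - dist x (c (f x)) with hΔ
  have hOPT : 0 ≤ ∑ x, dist x (c (f x)) := Finset.sum_nonneg fun _ _ => dist_nonneg
  -- If x was in L from the start, the margin compares all good points of L with its own group
  -- outside E, at least m - 2δ and m - 3δ points. Otherwise the medians compare the good points in
  -- half of L with those in half of L', at least (m - δ)/2 - δ each. In both cases d(x,w) ≤
  -- d(x,w'), and the triangle inequality gives Δ ≤ d(w, c (f y)) + d(w', c (f x)).
  have key : ((I.m : ℝ) - 3 * δ) / 2 * Δ ≤ ∑ x, dist x (c (f x)) := by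
    rcases median_le_of_mem_fill hcore hT hs hnd hL hx with h | h
    · obtain ⟨E, hE, hmar⟩ := hLd.margin x h y hy hyb (f x) (Ne.symm hne)
      have h1 : (I.m : ℝ) - δ - δ ≤ ((L.toFinset \ bad).card : ℝ) :=
        sub_card_le_card_sdiff (by rw [List.toFinset_card_of_nodup hn]; exact hLd.size)
          hcore.card_bad
      have h2 : (I.m : ℝ) - δ - δ ≤ (((cluster f (f x) \ bad) \ E).card : ℝ) :=
        sub_card_le_card_sdiff (hcore.le_card_sdiff _) hE
      refine mul_le_sum_of_le_dist (Ne.symm hne) (Q := L.toFinset \ bad)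
        (Q' := (cluster f (f x) \ bad) \ E) ?_ ?_ (by linarith) (by linarith) (by linarith) ?_
      · intro w hw
        rw [Finset.mem_sdiff, List.mem_toFinset] at hw
        exact hLd.eq w hw.1 y hy hw.2 hyb
      · intro w hw
        rw [Finset.mem_sdiff, Finset.mem_sdiff, mem_cluster] at hw
        exact hw.1.1
      · intro w hw w' hw'
        rw [Finset.mem_sdiff, List.mem_toFinset] at hw
        rw [Finset.mem_sdiff, Finset.mem_sdiff, mem_cluster] at hw'
        have h3 := hmar w hw.1 w' hw'.1.2 hw'.1.1 hw'.2
        have h4 := dist_triangle x w (c (f y))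
        have h5 := dist_triangle_right x w' (c (f x))
        linarith
    · obtain ⟨L', hL', z, hz, hzb, hzx⟩ := exists_mem_bigLeaves hcore hT hnd (i := f x)
        fun y _ _ => hall y
      have hLd' := isDense_of_mem_bigLeaves hcore hT hL'
      have hn' := nodup_of_mem_bigLeaves hT hnd hL'
      have h1 := (Nat.cast_le (α := ℝ)).mpr (length_le_two_mul_filter_le_median I x L)
      rw [Nat.cast_mul, Nat.cast_two] at h1
      have h1' := (Nat.cast_le (α := ℝ)).mpr (length_le_two_mul_filter_median_le I x L')
      rw [Nat.cast_mul, Nat.cast_two] at h1'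
      set M := L.filter fun z => decide (I.d x z ≤ (medianT I x L).val) with hM
      set M' := L'.filter fun z => decide ((medianT I x L').val ≤ I.d x z) with hM'
      have h2 : ((I.m : ℝ) - δ) / 2 - δ ≤ ((M.toFinset \ bad).card : ℝ) :=
        sub_card_le_card_sdiff (by
          rw [List.toFinset_card_of_nodup (hn.filter _)]; linarith [hLd.size]) hcore.card_bad
      have h2' : ((I.m : ℝ) - δ) / 2 - δ ≤ ((M'.toFinset \ bad).card : ℝ) :=
        sub_card_le_card_sdiff (by
          rw [List.toFinset_card_of_nodup (hn'.filter _)]; linarith [hLd'.size]) hcore.card_bad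
      have hmemM : ∀ w ∈ M.toFinset \ bad, w ∈ L ∧ w ∉ bad ∧ dist x w ≤ (medianT I x L).val := by
        intro w hw
        rw [Finset.mem_sdiff, List.mem_toFinset, hM, List.mem_filter, hd] at hw
        exact ⟨hw.1.1, hw.2, of_decide_eq_true hw.1.2⟩
      have hmemM' : ∀ w ∈ M'.toFinset \ bad,
          w ∈ L' ∧ w ∉ bad ∧ (medianT I x L').val ≤ dist x w := by
        intro w hw
        rw [Finset.mem_sdiff, List.mem_toFinset, hM', List.mem_filter, hd] at hw
        exact ⟨hw.1.1, hw.2, of_decide_eq_true hw.1.2⟩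
      refine mul_le_sum_of_le_dist (Ne.symm hne) (Q := M.toFinset \ bad)
        (Q' := M'.toFinset \ bad) ?_ ?_ (by linarith) (by linarith) (by linarith) ?_
      · intro w hw
        obtain ⟨h1, h2, -⟩ := hmemM w hw
        exact hLd.eq w h1 y hy h2 hyb
      · intro w hw
        obtain ⟨h1, h2, -⟩ := hmemM' w hw
        exact (hLd'.eq w h1 z hz h2 hzb).trans hzx
      · intro w hw w' hw'
        have h3 := (hmemM w hw).2.2
        have h3' := (hmemM' w' hw').2.2
        have h4 := dist_triangle x w (c (f y))
        have h5 := dist_triangle_right x w' (c (f x))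
        have h6 := h L' hL'
        linarith
  -- Since m ≥ 5δ + 15, the factor (m - 15)/5 is nonnegative and at most (m - 3δ)/2.
  rcases le_total Δ 0 with h | h
  · nlinarith
  · nlinarith

end Labels

/-! ### Dynamic programming -/

section DynamicProgramming

variable {X : Type u} (I : Input X)

/-- The cost of a list of clusters with centers. -/
noncomputable def listCost (C : List (List X × X)) : ℝ :=
  (C.map fun a => (a.1.map fun x => I.d x a.2).sum).sum

/-- `s` is at least as cheap as `t`. -/
def SolLE (s t : Sol X) : Prop := ∀ v, t = some v → ∃ w, s = some w ∧ w.1 ≤ v.1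

variable {I}

theorem SolLE.refl (s : Sol X) : SolLE s s := fun v h => ⟨v, h, le_rfl⟩

theorem SolLE.trans {r s t : Sol X} (h1 : SolLE r s) (h2 : SolLE s t) : SolLE r t := by
  intro v hv
  obtain ⟨w, hw, hle⟩ := h2 v hv
  obtain ⟨z, hz, hle'⟩ := h1 w hw
  exact ⟨z, hz, hle'.trans hle⟩

theorem betterT_spec (s t : Sol X) :
    SolLE (betterT s t).val s ∧ SolLE (betterT s t).val t ∧
      ((betterT s t).val = s ∨ (betterT s t).val = t) := by
  rcases s with _ | a
  · exact ⟨fun v h => (by cases h), SolLE.refl _, Or.inr rfl⟩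
  rcases t with _ | b
  · exact ⟨SolLE.refl _, fun v h => (by cases h), Or.inl rfl⟩
  simp only [betterT, op_val]
  split_ifs with h
  · exact ⟨SolLE.refl _, fun v hv => ⟨a, rfl, (Option.some.inj hv) ▸ h⟩, Or.inl rfl⟩
  · exact ⟨fun v hv => ⟨b, rfl, (Option.some.inj hv) ▸ (not_le.mp h).le⟩, SolLE.refl _, Or.inr rfl⟩

theorem foldl_betterT_spec {A : Type v} (F : A → Sol X) (l : List A) (s : Sol X) :
    SolLE (l.foldl (fun b a => (betterT b (F a)).val) s) s ∧
      (∀ a ∈ l, SolLE (l.foldl (fun b a => (betterT b (F a)).val) s) (F a)) ∧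
      ((l.foldl (fun b a => (betterT b (F a)).val) s) = s ∨
        ∃ a ∈ l, (l.foldl (fun b a => (betterT b (F a)).val) s) = F a) := by
  induction l generalizing s with
  | nil => exact ⟨SolLE.refl _, by simp, Or.inl rfl⟩
  | cons a l ih =>
    obtain ⟨h1, h2, h3⟩ := ih (betterT s (F a)).val
    obtain ⟨g1, g2, g3⟩ := betterT_spec s (F a)
    rw [List.foldl_cons]
    refine ⟨h1.trans g1, ?_, ?_⟩
    · intro b hb
      rcases List.mem_cons.mp hb with rfl | hb
      · exact h1.trans g2
      · exact h2 b hb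
    · rcases h3 with h3 | ⟨b, hb, h3⟩
      · rcases g3 with g3 | g3
        · exact Or.inl (h3.trans g3)
        · exact Or.inr ⟨a, by simp, h3.trans g3⟩
      · exact Or.inr ⟨b, by simp [hb], h3⟩

/-- The solution `s` is a cheapest pruning of `B` into `j` clusters. -/
structure IsBest (I : Input X) (B : BTree X) (j : ℕ) (s : Sol X) : Prop where
  sound : ∀ v, s = some v → BPruning B (v.2.map Prod.fst) ∧ v.2.length = j ∧ v.1 = listCost I v.2
  best : ∀ C : List (List X × X), BPruning B (C.map Prod.fst) → C.length = j →
    ∃ v, s = some v ∧ v.1 ≤ listCost I C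

theorem listCost_append (C D : List (List X × X)) :
    listCost I (C ++ D) = listCost I C + listCost I D := by
  simp [listCost]

theorem sum_foldT (c : List X) (s : X) :
    (foldT (fun t x => (op (I.d x s)).bind fun a => op (t + a)) 0 c).val =
      (c.map fun x => I.d x s).sum := by
  rw [foldT_val]
  simp only [bind_val, op_val]
  have : ∀ t : ℝ, c.foldl (fun t x => t + I.d x s) t = t + (c.map fun x => I.d x s).sum := by
    induction c with
    | nil => simp
    | cons x c ih => intro t; rw [List.foldl_cons, ih, List.map_cons, List.sum_cons, add_assoc]
  rw [this, zero_add]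

theorem oneClusterT_val (c : List X) : (oneClusterT I c).val =
    I.pts.foldl (fun b s => (betterT b
      (some ((c.map fun x => I.d x s).sum, [(c, s)]))).val) none := by
  rw [oneClusterT, foldT_val]
  simp only [bind_val, op_val, sum_foldT]

theorem oneClusterT_isBest (hall : ∀ x, x ∈ I.pts) (B : BTree X) :
    IsBest I B 1 (oneClusterT I B.points).val := by
  rw [oneClusterT_val]
  obtain ⟨-, h2, h3⟩ := foldl_betterT_spec
    (fun s => (some ((B.points.map fun x => I.d x s).sum, [(B.points, s)]) : Sol X)) I.pts none
  constructor
  · intro v hv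
    rcases h3 with h3 | ⟨s, -, h3⟩
    · rw [h3] at hv; cases hv
    · rw [h3] at hv
      obtain rfl := Option.some.inj hv
      exact ⟨.whole _, rfl, by simp [listCost]⟩
  · intro C hC hlen
    obtain ⟨⟨c, s⟩, rfl⟩ := List.length_eq_one_iff.mp hlen
    -- A pruning with one cluster has to be the whole tree, because prunings preserve the
    -- concatenated list of points.
    have hc : c = B.points := by
      have := hC.flatten_eq
      simpa using this
    subst hc
    obtain ⟨w, hw, hle⟩ := h2 s (hall s) _ rfl
    exact ⟨w, hw, hle.trans_eq (by simp [listCost])⟩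

/-- The list `tab` has the cheapest prunings of `B` into `1, …, k` clusters. -/
def IsTable (I : Input X) (B : BTree X) (tab : List (Sol X)) : Prop :=
  ∀ j < I.k, ∃ s, tab[j]? = some s ∧ IsBest I B (j + 1) s

theorem combineT_val (L R : List (Sol X)) (m : ℕ) : (combineT L R m).val =
    (List.range' 1 (m - 1)).foldl (fun b m₁ => (betterT b
      (unionT ((L[m₁ - 1]?).getD none) ((R[m - m₁ - 1]?).getD none)).val).val) none := by
  rw [combineT]
  simp only [bind_val, foldT_val, rangeT_val, nthT_val]

/-- A pruning into more than one cluster splits at the root into two nonempty prunings, so their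
sizes m₁ and m - m₁ are covered by the loop, and cost is additive. -/
theorem combineT_isBest {l r : BTree X} {L R : List (Sol X)} (hL : IsTable I l L)
    (hR : IsTable I r R) {m : ℕ} (hm : 1 < m) (hmk : m ≤ I.k) :
    IsBest I (.node l r) m (combineT L R m).val := by
  rw [combineT_val]
  obtain ⟨-, h2, h3⟩ := foldl_betterT_spec (fun m₁ =>
    (unionT ((L[m₁ - 1]?).getD none) ((R[m - m₁ - 1]?).getD none)).val)
    (List.range' 1 (m - 1)) none
  constructor
  · intro v hv
    rcases h3 with h3 | ⟨m₁, hm₁, h3⟩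
    · rw [h3] at hv; cases hv
    · rw [h3] at hv
      rw [List.mem_range'_1] at hm₁
      obtain ⟨s, hs, hsb⟩ := hL (m₁ - 1) (by lia)
      obtain ⟨t, ht, htb⟩ := hR (m - m₁ - 1) (by lia)
      rw [hs, ht, Option.getD_some, Option.getD_some] at hv
      rcases s with _ | a
      · cases hv
      rcases t with _ | b
      · cases hv
      simp only [unionT, bind_val, op_val, appendT_val, Option.some.injEq] at hv
      subst hv
      obtain ⟨a1, a2, a3⟩ := hsb.sound a rfl
      obtain ⟨b1, b2, b3⟩ := htb.sound b rfl
      refine ⟨?_, ?_, ?_⟩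
      · rw [List.map_append]; exact .split a1 b1
      · rw [List.length_append, a2, b2]; lia
      · rw [listCost_append, a3, b3]
  · intro C hC hlen
    generalize hP : C.map Prod.fst = P at hC
    cases hC with
    | whole =>
      have := congrArg List.length hP
      simp only [List.length_map, List.length_singleton] at this
      lia
    | @split _ _ P Q hlP hrQ =>
      obtain ⟨C₁, C₂, rfl, rfl, rfl⟩ := List.map_eq_append_iff.mp hP
      have p1 := hlP.length_pos
      have p2 := hrQ.length_pos
      rw [List.length_map] at p1 p2
      rw [List.length_append] at hlen
      obtain ⟨s, hs, hsb⟩ := hL (C₁.length - 1) (by lia)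
      obtain ⟨t, ht, htb⟩ := hR (m - C₁.length - 1) (by lia)
      obtain ⟨a, rfl, ha⟩ := hsb.best C₁ hlP (by lia)
      obtain ⟨b, rfl, hb⟩ := htb.best C₂ hrQ (by lia)
      obtain ⟨w, hw, hle⟩ := h2 C₁.length (List.mem_range'_1.mpr (by lia)) (a.1 + b.1, a.2 ++ b.2)
        (by simp [hs, ht, unionT, appendT_val])
      refine ⟨w, hw, hle.trans ?_⟩
      rw [listCost_append]
      exact add_le_add ha hb

theorem pointsT_val (t : BTree X) : t.pointsT.val = t.points := by
  induction t with
  | leaf c => rfl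
  | node l r h1 h2 =>
    rw [BTree.pointsT, call_val, bind_val, bind_val, appendT_val, h1, h2, BTree.points]

theorem tableT_isTable (hall : ∀ x, x ∈ I.pts) (B : BTree X) : IsTable I B (B.tableT I).val := by
  induction B with
  | leaf c =>
    intro j hj
    simp only [BTree.tableT, bind_val, rangeT_val, mapT_val, op_val]
    rw [List.getElem?_map, List.getElem?_range' hj]
    refine ⟨_, rfl, ?_⟩
    beta_reduce
    have hone := oneClusterT_isBest hall (.leaf c)
    split_ifs with h
    · obtain rfl : j = 0 := by lia
      exact hone
    · constructor
      · intro v hv; cases hv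
      · intro C hC hlen
        generalize hP : C.map Prod.fst = P at hC
        cases hC with
        | whole =>
          have := congrArg List.length hP
          simp only [List.length_map, List.length_singleton] at this
          lia
  | node l r hl hr =>
    intro j hj
    simp only [BTree.tableT, call_val, bind_val, rangeT_val, mapT_val]
    rw [List.getElem?_map, List.getElem?_range' hj]
    refine ⟨_, rfl, ?_⟩
    beta_reduce
    have hone := oneClusterT_isBest hall (.node l r)
    rw [← pointsT_val] at hone
    split_ifs with h
    · obtain rfl : j = 0 := by lia
      exact hone
    · have := combineT_isBest hl hr (m := 1 + 1 * j) (by lia) (by lia)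
      rwa [show j + 1 = 1 + 1 * j by lia]

/-- The third phase finds a cheapest pruning of the binary tree into `k` clusters. -/
theorem minPruningT_spec (hall : ∀ x, x ∈ I.pts) (T : CTree X) (hk : 0 < I.k)
    {C : List (List X × X)} (hC : BPruning T.binaryT.val (C.map Prod.fst)) (hlen : C.length = I.k) :
    ∃ D, (minPruningT I T).val = some D ∧ BPruning T.binaryT.val (D.map Prod.fst) ∧
      D.length = I.k ∧ listCost I D ≤ listCost I C := by
  obtain ⟨s, hs, hb⟩ := tableT_isTable hall T.binaryT.val (I.k - 1) (by lia)
  rw [show I.k - 1 + 1 = I.k by lia] at hb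
  obtain ⟨v, rfl, hv⟩ := hb.best C hC hlen
  obtain ⟨h1, h2, h3⟩ := hb.sound v rfl
  refine ⟨v.2, ?_, h1, h2, by rwa [← h3]⟩
  simp [minPruningT, nthT_val, hs]

end DynamicProgramming

/-! ### Reading lists of clusters as clusterings -/

section Reading

variable {X : Type u} [Fintype X] [DecidableEq X] {k : ℕ}

theorem exists_index_of_nodup_flatten (P : List (List X)) (hlen : P.length = k)
    (hnd : P.flatten.Nodup) (hall : ∀ x, x ∈ P.flatten) :
    ∃ g : X → Fin k, ∀ x (i : ℕ) (hi : i < P.length), x ∈ P[i] ↔ (g x : ℕ) = i := by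
  have h1 : ∀ x, ∃ i : Fin k, x ∈ P[i] := by
    intro x
    obtain ⟨L, hL, hx⟩ := List.mem_flatten.mp (hall x)
    obtain ⟨i, hi, rfl⟩ := List.getElem_of_mem hL
    exact ⟨⟨i, by lia⟩, hx⟩
  choose g hg using h1
  refine ⟨g, fun x i hi => ⟨fun hx => ?_, ?_⟩⟩
  · rw [List.nodup_flatten, List.pairwise_iff_getElem] at hnd
    rcases lt_trichotomy (g x : ℕ) i with h | h | h
    · exact absurd hx (hnd.2 _ _ _ _ h (hg x))
    · exact h
    · exact absurd (hg x) (hnd.2 _ _ _ _ h hx)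
  · rintro rfl
    exact hg x

theorem represents_of_index {P : List (List X)} (hlen : P.length = k) {g : X → Fin k}
    (hg : ∀ x (i : ℕ) (hi : i < P.length), x ∈ P[i] ↔ (g x : ℕ) = i) : Represents P g := by
  refine List.ext_getElem (by simp [hlen]) fun i h1 h2 => ?_
  rw [List.getElem_map, List.getElem_ofFn]
  ext x
  rw [List.mem_toFinset, hg, mem_cluster, Fin.ext_iff]

theorem representsWithCenters_of_index {C : List (List X × X)} (hlen : C.length = k)
    {g : X → Fin k} (hg : ∀ x (i : ℕ) (hi : i < (C.map Prod.fst).length),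
      x ∈ (C.map Prod.fst)[i] ↔ (g x : ℕ) = i) :
    RepresentsWithCenters C g fun i => (C[i]'(by rw [hlen]; exact i.2)).2 := by
  refine List.ext_getElem (by simp [hlen]) fun i h1 h2 => ?_
  rw [List.getElem_map, List.getElem_ofFn]
  refine Prod.ext ?_ rfl
  ext x
  have := hg x i (by simpa using h1)
  rw [List.getElem_map] at this
  rw [List.mem_toFinset, this, mem_cluster, Fin.ext_iff]

/-- List costs count repetitions, hence the need for clusters without duplicates. -/
theorem cost_eq_listCost {I : Input X} {C : List (List X × X)} {g : X → Fin k} {b : Fin k → X}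
    (h : RepresentsWithCenters C g b) (hnd : ∀ a ∈ C, a.1.Nodup) :
    cost I.d g b = listCost I C := by
  rw [cost, ← List.sum_ofFn, listCost]
  have h1 := congrArg (List.map fun a : Finset X × X => ∑ x ∈ a.1, I.d x a.2) h
  rw [List.map_map, List.map_ofFn] at h1
  have h2 : C.map (fun a => (a.1.map fun x => I.d x a.2).sum) =
      C.map ((fun a : Finset X × X => ∑ x ∈ a.1, I.d x a.2) ∘ fun c => (c.1.toFinset, c.2)) :=
    List.map_congr_left fun a ha => by
      rw [Function.comp_apply, List.sum_toFinset _ (hnd a ha)]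
  rw [h2, h1]
  rfl

end Reading

/-! ### Sizes of trees -/

theorem mul_add_one_sq (a b : ℕ) : a * (b + 1) ^ 2 = a * b ^ 2 + a * (1 + 2 * b) := by ring

/-- Expands the square into monomials that linear arithmetic can treat as atoms in the size
inductions. -/
theorem mul_add_add_one_sq (a b c : ℕ) : a * (b + c + 1) ^ 2 =
    a * b ^ 2 + a * c ^ 2 + a * (1 + 2 * (b * c) + 2 * b + 2 * c) := by ring

section Size

variable {X : Type u}

mutual
/-- The number of points, list cells and nodes of a tree. -/
def CTree.size : CTree X → ℕ
  | .leaf c => c.length + 1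
  | .node ts => sizeAll ts + 1
def sizeAll : List (CTree X) → ℕ
  | [] => 1
  | t :: ts => t.size + sizeAll ts + 1
end

theorem CTree.size_leaf (c : List X) : (CTree.leaf c).size = c.length + 1 := by rw [CTree.size]

theorem CTree.size_node (ts : List (CTree X)) : (CTree.node ts).size = sizeAll ts + 1 := by
  rw [CTree.size]

theorem sizeAll_nil : sizeAll ([] : List (CTree X)) = 1 := by rw [sizeAll]

theorem sizeAll_cons (t : CTree X) (ts : List (CTree X)) :
    sizeAll (t :: ts) = t.size + sizeAll ts + 1 := by rw [sizeAll]

theorem CTree.size_pos (t : CTree X) : 0 < t.size := by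
  cases t <;> rw [CTree.size] <;> lia

theorem sizeAll_pos (ts : List (CTree X)) : 0 < sizeAll ts := by
  cases ts <;> rw [sizeAll] <;> lia

theorem length_lt_sizeAll (ts : List (CTree X)) : ts.length < sizeAll ts := by
  induction ts with
  | nil => rw [sizeAll_nil]; simp
  | cons t ts ih => rw [sizeAll_cons, List.length_cons]; lia

theorem size_lt_sizeAll {ts : List (CTree X)} {t : CTree X} (h : t ∈ ts) :
    t.size < sizeAll ts := by
  induction ts with
  | nil => cases h
  | cons s ts ih =>
    rw [sizeAll_cons]
    rcases List.mem_cons.mp h with rfl | h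
    · lia
    · have := ih h; lia

theorem sizeAll_filter_add (F : List (CTree X)) (p : CTree X → Bool) :
    sizeAll (F.filter p) + sizeAll (F.filter fun t => !p t) = sizeAll F + 1 := by
  induction F with
  | nil => simp [sizeAll_nil]
  | cons t F ih =>
    cases h : p t <;> simp [h, sizeAll_cons] <;> lia

mutual
theorem length_points_lt : (t : CTree X) → t.points.length < t.size
  | .leaf c => by rw [CTree.points, CTree.size]; lia
  | .node ts => by
    rw [CTree.points, CTree.size]
    have := length_pointsAll_lt ts
    lia
theorem length_pointsAll_lt : (ts : List (CTree X)) → (pointsAll ts).length < sizeAll ts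
  | [] => by rw [pointsAll, sizeAll]; simp
  | t :: ts => by
    rw [pointsAll, sizeAll, List.length_append]
    have := length_points_lt t
    have := length_pointsAll_lt ts
    lia
end

-- Appending at each level costs linear time; the cross terms of the square of a sum absorb this in
-- the induction.
mutual
theorem pointsT_cost_le : (t : CTree X) → t.pointsT.cost ≤ 2 * t.size ^ 2
  | .leaf c => by rw [CTree.pointsT, CTree.size, op_cost]; rw [mul_add_one_sq]; lia
  | .node ts => by
    rw [CTree.pointsT, CTree.size, call_cost]
    have := pointsAllT_cost_le ts
    rw [mul_add_one_sq]
    lia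
theorem pointsAllT_cost_le : (ts : List (CTree X)) → (pointsAllT ts).cost ≤ 2 * sizeAll ts ^ 2
  | [] => by rw [pointsAllT, sizeAll, op_cost]; lia
  | t :: ts => by
    rw [pointsAllT, sizeAll, call_cost, bind_cost, bind_cost, appendT_cost, CTree.pointsT_val]
    have := length_points_lt t
    have := pointsT_cost_le t
    have := pointsAllT_cost_le ts
    rw [mul_add_add_one_sq]
    lia
end

end Size

/-! ### The running time of the linkage phase -/

section LinkageCost

variable {X : Type u} (I : Input X)

theorem nearlyInT_cost_le (δ : ℝ) (p : X) (r : ℝ) (t : CTree X) {N : ℕ} (hN : t.size ≤ N) :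
    (nearlyInT I δ p r t).cost ≤ 14 * N ^ 2 := by
  simp only [nearlyInT, bind_cost, op_cost, lengthT_cost, splitT_val, CTree.pointsT_val]
  have h1 := pointsT_cost_le t
  have h2 := length_points_lt t
  have h3 := splitT_cost_le (inBallT I p r) t.points 2 (fun a _ => le_rfl)
  have h4 := List.length_filter_le (fun a => (inBallT I p r a).val) t.points
  have h5 := List.length_filter_le (fun a => !(inBallT I p r a).val) t.points
  have h6 : t.size ^ 2 ≤ N ^ 2 := Nat.pow_le_pow_left hN 2
  have h7 : N ≤ N ^ 2 := Nat.le_self_pow (by lia) N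
  lia

theorem violatesT_cost_le (ball : List X) (x : X) {N : ℕ} (hN : ball.length ≤ N) :
    (violatesT I ball x).cost ≤ N * (5 * N + 3) + 1 := by
  have h1 : ∀ p₁, (anyT (fun p₂ => (op (I.d p₁ p₂)).bind fun a =>
      (op (I.d p₁ x)).bind fun b => op (decide (b ≤ a))) ball).cost ≤ N * 5 + 1 := fun p₁ =>
    (anyT_cost_le _ ball 3 fun a _ => le_rfl).trans (by gcongr)
  refine (anyT_cost_le _ ball _ fun p₁ _ => h1 p₁).trans ?_
  have : ball.length * (N * 5 + 1 + 2) ≤ N * (N * 5 + 1 + 2) := by gcongr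
  lia

theorem approxClosureT_cost_le (δ : ℝ) (p : X) (r : ℝ) (u : List X) {N : ℕ}
    (hN : I.pts.length ≤ N) (hu : u.length ≤ N) (hN0 : 0 < N) :
    (approxClosureT I δ p r u).cost ≤ 32 * N ^ 3 := by
  simp only [approxClosureT, bind_cost, op_cost, lengthT_cost, splitT_val]
  have h1 := splitT_cost_le (inBallT I p r) I.pts 2 (fun a _ => le_rfl)
  have h2 := splitT_cost_le (inBallT I p r) u 2 (fun a _ => le_rfl)
  set ball := I.pts.filter fun a => (inBallT I p r a).val
  set out := I.pts.filter fun a => !(inBallT I p r a).val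
  have h3 : ball.length ≤ N := (List.length_filter_le _ _).trans hN
  have h4 : out.length ≤ N := (List.length_filter_le _ _).trans hN
  have h5 := splitT_cost_le (violatesT I ball) out _ (fun a _ => violatesT_cost_le I ball a h3)
  have h6 : out.length * (N * (5 * N + 3) + 1 + 2) ≤ N * (N * (5 * N + 3) + 1 + 2) := by gcongr
  have h7 := List.length_filter_le (fun a => !(inBallT I p r a).val) u
  have h8 := List.length_filter_le (fun a => (violatesT I ball a).val) out
  have h9 : N ≤ N ^ 3 := Nat.le_self_pow (by lia) N
  have h10 : N ^ 2 ≤ N ^ 3 := Nat.pow_le_pow_right hN0 (by lia)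
  have h11 : N * (N * (5 * N + 3) + 1 + 2) = 5 * N ^ 3 + 3 * N ^ 2 + 3 * N := by ring
  lia

theorem linkT_cost_le (δ : ℝ) (F : List (CTree X)) (pq : X × X) {N : ℕ}
    (hN : I.pts.length ≤ N) (hF : sizeAll F ≤ N) : (linkT I δ F pq).cost ≤ 56 * N ^ 3 := by
  simp only [linkT, bind_cost, op_cost, lengthT_cost, splitT_val, pointsAllT_val, op_val]
  set r := I.d pq.1 pq.2
  have hN0 : 0 < N := (sizeAll_pos F).trans_le hF
  have h1 := splitT_cost_le (nearlyInT I δ pq.1 r) F _ (fun t ht =>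
    nearlyInT_cost_le I δ pq.1 r t ((size_lt_sizeAll ht).le.trans hF))
  have h2 : F.length ≤ N := (length_lt_sizeAll F).le.trans hF
  set U := F.filter fun a => (nearlyInT I δ pq.1 r a).val
  have hU : sizeAll U ≤ N := by
    have := sizeAll_filter_add F fun a => (nearlyInT I δ pq.1 r a).val
    have := sizeAll_pos (F.filter fun a => !(nearlyInT I δ pq.1 r a).val)
    lia
  have h3 := pointsAllT_cost_le U
  have h4 : sizeAll U ^ 2 ≤ N ^ 2 := Nat.pow_le_pow_left hU 2
  have h5 := approxClosureT_cost_le I δ pq.1 r (pointsAll U) hN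
    ((length_pointsAll_lt U).le.trans hU) hN0
  have h6 := (length_lt_sizeAll U).le.trans hU
  have h7 : F.length * (14 * N ^ 2 + 2) ≤ N * (14 * N ^ 2 + 2) := by gcongr
  have h8 : N * (14 * N ^ 2 + 2) = 14 * N ^ 3 + 2 * N := by ring
  have h9 : N ≤ N ^ 3 := Nat.le_self_pow (by lia) N
  have h10 : N ^ 2 ≤ N ^ 3 := Nat.pow_le_pow_right hN0 (by lia)
  lia

/-- The children only move. The new node, its list cell and the end marker of its own list of
children add 3. -/
theorem linkT_size_le (δ : ℝ) (F : List (CTree X)) (pq : X × X) :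
    sizeAll (linkT I δ F pq).val ≤ sizeAll F + 3 := by
  simp only [linkT, bind_val, op_val, splitT_val]
  have := sizeAll_filter_add F fun t => (nearlyInT I δ pq.1 (I.d pq.1 pq.2) t).val
  split_ifs
  · rw [sizeAll_cons, CTree.size_node]
    lia
  · lia

/-- The bound for the size of the trees of the linkage phase. -/
def sizeBound (n : ℕ) : ℕ := 3 * n ^ 2 + 3 * n + 2

theorem sizeAll_map_leaf (l : List X) : sizeAll (l.map fun x => CTree.leaf [x]) =
    3 * l.length + 1 := by
  induction l with
  | nil => rw [List.map_nil, sizeAll_nil]; rfl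
  | cons x l ih =>
    rw [List.map_cons, sizeAll_cons, ih, CTree.size_leaf, List.length_singleton, List.length_cons]
    lia

theorem foldl_linkT_size_le (δ : ℝ) (l : List (X × X)) (F : List (CTree X)) :
    sizeAll (l.foldl (fun F pq => (linkT I δ F pq).val) F) ≤ sizeAll F + 3 * l.length := by
  induction l generalizing F with
  | nil => simp
  | cons pq l ih =>
    rw [List.foldl_cons, List.length_cons]
    have h1 := ih (linkT I δ F pq).val
    have h2 := linkT_size_le I δ F pq
    lia

theorem linkageT_size_le : (linkageT I).val.size ≤ sizeBound I.pts.length := by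
  simp only [linkageT, bind_val, op_val, mapT_val, foldT_val]
  set l := (sortT (fun pq : X × X => I.d pq.1 pq.2) (pairsT I.pts I.pts).val).val with hl
  have hlen : l.length = I.pts.length ^ 2 := by
    rw [hl, (sortT_perm _ _).length_eq, length_pairsT, sq]
  have h1 := foldl_linkT_size_le I (slackT I).val l (I.pts.map fun x => .leaf [x])
  rw [sizeAll_map_leaf, hlen] at h1
  unfold sizeBound
  generalize hF : l.foldl (fun F pq => (linkT I (slackT I).val F pq).val)
    (I.pts.map fun x => CTree.leaf [x]) = F at h1 ⊢
  split
  · rw [sizeAll_cons, sizeAll_nil] at h1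
    lia
  · rw [CTree.size_node]
    lia

theorem linkageT_cost_le {N : ℕ} (hN : sizeBound I.pts.length ≤ N) :
    (linkageT I).cost ≤ 90 * N ^ 4 := by
  simp only [linkageT, slackT, bind_cost, op_cost, lengthT_cost, bind_val, op_val, mapT_val]
  set n := I.pts.length with hn
  unfold sizeBound at hN
  set δ : ℝ := I.ε * ((lengthT I.pts).val : ℝ)
  set l := (sortT (fun pq : X × X => I.d pq.1 pq.2) (pairsT I.pts I.pts).val).val with hl
  have hlen : l.length = n ^ 2 := by
    rw [hl, (sortT_perm _ _).length_eq, length_pairsT, sq]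
  have h1 := pairsT_cost_le I.pts I.pts
  have h2 := sortT_cost_le (fun pq : X × X => I.d pq.1 pq.2) (pairsT I.pts I.pts).val
  rw [length_pairsT] at h2
  have h3 := mapT_cost_le (fun x => op (CTree.leaf [x])) I.pts 1 (fun _ _ => le_rfl)
  -- Each round adds at most 3 to the size, so size plus three times the number of remaining rounds
  -- never increases.
  have h4 := foldT_cost_le (linkT I δ) (fun l F => sizeAll F + 3 * l.length ≤ N) (56 * N ^ 3)
    (fun pq l F h => ⟨linkT_cost_le I δ F pq (by lia) (by lia), by
      have := linkT_size_le I δ F pq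
      rw [List.length_cons] at h
      lia⟩) (I.pts.map fun x => .leaf [x]) l (by
      rw [sizeAll_map_leaf, hlen]
      lia)
  rw [hlen] at h4
  rw [← hn] at h1 h2 h3
  have hN0 : 0 < N := by lia
  have h5 : N ≤ N ^ 4 := Nat.le_self_pow (by lia) N
  have h6 : N ^ 2 ≤ N ^ 4 := Nat.pow_le_pow_right hN0 (by lia)
  have hnN : n ^ 2 ≤ N := by lia
  have h7 : n * (5 * n + 3) = 5 * n ^ 2 + 3 * n := by ring
  have h8 : n * n * (3 * (n * n) + 2) = 3 * (n ^ 2) ^ 2 + 2 * n ^ 2 := by ring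
  have h9 : (n ^ 2) ^ 2 ≤ N ^ 2 := Nat.pow_le_pow_left hnN 2
  have h10 : n ^ 2 * (56 * N ^ 3 + 1) ≤ N * (56 * N ^ 3 + 1) := by gcongr
  have h11 : N * (56 * N ^ 3 + 1) = 56 * N ^ 4 + N := by ring
  lia

end LinkageCost

/-! ### The running time of the cleaning phase -/

section CleanCost

variable {X : Type u}

mutual
theorem collapseT_cost_le : (t : CTree X) → t.collapseT.cost ≤ 3 * t.size ^ 2
  | .leaf c => by rw [CTree.collapseT, CTree.size, op_cost]; rw [mul_add_one_sq]; lia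
  | .node ts => by
    rw [CTree.collapseT, CTree.size, call_cost, bind_cost]
    have h1 := allT_cost_le (fun t : CTree X => op t.isSingleLeaf) ts 1 (fun _ _ => le_rfl)
    have h2 := length_lt_sizeAll ts
    have h3 := pointsAllT_cost_le ts
    have h4 := collapseAllT_cost_le ts
    split_ifs
    · rw [bind_cost, op_cost]
      rw [mul_add_one_sq]
      lia
    · rw [bind_cost, op_cost]
      rw [mul_add_one_sq]
      lia
theorem collapseAllT_cost_le : (ts : List (CTree X)) → (collapseAllT ts).cost ≤ 3 * sizeAll ts ^ 2
  | [] => by rw [collapseAllT, sizeAll, op_cost]; lia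
  | t :: ts => by
    rw [collapseAllT, sizeAll, call_cost, bind_cost, bind_cost, op_cost]
    have := collapseT_cost_le t
    have := collapseAllT_cost_le ts
    rw [mul_add_add_one_sq]
    lia
end

mutual
theorem collapseT_size_le : (t : CTree X) → t.collapseT.val.size ≤ t.size
  | .leaf c => by rw [collapseT_leaf_val]
  | .node ts => by
    rw [collapseT_node_val]
    have h1 := length_pointsAll_lt ts
    have h2 := collapseAllT_size_le ts
    split_ifs
    · rw [CTree.size_leaf, CTree.size_node]; lia
    · rw [CTree.size_node, CTree.size_node]; lia
theorem collapseAllT_size_le : (ts : List (CTree X)) →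
    sizeAll (ts.map fun t => t.collapseT.val) ≤ sizeAll ts
  | [] => le_rfl
  | t :: ts => by
    rw [List.map_cons, sizeAll_cons, sizeAll_cons]
    have h1 := collapseT_size_le t
    have h2 := collapseAllT_size_le ts
    lia
end

mutual
theorem leavesT_length_le : (t : CTree X) → t.leavesT.val.length ≤ t.size ∧
    t.leavesT.val.flatten.length ≤ t.size
  | .leaf c => by rw [leavesT_leaf_val, CTree.size]; simp
  | .node ts => by
    rw [CTree.leavesT, call_val, CTree.size]
    have := leavesAllT_length_le ts
    lia
theorem leavesAllT_length_le : (ts : List (CTree X)) → (leavesAllT ts).val.length ≤ sizeAll ts ∧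
    (leavesAllT ts).val.flatten.length ≤ sizeAll ts
  | [] => by rw [leavesAllT, sizeAll, op_val]; simp
  | t :: ts => by
    rw [leavesAllT, sizeAll, call_val, bind_val, bind_val, appendT_val, List.length_append,
      List.flatten_append, List.length_append]
    have h1 := leavesT_length_le t
    have h2 := leavesAllT_length_le ts
    lia
end

mutual
theorem leavesT_cost_le : (t : CTree X) → t.leavesT.cost ≤ 2 * t.size ^ 2
  | .leaf c => by rw [CTree.leavesT, CTree.size, op_cost]; rw [mul_add_one_sq]; lia
  | .node ts => by
    rw [CTree.leavesT, CTree.size, call_cost]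
    have := leavesAllT_cost_le ts
    rw [mul_add_one_sq]
    lia
theorem leavesAllT_cost_le : (ts : List (CTree X)) → (leavesAllT ts).cost ≤ 2 * sizeAll ts ^ 2
  | [] => by rw [leavesAllT, sizeAll, op_cost]; lia
  | t :: ts => by
    rw [leavesAllT, sizeAll, call_cost, bind_cost, bind_cost, appendT_cost]
    have := (leavesT_length_le t).1
    have := leavesT_cost_le t
    have := leavesAllT_cost_le ts
    rw [mul_add_add_one_sq]
    lia
end

theorem medianT_cost_le (I : Input X) (p : X) (c : List X) {N : ℕ} (hN : c.length ≤ N)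
    (hN0 : 0 < N) : (medianT I p c).cost ≤ 18 * N ^ 2 := by
  simp only [medianT, bind_cost, op_cost, lengthT_cost, mapT_val]
  have h1 := mapT_cost_le (fun x => op (I.d p x)) c 1 (fun _ _ => le_rfl)
  have h2 := sortT_cost_le (fun t : ℝ => t) (c.map fun a => (op (I.d p a)).val)
  have h3 := (sortT_perm (fun t : ℝ => t) (c.map fun a => (op (I.d p a)).val)).length_eq
  set s := (sortT (fun t : ℝ => t) (c.map fun a => (op (I.d p a)).val)).val
  rw [List.length_map] at h2 h3
  have h4 := fun j => nthT_cost_le s j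
  have h5 := h4 (((lengthT s).val - 1) / 2)
  have h6 := h4 ((lengthT s).val / 2)
  rw [h3] at h5 h6 ⊢
  have h7 : c.length * (3 * c.length + 2) ≤ N * (3 * N + 2) := by gcongr
  have h8 : N * (3 * N + 2) = 3 * N ^ 2 + 2 * N := by ring
  have h9 : N ≤ N ^ 2 := Nat.le_self_pow (by lia) N
  lia

theorem nearestLeafT_cost_le (I : Input X) (p : X) (l : List (List X)) {N : ℕ} (hl : l.length ≤ N)
    (hN : ∀ c ∈ l, c.length ≤ N) (hN0 : 0 < N) : (nearestLeafT I p l).cost ≤ 21 * N ^ 3 := by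
  rw [nearestLeafT]
  refine (foldT_cost_le _ (fun l _ => ∀ c ∈ l, c.length ≤ N) (18 * N ^ 2 + 1) ?_ _ _ hN).trans ?_
  · intro c l b h
    refine ⟨?_, fun c hc => h c (by simp [hc])⟩
    have := medianT_cost_le I p c (h c (by simp)) hN0
    rw [bind_cost, op_cost]
    lia
  · have h1 : l.length * (18 * N ^ 2 + 1 + 1) ≤ N * (18 * N ^ 2 + 1 + 1) := by gcongr
    have h2 : N * (18 * N ^ 2 + 1 + 1) = 18 * N ^ 3 + 2 * N := by ring
    have h3 : N ≤ N ^ 3 := Nat.le_self_pow (by lia) N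
    lia

variable [DecidableEq X]

theorem fillLeafT_cost_le (asg : List (X × Option (ℝ × X))) (c : List X) {N : ℕ}
    (hasg : asg.length ≤ N) (hc : c.length ≤ N) (hN0 : 0 < N) :
    (fillLeafT asg c).cost ≤ 14 * N ^ 2 := by
  have h : ∀ t : X × Option (ℝ × X) → Timed Bool, (∀ a, (t a).cost ≤ N * 3 + 1) →
      ((splitT t asg).bind fun s => (mapT (fun a => op a.1) s.1).bind fun extra =>
        appendT c extra).cost ≤ 14 * N ^ 2 := by
    intro t ht
    simp only [bind_cost, mapT_val, appendT_cost, splitT_val]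
    have h1 := splitT_cost_le t asg (N * 3 + 1) (fun a _ => ht a)
    have h2 := mapT_cost_le (fun a : X × Option (ℝ × X) => op a.1)
      (asg.filter fun a => (t a).val) 1 (fun _ _ => le_rfl)
    have h3 := List.length_filter_le (fun a => (t a).val) asg
    have h4 : asg.length * (N * 3 + 1 + 2) ≤ N * (N * 3 + 1 + 2) := by gcongr
    have h5 : N * (N * 3 + 1 + 2) = 3 * N ^ 2 + 3 * N := by ring
    have h6 : N ≤ N ^ 2 := Nat.le_self_pow (by lia) N
    lia
  refine h _ fun a => ?_
  rcases a with ⟨x, _ | b⟩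
  · simp
  · exact (memT_cost_le b.2 c).trans (by gcongr)

theorem fillLeafT_length_le (asg : List (X × Option (ℝ × X))) (c : List X) :
    (fillLeafT asg c).val.length ≤ c.length + asg.length := by
  rw [fillLeafT_val, List.length_append, List.length_map]
  gcongr
  exact List.length_filter_le _ _

mutual
theorem rebuildT_cost_le (asg : List (X × Option (ℝ × X))) {N : ℕ} (hasg : asg.length ≤ N) :
    (t : CTree X) → t.size ≤ N → (t.rebuildT asg).cost ≤ (14 * N ^ 2 + 4) * t.size
  | .leaf c, h => by
    rw [CTree.size] at h
    rw [CTree.rebuildT, CTree.size, call_cost, bind_cost, op_cost]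
    have := fillLeafT_cost_le asg c hasg (by lia) (by lia)
    nlinarith
  | .node ts, h => by
    rw [CTree.size] at h
    rw [CTree.rebuildT, CTree.size, call_cost, bind_cost, op_cost]
    have := rebuildAllT_cost_le asg hasg ts (by lia)
    nlinarith
theorem rebuildAllT_cost_le (asg : List (X × Option (ℝ × X))) {N : ℕ} (hasg : asg.length ≤ N) :
    (ts : List (CTree X)) → sizeAll ts ≤ N →
      (rebuildAllT asg ts).cost ≤ (14 * N ^ 2 + 4) * sizeAll ts
  | [], _ => by rw [rebuildAllT, sizeAll, op_cost]; lia
  | t :: ts, h => by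
    rw [sizeAll] at h
    rw [rebuildAllT, sizeAll, call_cost, bind_cost, op_cost]
    have h1 := rebuildT_cost_le asg hasg t (by lia)
    have h2 := rebuildAllT_cost_le asg hasg ts (by lia)
    split_ifs
    · nlinarith
    · rw [bind_cost, bind_cost, op_cost]
      nlinarith
end

-- Crude on purpose: every leaf is charged with the entire assignment, which avoids any disjointness
-- and stays polynomial.
mutual
theorem rebuildT_size_le (asg : List (X × Option (ℝ × X))) :
    (t : CTree X) → (t.rebuildT asg).val.size ≤ t.size * (asg.length + 1)
  | .leaf c => by
    rw [rebuildT_leaf_val, CTree.size_leaf, CTree.size_leaf]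
    have := fillLeafT_length_le asg c
    nlinarith
  | .node ts => by
    rw [rebuildT_node_val, CTree.size_node, CTree.size_node]
    have := rebuildAllT_size_le asg ts
    nlinarith
theorem rebuildAllT_size_le (asg : List (X × Option (ℝ × X))) : (ts : List (CTree X)) →
    sizeAll ((ts.filter fun t => !t.isSingleLeaf).map fun t => (t.rebuildT asg).val) ≤
      sizeAll ts * (asg.length + 1)
  | [] => by rw [List.filter_nil, List.map_nil, sizeAll_nil]; lia
  | t :: ts => by
    have h1 := rebuildT_size_le asg t
    have h2 := rebuildAllT_size_le asg ts
    cases h : t.isSingleLeaf <;>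
      simp only [List.filter_cons, h, Bool.not_true, Bool.not_false, if_true, Bool.false_eq_true,
        if_false, List.map_cons, sizeAll_cons] <;> nlinarith
end

theorem length_singlePoints_le (T : CTree X) : (singlePoints T).length ≤ T.size := by
  refine le_trans ?_ ((leavesT_length_le T.collapseT.val).2.trans (collapseT_size_le T))
  rw [singlePoints, (List.reverse_perm _).flatten.length_eq]
  exact (List.filter_sublist.flatten).length_le

theorem cleanT_size_le (I : Input X) (T : CTree X) {N : ℕ} (hN : T.size ≤ N) :
    (cleanT I T).val.size ≤ N * (N + 1) := by
  rw [cleanT_val, cleaned]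
  refine (rebuildT_size_le _ _).trans ?_
  rw [assignment, List.length_map]
  have h1 := collapseT_size_le T
  have h2 := length_singlePoints_le T
  gcongr <;> lia

theorem cleanT_cost_le (I : Input X) (T : CTree X) {N : ℕ} (hN : T.size ≤ N) :
    (cleanT I T).cost ≤ 60 * N ^ 4 := by
  simp only [cleanT, bind_cost, splitT_val, op_val, foldT_val, mapT_val, bind_val, appendT_val,
    List.foldl_flip_append_eq_append, List.append_nil, List.map_id']
  have hN0 : 0 < N := T.size_pos.trans_le hN
  have e1 : T.collapseT.val.leavesT.val = leafList T := rfl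
  have e2 : ((leafList T).filter fun c => !isSingle c) = bigLeaves T := rfl
  have e3 : ((leafList T).filter fun c => isSingle c).reverse.flatten = singlePoints T := rfl
  have e4 : ((singlePoints T).map fun a => (a, (nearestLeafT I a (bigLeaves T)).val)) =
    assignment I T := rfl
  rw [e1, e2, e3, e4]
  have hT' : T.collapseT.val.size ≤ N := (collapseT_size_le T).trans hN
  have hlen : (leafList T).length ≤ N := (leavesT_length_le T.collapseT.val).1.trans hT'
  have hmem : ∀ c ∈ leafList T, c.length ≤ N := fun c hc =>
    ((List.sublist_flatten_of_mem hc).length_le.trans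
      (leavesT_length_le T.collapseT.val).2).trans hT'
  have hsing := (length_singlePoints_le T).trans hN
  have h1 := collapseT_cost_le T
  have h2 := leavesT_cost_le T.collapseT.val
  have h3 := splitT_cost_le (fun c : List X => op (isSingle c)) (leafList T) 1 (fun _ _ => le_rfl)
  have h4 := foldT_cost_le (fun (acc c : List X) => appendT c acc)
    (fun l _ => ∀ c ∈ l, c.length ≤ N) (2 * N + 1) (fun c l b h => ⟨by
      rw [appendT_cost]
      have := h c (by simp)
      lia, fun c hc => h c (by simp [hc])⟩) [] ((leafList T).filter fun c => isSingle c)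
    fun c hc => hmem c (List.mem_of_mem_filter hc)
  have h5 := mapT_cost_le (fun p => (nearestLeafT I p (bigLeaves T)).bind fun b => op (p, b))
    (singlePoints T) (21 * N ^ 3 + 1) (fun p _ => by
      rw [bind_cost, op_cost]
      have := nearestLeafT_cost_le I p (bigLeaves T)
        ((List.length_filter_le _ _).trans hlen) (fun c hc => hmem c (List.mem_of_mem_filter hc))
        hN0
      lia)
  have h6 := rebuildT_cost_le (assignment I T) (N := N)
    (by rw [assignment, List.length_map]; exact hsing) T.collapseT.val hT'
  have g1 : T.size ^ 2 ≤ N ^ 2 := Nat.pow_le_pow_left hN 2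
  have g2 : T.collapseT.val.size ^ 2 ≤ N ^ 2 := Nat.pow_le_pow_left hT' 2
  have g3 : ((leafList T).filter fun c => isSingle c).length * (2 * N + 1 + 1) ≤
      N * (2 * N + 1 + 1) := by
    gcongr
    exact (List.length_filter_le _ _).trans hlen
  have g4 : (singlePoints T).length * (21 * N ^ 3 + 1 + 2) ≤ N * (21 * N ^ 3 + 1 + 2) := by gcongr
  have g5 : (14 * N ^ 2 + 4) * T.collapseT.val.size ≤ (14 * N ^ 2 + 4) * N := by gcongr
  have g6 : N * (2 * N + 1 + 1) = 2 * N ^ 2 + 2 * N := by ring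
  have g7 : N * (21 * N ^ 3 + 1 + 2) = 21 * N ^ 4 + 3 * N := by ring
  have g8 : (14 * N ^ 2 + 4) * N = 14 * N ^ 3 + 4 * N := by ring
  have k1 : N ≤ N ^ 4 := Nat.le_self_pow (by lia) N
  have k2 : N ^ 2 ≤ N ^ 4 := Nat.pow_le_pow_right hN0 (by lia)
  have k3 : N ^ 3 ≤ N ^ 4 := Nat.pow_le_pow_right hN0 (by lia)
  lia

end CleanCost

/-! ### The running time of the dynamic program -/

section DynamicCost

variable {X : Type u}

/-- The number of points and nodes of a binary tree. -/
def BTree.size : BTree X → ℕ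
  | .leaf c => c.length + 1
  | .node l r => l.size + r.size + 1

theorem BTree.size_pos (B : BTree X) : 0 < B.size := by
  cases B <;> rw [BTree.size] <;> lia

theorem BTree.length_points_le (B : BTree X) : B.points.length ≤ B.size := by
  induction B with
  | leaf c => rw [BTree.points, BTree.size]; lia
  | node l r h1 h2 => rw [BTree.points, BTree.size, List.length_append]; lia

theorem BTree.pointsT_cost_le (B : BTree X) : B.pointsT.cost ≤ 2 * B.size ^ 2 := by
  induction B with
  | leaf c => rw [BTree.pointsT, BTree.size, op_cost, mul_add_one_sq]; lia
  | node l r h1 h2 =>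
    rw [BTree.pointsT, BTree.size, call_cost, bind_cost, bind_cost, appendT_cost, pointsT_val]
    have := l.length_points_le
    have := l.size_pos
    have := r.size_pos
    rw [mul_add_add_one_sq]
    lia

mutual
theorem binaryT_cost_le : (t : CTree X) → t.binaryT.cost ≤ 3 * t.size
  | .leaf c => by rw [CTree.binaryT, CTree.size, op_cost]; lia
  | .node ts => by
    rw [CTree.binaryT, CTree.size, call_cost]
    have := binaryAllT_cost_le ts none
    lia
theorem binaryAllT_cost_le : (ts : List (CTree X)) → (a : Option (BTree X)) →
    (binaryAllT a ts).cost ≤ 3 * sizeAll ts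
  | [], a => by rw [binaryAllT, sizeAll, op_cost]; lia
  | t :: ts, a => by
    rw [binaryAllT, sizeAll, call_cost, bind_cost, bind_cost, op_cost]
    have h1 := binaryT_cost_le t
    have h2 := binaryAllT_cost_le ts
    refine le_trans (Nat.add_le_add_right (Nat.add_le_add_left (Nat.add_le_add_left (h2 _) _) _) _) ?_
    lia
end

mutual
theorem binaryT_size_le : (t : CTree X) → t.binaryT.val.size ≤ t.size
  | .leaf c => by rw [binaryT_leaf_val, CTree.size, BTree.size]
  | .node ts => by
    rw [binaryT_node_val, CTree.size]
    cases ts with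
    | nil => rw [binaryAllT_nil_val, Option.getD_none, BTree.size, List.length_nil]; lia
    | cons t ts =>
      rw [binaryAllT_none_val, sizeAll]
      have h1 := binaryT_size_le t
      have h2 := binaryAllT_size_le ts t.binaryT.val
      lia
theorem binaryAllT_size_le : (ts : List (CTree X)) → (a : BTree X) →
    (binaryAllT (some a) ts).val.size ≤ a.size + sizeAll ts
  | [], a => by rw [binaryAllT_nil_val, Option.getD_some]; lia
  | t :: ts, a => by
    rw [binaryAllT_some_val, sizeAll]
    have h1 := binaryT_size_le t
    have h2 := binaryAllT_size_le ts (.node a t.binaryT.val)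
    rw [BTree.size] at h2
    lia
end

theorem betterT_cost (s t : Sol X) : (betterT s t).cost = 1 := by
  rcases s with _ | a <;> rcases t with _ | b <;> rfl

variable {I : Input X} {N : ℕ}

theorem oneClusterT_cost_le (c : List X) (hn : I.pts.length ≤ N) (hc : c.length ≤ N)
    (hN0 : 0 < N) : (oneClusterT I c).cost ≤ 9 * N ^ 2 := by
  rw [oneClusterT]
  refine (foldT_cost_le _ (fun _ _ => True) (N * 3 + 3) (fun s _ b _ => ⟨?_, trivial⟩) _ _
    trivial).trans ?_
  · simp only [bind_cost, op_cost, betterT_cost]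
    have := foldT_cost_le (fun t x => (op (I.d x s)).bind fun a => op (t + a)) (fun _ _ => True) 2
      (fun _ _ _ _ => ⟨le_rfl, trivial⟩) 0 c trivial
    lia
  · have h1 : I.pts.length * (N * 3 + 3 + 1) ≤ N * (N * 3 + 3 + 1) := by gcongr
    have h2 : N * (N * 3 + 3 + 1) = 3 * N ^ 2 + 4 * N := by ring
    have h3 : N ≤ N ^ 2 := Nat.le_self_pow (by lia) N
    lia

/-- Correctness of the left table enters the time bound: a stored solution for m₁ clusters has
length m₁, so appending it is cheap. -/
theorem combineT_cost_le {l : BTree X} {L R : List (Sol X)} (hL : IsTable I l L)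
    (hLl : L.length = I.k) (hRl : R.length = I.k) {m : ℕ} (hm : m ≤ I.k) (hk : I.k ≤ N)
    (hN0 : 0 < N) : (combineT L R m).cost ≤ 20 * N ^ 2 := by
  rw [combineT, bind_cost, rangeT_cost, rangeT_val]
  have h1 := foldT_cost_le (fun (best : Sol X) m₁ =>
    (nthT L (m₁ - 1)).bind fun a =>
    (nthT R (m - m₁ - 1)).bind fun b =>
    (unionT (a.getD none) (b.getD none)).bind fun new =>
    betterT best new) (fun l _ => ∀ m₁ ∈ l, 1 ≤ m₁ ∧ m₁ < m) (4 * N + 5)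
    (fun m₁ l b h => ⟨?_, fun m hm => h m (by simp [hm])⟩) none (List.range' 1 (m - 1))
    (fun m₁ hm₁ => by rw [List.mem_range'_1] at hm₁; lia)
  · rw [List.length_range'] at h1
    have h2 : (m - 1) * (4 * N + 5 + 1) ≤ N * (4 * N + 5 + 1) := by gcongr; lia
    have h3 : N * (4 * N + 5 + 1) = 4 * N ^ 2 + 6 * N := by ring
    have h4 : N ≤ N ^ 2 := Nat.le_self_pow (by lia) N
    lia
  · have hm₁ := h m₁ (by simp)
    simp only [bind_cost, nthT_val, betterT_cost]
    have h1 := nthT_cost_le L (m₁ - 1)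
    have h2 := nthT_cost_le R (m - m₁ - 1)
    have h3 : (unionT ((L[m₁ - 1]?).getD none) ((R[m - m₁ - 1]?).getD none)).cost ≤
        2 * N + 2 := by
      obtain ⟨s, hs, hb⟩ := hL (m₁ - 1) (by lia)
      rw [hs, Option.getD_some]
      generalize (R[m - m₁ - 1]?).getD none = t
      rcases s with _ | a
      · simp [unionT]
      rcases t with _ | b
      · simp [unionT]
      simp only [unionT, bind_cost, appendT_cost, op_cost]
      have := (hb.sound a rfl).2.1
      lia
    lia

theorem tableT_length (B : BTree X) : (B.tableT I).val.length = I.k := by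
  cases B <;> simp [BTree.tableT, rangeT_val, mapT_val]

theorem tableT_cost_le (hall : ∀ x, x ∈ I.pts) (hn : I.pts.length ≤ N) (hk : I.k ≤ N) (B : BTree X)
    (hB : B.size ≤ N) : (B.tableT I).cost ≤ 40 * N ^ 3 * B.size := by
  have hN0 : 0 < N := B.size_pos.trans_le hB
  have k1 : N ≤ N ^ 3 := Nat.le_self_pow (by lia) N
  have k2 : N ^ 2 ≤ N ^ 3 := Nat.pow_le_pow_right hN0 (by lia)
  induction B with
  | leaf c =>
    rw [BTree.tableT, bind_cost, bind_cost, rangeT_cost, rangeT_val]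
    rw [BTree.size] at hB ⊢
    have h1 := oneClusterT_cost_le (I := I) c hn (by lia) hN0
    have h2 := mapT_cost_le (fun m => op (if m = 1 then (oneClusterT I c).val else none))
      (List.range' 1 I.k) 1 (fun _ _ => le_rfl)
    rw [List.length_range'] at h2
    have h3 : 40 * N ^ 3 * 1 ≤ 40 * N ^ 3 * (c.length + 1) := by gcongr; lia
    lia
  | node l r hl hr =>
    rw [BTree.tableT, call_cost, bind_cost, bind_cost, bind_cost, bind_cost, bind_cost,
      rangeT_cost, rangeT_val, pointsT_val]
    have hp := (BTree.node l r).pointsT_cost_le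
    have hp' := (BTree.node l r).length_points_le
    have hsq : (BTree.node l r).size ^ 2 ≤ N ^ 2 := Nat.pow_le_pow_left hB 2
    have h1 := oneClusterT_cost_le (I := I) (BTree.node l r).points hn (hp'.trans hB) hN0
    rw [BTree.size] at hB
    have h2 := mapT_cost_le (fun m =>
      if m = 1 then op (oneClusterT I (BTree.node l r).points).val
      else combineT (l.tableT I).val (r.tableT I).val m) (List.range' 1 I.k) (20 * N ^ 2)
      (fun m hm => by
        rw [List.mem_range'_1] at hm
        split_ifs
        · rw [op_cost]
          nlinarith
        · exact combineT_cost_le (tableT_isTable hall l) (tableT_length l) (tableT_length r)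
            (by lia) hk hN0)
    rw [List.length_range'] at h2
    have h3 := hl (by lia)
    have h4 := hr (by lia)
    have h5 : I.k * (20 * N ^ 2 + 2) ≤ N * (20 * N ^ 2 + 2) := by gcongr
    have h6 : N * (20 * N ^ 2 + 2) = 20 * N ^ 3 + 2 * N := by ring
    have h7 : 40 * N ^ 3 * (l.size + r.size + 1) =
      40 * N ^ 3 * l.size + 40 * N ^ 3 * r.size + 40 * N ^ 3 := by ring
    rw [BTree.size, h7]
    lia

theorem minPruningT_cost_le (hall : ∀ x, x ∈ I.pts) (hn : I.pts.length ≤ N) (hk : I.k ≤ N)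
    (T : CTree X) (hT : T.size ≤ N) : (minPruningT I T).cost ≤ 50 * N ^ 4 := by
  rw [minPruningT, bind_cost, bind_cost, bind_cost, op_cost]
  have hN0 : 0 < N := T.size_pos.trans_le hT
  have h1 := binaryT_cost_le T
  have h2 := (binaryT_size_le T).trans hT
  have h3 := tableT_cost_le hall hn hk T.binaryT.val h2
  have h4 := nthT_cost_le (T.binaryT.val.tableT I).val (I.k - 1)
  rw [tableT_length] at h4
  have h5 : 40 * N ^ 3 * T.binaryT.val.size ≤ 40 * N ^ 3 * N := by gcongr
  have h6 : 40 * N ^ 3 * N = 40 * N ^ 4 := by ring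
  have h7 : N ≤ N ^ 4 := Nat.le_self_pow (by lia) N
  lia

end DynamicCost

/-- The algorithm runs in polynomial time. -/
theorem algorithmT_cost_le {X : Type u} [DecidableEq X] (I : Input X) (hall : ∀ x, x ∈ I.pts)
    (hk : I.k ≤ I.pts.length) : (algorithmT I).cost ≤ 150 * sizeBound I.pts.length ^ 4 +
      50 * (sizeBound I.pts.length * (sizeBound I.pts.length + 1)) ^ 4 + 1 := by
  rw [algorithmT, bind_cost, bind_cost, bind_cost, op_cost]
  set N := sizeBound I.pts.length with hN
  have hn : I.pts.length ≤ N := by rw [hN, sizeBound]; lia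
  have hNM : N ≤ N * (N + 1) := by nlinarith
  have h1 := linkageT_cost_le I hN.ge
  have h2 := linkageT_size_le I
  have h3 := cleanT_cost_le I (linkageT I).val h2
  have h4 := cleanT_size_le I (linkageT I).val h2
  have h5 := minPruningT_cost_le hall (hn.trans hNM) ((hk.trans hn).trans hNM) _ h4
  lia

-- From resilience to the output of the algorithm.

section Main

variable {X : Type u} [Fintype X] [DecidableEq X] [MetricSpace X] {k : ℕ}

/-- A resilient instance has well separated groups of good points. -/
theorem exists_isCore {f : X → Fin k} {c : Fin k → X} (hopt : IsOptimalWith f c)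
    (hk : k < Fintype.card X) {α ε : ℝ} (hα : 2 + Real.sqrt 7 < α)
    (hres : IsResilient dist α ε f) (hε : ε ≤ rho f / 5) :
    ∃ (q : Fin k → X) (bad : Finset X),
      IsCore f c q bad (minClusterSize f) (ε * Fintype.card X) := by
  classical
  have hsq : (0 : ℝ) ≤ Real.sqrt 7 := Real.sqrt_nonneg 7
  have hsq2 : Real.sqrt 7 * Real.sqrt 7 = 7 := Real.mul_self_sqrt (by norm_num)
  have hα3 : 3 ≤ α := by nlinarith
  -- Equivalent to α² - 4α - 3 ≥ 0, whose larger root is 2 + √7.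
  have hα2 : 3 * (1 + α) ≤ α * (α - 1) := by nlinarith
  have hn : (0 : ℝ) < Fintype.card X := by exact_mod_cast (by lia : 0 < Fintype.card X)
  -- Nonnegativity of ε n comes from resilience itself, applied to the unperturbed distance and to
  -- f.
  have hδ : 0 ≤ ε * Fintype.card X := by
    obtain ⟨σ, hσ⟩ := hres.2 dist (fun x y => ⟨le_rfl,
      le_mul_of_one_le_left dist_nonneg (by linarith)⟩) f ⟨c, hopt⟩
    exact le_trans (Nat.cast_nonneg _) hσ
  have hm : 5 * (ε * Fintype.card X) + 15 ≤ minClusterSize f := by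
    rw [rho, div_div, le_div_iff₀ (by positivity)] at hε
    linarith
  have hcard := card_not_good_le hopt hk hα3 hres hδ fun i => hm.trans
    (by exact_mod_cast minClusterSize_le f i)
  have hgood : ∀ i, IsGood α f c (c i) := by
    intro i j hj
    rw [hopt.apply_center hk] at hj ⊢
    rw [dist_self, mul_zero, dist_pos]
    exact fun h => hj (hopt.injective hk h).symm
  -- The farthest good point of cluster i from its center; its distance is the radius of the group.
  have hq : ∀ i, ∃ p, (IsGood α f c p ∧ f p = i) ∧
      ∀ x, IsGood α f c x → f x = i → dist x (c i) ≤ dist (c i) p := by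
    intro i
    obtain ⟨p, hp, hmax⟩ := Finset.exists_max_image
      (Finset.univ.filter fun x => IsGood α f c x ∧ f x = i) (fun x => dist (c i) x)
      ⟨c i, by simp [hgood i, hopt.apply_center hk i]⟩
    refine ⟨p, by simpa using hp, fun x hx hxi => ?_⟩
    rw [dist_comm]
    exact hmax x (by simp [hx, hxi])
  choose q hq1 hq2 using hq
  refine ⟨q, {x | ¬ IsGood α f c x}.toFinset, hδ, hm, minClusterSize_le f, ?_, ?_,
    hopt.apply_center hk, ?_, ?_⟩
  · rwa [← Set.ncard_eq_toFinset_card']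
  · intro i
    simpa using hgood i
  · intro x hx
    simp only [Set.mem_toFinset, Set.mem_ofPred_eq, not_not] at hx
    exact hq2 _ x hx rfl
  · intro x hx i hi
    simp only [Set.mem_toFinset, Set.mem_ofPred_eq, not_not] at hx
    have h1 := hx i hi
    have h2 := (hq1 i).1 (f x) (by rw [(hq1 i).2]; exact hi.symm)
    rw [(hq1 i).2, dist_comm (q i) (c i)] at h2
    have h3 := dist_triangle (q i) (c i) (c (f x))
    rw [dist_comm (q i) (c i)] at h3
    have h4 := dist_triangle_left (c i) (c (f x)) x
    have h5 : 0 ≤ dist (c i) (q i) := dist_nonneg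
    -- Goodness of q i puts every other center farther than (α-1)R from c i. Goodness of x bounds
    -- d(x, c (f x)) by d(x, c i)/α, so d(x, c i) > α(α-1)/(α+1) R ≥ 3R.
    have h6 : (α - 1) * dist (c i) (q i) < dist x (c i) + dist x (c (f x)) := by linarith
    have h7 : α * ((α - 1) * dist (c i) (q i)) < α * (dist x (c i) + dist x (c (f x))) :=
      mul_lt_mul_of_pos_left h6 (by linarith)
    have h8 : 3 * (1 + α) * dist (c i) (q i) ≤ α * (α - 1) * dist (c i) (q i) :=
      mul_le_mul_of_nonneg_right hα2 h5
    have h9 : (1 + α) * (3 * dist (c i) (q i)) < (1 + α) * dist x (c i) := by linarith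
    exact lt_of_mul_lt_mul_left h9 (by linarith)

theorem nodup_flatten_of_perm {P : List (List X)} {pts : List X} (hnd : pts.Nodup)
    (hall : ∀ x, x ∈ pts) (h : P.flatten.Perm pts) :
    P.flatten.Nodup ∧ ∀ x, x ∈ P.flatten :=
  ⟨h.nodup_iff.mpr hnd, fun x => h.mem_iff.mpr (hall x)⟩

/-- The cost of a clustering that differs from `f` only in few points. -/
theorem cost_le_of_reassign {f h : X → Fin k} {c : Fin k → X} {bad : Finset X} {δ M ε' : ℝ}
    (hh : ∀ x ∉ bad, h x = f x) (hbad : (bad.card : ℝ) ≤ δ) (hM : 5 * δ ≤ M * ε')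
    (hδM : 5 * δ ≤ M) (hε' : 0 ≤ ε')
    (hcost : ∀ x, h x ≠ f x → M * (dist x (c (h x)) - dist x (c (f x))) ≤
      5 * ∑ x, dist x (c (f x))) :
    ∑ x, dist x (c (h x)) ≤ (1 + ε') * ∑ x, dist x (c (f x)) := by
  set O := ∑ x, dist x (c (f x)) with hO
  have hO0 : 0 ≤ O := Finset.sum_nonneg fun _ _ => dist_nonneg
  suffices h1 : ∑ x, (dist x (c (h x)) - dist x (c (f x))) ≤ ε' * O by
    rw [Finset.sum_sub_distrib] at h1
    linarith
  have h2 : ∑ x, (dist x (c (h x)) - dist x (c (f x))) =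
      ∑ x ∈ bad, (dist x (c (h x)) - dist x (c (f x))) := by
    symm
    refine Finset.sum_subset (Finset.subset_univ _) fun x _ hx => ?_
    rw [hh x hx, sub_self]
  have hM0 : 0 ≤ M := by linarith [Nat.cast_nonneg (α := ℝ) bad.card]
  -- If M = 0 then δ ≤ 0, so there are no bad points and nothing is mislabelled.
  rcases hM0.eq_or_lt with hM0 | hM0
  · have h3 : bad = ∅ := by
      rw [← Finset.card_eq_zero]
      have : (bad.card : ℝ) ≤ 0 := by linarith
      exact_mod_cast le_antisymm this (Nat.cast_nonneg _)
    rw [h2, h3, Finset.sum_empty]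
    exact mul_nonneg hε' hO0
  · have h3 : M * ∑ x ∈ bad, (dist x (c (h x)) - dist x (c (f x))) ≤ bad.card * (5 * O) := by
      rw [Finset.mul_sum, ← nsmul_eq_mul]
      refine Finset.sum_le_card_nsmul _ _ _ fun x _ => ?_
      by_cases hx : h x = f x
      · rw [hx, sub_self, mul_zero]; positivity
      · exact hcost x hx
    have h4 : M * ∑ x ∈ bad, (dist x (c (h x)) - dist x (c (f x))) ≤ M * (ε' * O) := by
      nlinarith
    rw [h2]
    exact le_of_mul_le_mul_left h4 hM0

/-- The cleaned tree has a pruning that is close to the optimal clustering, and the dynamic program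
finds a clustering that is at least as cheap as this pruning. -/
theorem algorithmT_val_spec {f : X → Fin k} {c q : Fin k → X} {bad : Finset X} {I : Input X}
    (hcore : IsCore f c q bad I.m (I.ε * Fintype.card X)) (hd : I.d = dist) (hk : I.k = k)
    (hnd : I.pts.Nodup) (hall : ∀ x, x ∈ I.pts) [hX : Nonempty X] :
    (∃ (P : List (List X)) (g : X → Fin k), IsPruning (algorithmT I).val.tree P ∧
      Represents P g ∧ IsClose I.ε f g) ∧
    ∃ (C : List (List X × X)) (g : X → Fin k) (b : Fin k → X),
      (algorithmT I).val.clustering = some C ∧ RepresentsWithCenters C g b ∧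
      ∀ ε' : ℝ, 0 ≤ ε' → 5 * (I.ε * Fintype.card X) ≤ ((I.m : ℝ) - 15) * ε' →
        cost dist g b ≤ (1 + ε') * cost dist f c := by
  have hlen : I.pts.length = Fintype.card X := by
    rw [← List.toFinset_card_of_nodup hnd, ← Finset.card_univ]
    congr 1
    ext x
    simp [hall x]
  set δ := I.ε * (Fintype.card X : ℝ) with hδ
  set T := (linkageT I).val with hTdef
  obtain ⟨hT, hperm, hs⟩ := linkageT_spec (by rwa [hlen]) hd hnd hall
  rw [hlen, ← hδ, ← hTdef] at hT
  rw [← hTdef] at hperm hs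
  have hTnd : T.points.Nodup := hperm.nodup_iff.mpr hnd
  have hTall : ∀ x, x ∈ T.points := fun x => hperm.mem_iff.mpr (hall x)
  obtain ⟨Ps, h1, h2, h3, h4, h5, h6⟩ := exists_pruning hcore (assignment I T) hT hs hTnd
    fun _ _ _ y _ _ => hTall y
  rw [← cleanT_val] at h1 h2
  set fill : List X → List X := fun L => (fillLeafT (assignment I T) L).val with hfill
  have hPlen : Ps.length = k := by
    have h7 : (Ps.map Prod.fst).toFinset = Finset.univ := by
      ext i
      rw [List.mem_toFinset, h6]
      simp only [Finset.mem_univ, iff_true]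
      exact ⟨c i, hTall _, hcore.center_good i, hcore.center_apply i⟩
    have h8 := List.toFinset_card_of_nodup h5
    rw [h7, Finset.card_univ, Fintype.card_fin, List.length_map] at h8
    exact h8.symm
  have hfillperm := fill_perm hcore hT hs hTnd
  have hflat : (Ps.map fun a => a.2.flatMap fill).flatten.Perm I.pts := by
    have h7 : (Ps.map fun a => a.2.flatMap fill).flatten = (bigLeaves T).flatMap fill := by
      rw [← h3]
      clear * -
      induction Ps with
      | nil => rfl
      | cons a l ih => simp [ih]
    rw [h7]
    exact hfillperm.trans hperm
  obtain ⟨hPnd, hPall⟩ := nodup_flatten_of_perm hnd hall hflat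
  obtain ⟨g, hg⟩ := exists_index_of_nodup_flatten (k := k) _ (by rw [List.length_map, hPlen])
    hPnd hPall
  have hlt : ∀ i : Fin k, (i : ℕ) < Ps.length := fun i => by rw [hPlen]; exact i.2
  have hinj : Function.Injective fun i : Fin k => (Ps[(i : ℕ)]'(hlt i)).1 := by
    intro i j hij
    have h7 := (List.Nodup.getElem_inj_iff h5 (i := i) (j := j)
      (hi := by simpa using hlt i) (hj := by simpa using hlt j)).mp (by simpa using hij)
    exact Fin.ext h7
  -- The parts carry distinct groups and there are k of them, so translating positions in the list
  -- into groups is a permutation.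
  set τ : Equiv.Perm (Fin k) := Equiv.ofBijective _ (Finite.injective_iff_bijective.mp hinj)
    with hτ
  have hτv : ∀ i : Fin k, τ i = (Ps[(i : ℕ)]'(hlt i)).1 := fun i => rfl
  have hleaf : ∀ x, ∃ L ∈ bigLeaves T, x ∈ fill L ∧ ∃ y ∈ L, y ∉ bad ∧ f y = τ (g x) := by
    intro x
    have h7 := (hg x (g x) (by simpa using hlt (g x))).mpr rfl
    rw [List.getElem_map, List.mem_flatMap] at h7
    obtain ⟨L, hL, hxL⟩ := h7
    have hmem := List.getElem_mem (hlt (g x))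
    have hLbig : L ∈ bigLeaves T := by
      rw [← h3]
      exact List.mem_flatten.mpr ⟨_, List.mem_map.mpr ⟨_, hmem, rfl⟩, hL⟩
    obtain ⟨y, hy, hyb⟩ := (isDense_of_mem_bigLeaves hcore hT hLbig).exists_good hcore
      (nodup_of_mem_bigLeaves hT hTnd hLbig)
    exact ⟨L, hLbig, hxL, y, hy, hyb, h4 _ hmem L hL y hy hyb⟩
  have hlab : ∀ x ∉ bad, τ (g x) = f x := by
    intro x hx
    obtain ⟨L, hL, hxL, y, hy, hyb, hyx⟩ := hleaf x
    rw [← hyx]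
    exact eq_of_mem_fill hcore hd hT hs hTnd hTall hL hx hxL hy hyb
  refine ⟨⟨_, g, h1, represents_of_index (by rw [List.length_map, hPlen]) hg, τ.symm, ?_⟩, ?_⟩
  · rw [sum_card_cluster_sdiff]
    refine le_trans ?_ hcore.card_bad
    norm_cast
    refine Finset.card_le_card fun x hx => ?_
    by_contra hxb
    rw [Set.mem_toFinset, Set.mem_ofPred_eq, ← hlab x hxb, Equiv.symm_apply_apply] at hx
    exact hx rfl
  -- The comparison solution of the dynamic program: the constructed pruning, each part with the
  -- optimal center of its group.
  · set C₀ : List (List X × X) := Ps.map fun a => (a.2.flatMap fill, c a.1) with hC₀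
    have hC₀fst : C₀.map Prod.fst = Ps.map fun a => a.2.flatMap fill := by
      rw [hC₀, List.map_map]; rfl
    have hC₀len : C₀.length = k := by rw [hC₀, List.length_map, hPlen]
    rw [← hC₀fst] at h2
    have hkpos : 0 < k := (f hX.some).pos
    obtain ⟨D, hD, hDp, hDlen, hDcost⟩ := minPruningT_spec hall (cleanT I T).val
      (by rw [hk]; exact hkpos) h2 (by rw [hC₀len, hk])
    rw [hk] at hDlen
    have hDperm : (D.map Prod.fst).flatten.Perm I.pts := by
      rw [hDp.flatten_eq, ← h2.flatten_eq, hC₀fst]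
      exact hflat
    obtain ⟨hDnd, hDall⟩ := nodup_flatten_of_perm hnd hall hDperm
    obtain ⟨g', hg'⟩ := exists_index_of_nodup_flatten (k := k) _
      (by rw [List.length_map, hDlen]) hDnd hDall
    have hrepD := representsWithCenters_of_index hDlen hg'
    have hrepC := representsWithCenters_of_index (C := C₀) (g := g) hC₀len (by
      rw [hC₀fst]; exact hg)
    refine ⟨D, g', _, hD, hrepD, fun ε' hε'0 hε' => ?_⟩
    have hcD := cost_eq_listCost (I := I) hrepD fun a ha =>
      (List.nodup_flatten.mp hDnd).1 _ (List.mem_map.mpr ⟨a, ha, rfl⟩)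
    have hcC := cost_eq_listCost (I := I) hrepC fun a ha => by
      rw [← hC₀fst] at hPnd
      exact (List.nodup_flatten.mp hPnd).1 _ (List.mem_map.mpr ⟨a, ha, rfl⟩)
    rw [← hcD, ← hcC, hd] at hDcost
    refine hDcost.trans ?_
    rw [cost_eq_sum, cost_eq_sum]
    have hsum : ∑ x, dist x ((C₀[(g x : ℕ)]'(by rw [hC₀len]; exact (g x).2)).2) =
        ∑ x, dist x (c (τ (g x))) := by
      refine Finset.sum_congr rfl fun x _ => ?_
      rw [hτv]
      simp [hC₀]
    refine hsum.le.trans ?_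
    refine cost_le_of_reassign (h := fun x => τ (g x)) hlab hcore.card_bad hε'
      (by linarith [hcore.size_le]) hε'0 fun x hx => ?_
    obtain ⟨L, hL, hxL, y, hy, hyb, hyx⟩ := hleaf x
    beta_reduce at hx ⊢
    rw [← hyx] at hx ⊢
    exact mul_dist_sub_le hcore hd hT hs hTnd hTall hL hxL hy hyb hx

end Main

end KMedian

theorem mainTheorem3 :
    ∃ time : Polynomial ℕ,
      ∀ (X : Type u) [Fintype X] [DecidableEq X] [MetricSpace X] (k : ℕ) (f : X → Fin k) (α ε : ℝ)
        (pts : List X),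
        pts.Nodup → (∀ x, x ∈ pts) →
        k < Fintype.card X →
        KMedian.IsResilient dist α ε f →
        2 + Real.sqrt 7 < α →
        ε ≤ KMedian.rho f / 5 →
        let run := KMedian.algorithmT (KMedian.Input.mk pts dist k (KMedian.minClusterSize f) ε)
        run.cost ≤ time.eval (Fintype.card X) ∧
        (∃ (P : List (List X)) (g : X → Fin k),
          KMedian.IsPruning run.val.tree P ∧ KMedian.Represents P g ∧ KMedian.IsClose ε f g) ∧
        ∀ ε' : ℝ, 0 ≤ ε' → ε' ≤ 1 → ε ≤ KMedian.rho f * ε' / 5 →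
          ∃ (C : List (List X × X)) (g : X → Fin k) (b : Fin k → X),
            run.val.clustering = some C ∧ KMedian.RepresentsWithCenters C g b ∧
            KMedian.IsApproximation dist (1 + ε') g b := by
  let P : Polynomial ℕ := 3 * Polynomial.X ^ 2 + 3 * Polynomial.X + 2
  refine ⟨150 * P ^ 4 + 50 * (P * (P + 1)) ^ 4 + 1, ?_⟩
  intro X _ _ _ k f α ε pts hnd hall hk hres hα hε run
  obtain ⟨c, hc⟩ := hres.1
  have hn : 0 < Fintype.card X := by lia
  have : Nonempty X := Fintype.card_pos_iff.mp hn
  obtain ⟨q, bad, hcore⟩ := KMedian.exists_isCore hc hk hα hres hε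
  have hlen : pts.length = Fintype.card X := by
    rw [← List.toFinset_card_of_nodup hnd, ← Finset.card_univ]
    congr 1
    ext x
    simp [hall x]
  obtain ⟨hclose, C, g, b, hC, hrep, hcost⟩ := KMedian.algorithmT_val_spec
    (I := ⟨pts, dist, k, KMedian.minClusterSize f, ε⟩) hcore rfl rfl hnd hall
  refine ⟨?_, hclose, fun ε' h0 _ hε' => ⟨C, g, b, hC, hrep, fun g' b' => ?_⟩⟩
  · have h1 := KMedian.algorithmT_cost_le
      (⟨pts, dist, k, KMedian.minClusterSize f, ε⟩ : KMedian.Input X) hall (by rw [hlen]; exact hk.le)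
    simp only [hlen] at h1
    simpa [P, KMedian.sizeBound] using h1
  · refine (hcost ε' h0 ?_).trans (mul_le_mul_of_nonneg_left (hc g' b') (by linarith))
    have hn' : (0 : ℝ) < Fintype.card X := by exact_mod_cast hn
    -- Clearing denominators, the hypothesis on ε' becomes 5εn ≤ (m - 15)ε'.
    rw [KMedian.rho, div_mul_eq_mul_div, div_div, le_div_iff₀ (by positivity)] at hε'
    linarith
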